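/- Let $\mathbb T^d=[-\pi,\pi]^d$ with periodic boundary conditions and let $v$ be the cellular flow $$v(x_1,x_2)=\nabla^\perp(\sin x_1\sin x_2)=(-\sin x_1\cos x_2,\ \cos x_1\sin x_2).$$ For every integer $k\ge 3$ there is a constant $C>0$, depending only on $k$, such that the following holds. Let $g_0\in H^k(\mathbb T^2)$ be real valued (identified with its $C^1$ representative) with $\nabla g_0(0,0)\ne 0$, and set $$B_0(x)=(v(x_1,x_2),g_0(x_1,x_2)),\qquad u_0(x)=(0,0,(v\cdot\nabla g_0)(x_1,x_2)),\qquad x\in\mathbb T^3 .$$ Then the three-dimensional magnetic relaxation equations (MRE) with $\gamma=0$, $$\partial_t B+u\cdot\nabla B=B\cdot\nabla u,\qquad u=B\cdot\nabla B+\nabla p,\qquad \operatorname{div}u=\operatorname{div}B=0\qquad\text{on }\mathbb T^3,$$ have a global solution with $B\in C^0([0,\infty);H^k(\mathbb T^3))$, $u\in C^0([0,\infty);H^{k-1}(\mathbb T^3))$, $u$ of zero mean, and $B(\cdot,0)=B_0$, $u(\cdot,0)=u_0$ (the evolution equation for $B$ holding in the sense of distributions in $x$ at each time). It is unique: every solution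 in the same class on an interval $[0,T)$, $T>0$, with initial magnetic field $B_0$ coincides with it on $[0,T)$. It has the form $B=(v,g)$, $u=(0,0,v\cdot\nabla g)$ with $g=g(x_1,x_2,t)$, $g\in C^0([0,\infty);H^k(\mathbb T^2))$, solving the rank-one diffusion equation $$\partial_t g=(v\cdot\nabla)^2g,\qquad g(\cdot,0)=g_0$$ (in the sense of distributions in $(x_1,x_2)$). For every $t\ge0$ the field $B(\cdot,t)$ is $C^1$ and $$|\nabla g_0(0,0)|\,e^t\ \le\ \|\nabla B(\cdot,t)\|_{L^\infty(\mathbb T^3)}\ \le\ C\,\|B_0\|_{H^k(\mathbb T^3)}\,e^{Ct}.$$ -/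

import Mathlib

open scoped ContDiff Topology

namespace MRE

noncomputable section

/-- `ℝ^d` with its Euclidean norm. Functions on the torus `𝕋^d = [-π, π]^d` are functions on `ℝ^d`
that are `2π`-periodic in every coordinate. -/
abbrev Euc (d : ℕ) : Type := EuclideanSpace ℝ (Fin d)

/-- The period cell `[-π, π]^d`. -/
def cell (d : ℕ) : Set (Euc d) :=
  {x | ∀ i, x i ∈ Set.Icc (-Real.pi) Real.pi}

/-- `2π`-periodicity in every coordinate. -/
def Periodic {d : ℕ} {F : Type*} (f : Euc d → F) : Prop :=
  ∀ (i : Fin d) (x : Euc d), f (x + EuclideanSpace.single i (2 * Real.pi)) = f x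

/-- The Fourier coefficient `(2π)^{-d} ∫_{[-π,π]^d} f(x) e^{-i n·x} dx`. -/
def fourierCoeff {d : ℕ} (f : Euc d → ℝ) (n : Fin d → ℤ) : ℂ :=
  (((2 * Real.pi) ^ d : ℝ) : ℂ)⁻¹ *
    ∫ x in cell d, (f x : ℂ) * Complex.exp (-(Complex.I * ∑ i, (n i : ℂ) * (x i : ℂ)))

/-- The square `∑_n (1 + |n|²)^k |f̂(n)|²` of the `H^k(𝕋^d)` norm (possibly `⊤`). -/
def sobolevSq {d : ℕ} (k : ℕ) (f : Euc d → ℝ) : ENNReal :=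
  ∑' n : Fin d → ℤ,
    ENNReal.ofReal ((1 + ∑ i, (n i : ℝ) ^ 2) ^ k) * ‖fourierCoeff f n‖ₑ ^ 2

/-- The `H^k(𝕋^d)` norm of a scalar function. -/
def sobolevNorm {d : ℕ} (k : ℕ) (f : Euc d → ℝ) : ENNReal :=
  sobolevSq k f ^ (1 / 2 : ℝ)

/-- The `H^k(𝕋^d)` norm of a vector field. -/
def vecSobolevNorm {d m : ℕ} (k : ℕ) (f : Euc d → Euc m) : ENNReal :=
  (∑ i, sobolevSq k (fun x => f x i)) ^ (1 / 2 : ℝ)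

/-- Membership in `H^k(𝕋^d)` for a scalar function. Only used for `k > d/2`, where every element
of `H^k` has a unique continuous representative; that representative is the one meant. -/
def MemSobolev {d : ℕ} (k : ℕ) (f : Euc d → ℝ) : Prop :=
  Continuous f ∧ Periodic f ∧ sobolevNorm k f < ⊤

/-- Membership in `H^k(𝕋^d)` for a vector field, with the same convention. -/
def VecMemSobolev {d m : ℕ} (k : ℕ) (f : Euc d → Euc m) : Prop :=
  Continuous f ∧ Periodic f ∧ vecSobolevNorm k f < ⊤

/-- The directional derivative `(v · ∇) f`. -/
def advect {d : ℕ} (v : Euc d → Euc d) (f : Euc d → ℝ) : Euc d → ℝ :=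
  fun x => fderiv ℝ f x (v x)

/-- `div w = 0` on the torus, in the sense of distributions. -/
def DivFree {d : ℕ} (w : Euc d → Euc d) : Prop :=
  ∀ φ : Euc d → ℝ, ContDiff ℝ ∞ φ → Periodic φ → ∫ x in cell d, fderiv ℝ φ x (w x) = 0

/-- `(B, u)` is an `H^k` solution on the time interval `I` of the three-dimensional magnetic
relaxation equations with `γ = 0`,
`∂_t B + u · ∇B = B · ∇u`, `u = B · ∇B + ∇p`, `div u = div B = 0`, on `𝕋³`,
with `B ∈ C⁰(I; H^k)`, `u ∈ C⁰(I; H^{k-1})` and `u` of zero mean.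
Since `∇u` need not be continuous, the evolution equation is required in the sense of
distributions in `x`: since `u` and `B` are divergence free, for a test field `Φ` one has
`∫ (B · ∇u - u · ∇B) · Φ = ∫ B · (u · ∇Φ) - u · (B · ∇Φ)`. -/
structure IsMRESolution (k : ℕ) (I : Set ℝ) (B u : ℝ → Euc 3 → Euc 3) : Prop where
  mem_B : ∀ t ∈ I, VecMemSobolev k (B t)
  cont_B : ∀ t₀ ∈ I, Filter.Tendsto (fun t => vecSobolevNorm k (B t - B t₀)) (𝓝[I] t₀) (𝓝 0)
  mem_u : ∀ t ∈ I, VecMemSobolev (k - 1) (u t)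
  cont_u : ∀ t₀ ∈ I,
    Filter.Tendsto (fun t => vecSobolevNorm (k - 1) (u t - u t₀)) (𝓝[I] t₀) (𝓝 0)
  mean_u : ∀ t ∈ I, ∫ x in cell 3, u t x = 0
  div_B : ∀ t ∈ I, DivFree (B t)
  div_u : ∀ t ∈ I, DivFree (u t)
  constitutive : ∀ t ∈ I, ∃ p : Euc 3 → ℝ, ContDiff ℝ 1 p ∧ Periodic p ∧
    ∀ x, u t x = fderiv ℝ (B t) x (B t x) + gradient p x
  evolution : ∀ t ∈ I, ∀ Φ : Euc 3 → Euc 3, ContDiff ℝ ∞ Φ → Periodic Φ →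
    HasDerivWithinAt (fun s => ∫ x in cell 3, inner ℝ (B s x) (Φ x))
      (∫ x in cell 3,
        (inner ℝ (B t x) (fderiv ℝ Φ x (u t x)) - inner ℝ (u t x) (fderiv ℝ Φ x (B t x)))) I t

/-- The cellular flow `∇^⊥ (sin x₁ sin x₂) = (-sin x₁ cos x₂, cos x₁ sin x₂)`. -/
def cellularFlow : Euc 2 → Euc 2 :=
  fun x => !₂[-(Real.sin (x 0) * Real.cos (x 1)), Real.cos (x 0) * Real.sin (x 1)]

/-- `g ∈ C⁰(I; H^k(𝕋²))` solves the rank-one diffusion equation `∂_t g = (v · ∇)² g`, with `v` the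
cellular flow, in the sense of distributions in `x`; since `v` is divergence free, the operator
`(v · ∇)²` is its own formal adjoint. -/
structure IsRankOneSolution (k : ℕ) (I : Set ℝ) (g : ℝ → Euc 2 → ℝ) : Prop where
  mem : ∀ t ∈ I, MemSobolev k (g t)
  cont : ∀ t₀ ∈ I, Filter.Tendsto (fun t => sobolevNorm k (g t - g t₀)) (𝓝[I] t₀) (𝓝 0)
  evolution : ∀ t ∈ I, ∀ φ : Euc 2 → ℝ, ContDiff ℝ ∞ φ → Periodic φ →
    HasDerivWithinAt (fun s => ∫ x in cell 2, g s x * φ x)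
      (∫ x in cell 2, g t x * advect cellularFlow (advect cellularFlow φ) x) I t

/-- The horizontal part `x_H = (x₁, x₂)` of `x ∈ ℝ³`. -/
def horiz (x : Euc 3) : Euc 2 := !₂[x 0, x 1]

/-- The field `x ↦ (w(x_H), h(x_H))` on `ℝ³`, independent of `x₃`. -/
def twoHalf (w : Euc 2 → Euc 2) (h : Euc 2 → ℝ) : Euc 3 → Euc 3 :=
  fun x => !₂[w (horiz x) 0, w (horiz x) 1, h (horiz x)]

/-- The `L^∞(𝕋³)` norm of the gradient (Jacobian matrix, with its operator norm) of a field. -/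
def gradSupNorm (f : Euc 3 → Euc 3) : ENNReal :=
  MeasureTheory.eLpNorm (fderiv ℝ f) ⊤ (MeasureTheory.volume.restrict (cell 3))

end

end MRE

/-! Reduction. For B = (v, g) and u = (0, 0, v·∇g), all independent of x₃, the term v·∇v is a
gradient and goes into the pressure, u·∇B vanishes because u is vertical, and B·∇u = (0, 0,
(v·∇)²g). MRE becomes the linear scalar equation ∂_t g = A²g with A = v·∇.

Existence and upper bound. In Fourier variables A is a real matrix coupling n only to n + (±1, ±1),
and it is skew because div v = 0. For a weight w and z = Ac this gives ⟨wc, A²c⟩ = -⟨wz, z⟩ - ⟨[A,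
w]c, z⟩. Young's inequality absorbs z, and for w = (1 + |n|²)^k the commutator is harmless: A has
order one and w changes by a relative amount O(1/|n|) between neighbours (`energy_deriv_le`,
`cellKer_commutator`). The bound is uniform over Galerkin truncations. A limit along one fixed
ultrafilter of finite frequency sets gives a linear solution operator `flow` of at most exponential
growth in H^k, and Sobolev embedding bounds the gradient. Rough data are handled by density of
trigonometric polynomials.

Lower bound. The flow v vanishes at 0 with Dv(0) = diag(-1, 1), so ∇(Af)(0) = Dv(0)ᵀ∇f(0) and
∇(A²f)(0) = ∇f(0). The gradient of g at the stagnation point therefore solves y' = y (`opA_phaseL`,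
`fderiv_synth_flow_zero`).

Uniqueness. Let b = B₂ - B₁, w = u₂ - u₁, and let q be the difference of the pressures. The L²
energy identity for b contains the dissipation -‖w‖². The remaining terms must be bounded by ‖b‖²
although b·∇b is not controlled by b and ∇u₁ need not be bounded. Two facts help. First, B₁·∇b = w -
b·∇B₂ - ∇q, so derivatives of b along B₁ are under control; ∇q itself is controlled because it is
orthogonal to the divergence-free fields w and [B₂, b]. Second, u₁ is vertical and equal to
(B₁·∇B₁,₃)e₃, so the dangerous product (B₁·∇B₁,₃)(b·∇b₃) can be traded for (b·∇B₁,₃)(B₁·∇b₃) and a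
term with [B₁, b], by the identity `DivFree.commutator`. Only first derivatives of the fields occur.
The pointwise inequality is `energy_pointwise`; Gronwall concludes in `IsMRESolution.unique`. -/

namespace MRE

noncomputable section

open MeasureTheory Set Filter

/-! ### Integration over the period cell. -/

section Cell

variable {d : ℕ}

theorem cell_eq_preimage (d : ℕ) :
    cell d = (WithLp.ofLp : Euc d → (Fin d → ℝ)) ⁻¹'
      (Set.pi univ fun _ => Icc (-Real.pi) Real.pi) := by
  ext x; simp only [cell, mem_ofPred_eq, mem_preimage, Set.mem_pi, mem_univ, true_implies]

theorem isCompact_cell (d : ℕ) : IsCompact (cell d) := by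
  rw [cell_eq_preimage]
  exact (PiLp.homeomorph 2 (fun _ : Fin d => ℝ)).isCompact_preimage.2
    (isCompact_univ_pi fun _ => isCompact_Icc)

theorem measurableSet_cell (d : ℕ) : MeasurableSet (cell d) :=
  (isCompact_cell d).measurableSet

theorem integrableOn_cell {E : Type*} [NormedAddCommGroup E] {f : Euc d → E}
    (hf : Continuous f) : IntegrableOn f (cell d) :=
  hf.continuousOn.integrableOn_compact (isCompact_cell d)

theorem setIntegral_cell_eq_pi {E : Type*} [NormedAddCommGroup E] [NormedSpace ℝ E]
    (f : Euc d → E) :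
    ∫ x in cell d, f x =
      ∫ y in Set.pi univ fun _ : Fin d => Icc (-Real.pi) Real.pi, f (WithLp.toLp 2 y) := by
  rw [cell_eq_preimage]
  have := (PiLp.volume_preserving_ofLp (Fin d)).setIntegral_preimage_emb
    (MeasurableEquiv.toLp 2 (Fin d → ℝ)).symm.measurableEmbedding
    (fun y => f (WithLp.toLp 2 y)) (Set.pi univ fun _ => Icc (-Real.pi) Real.pi)
  simpa using this

theorem volume_real_cell (d : ℕ) : (volume : Measure (Euc d)).real (cell d) = (2 * Real.pi) ^ d := by
  rw [cell_eq_preimage, Measure.real,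
    (PiLp.volume_preserving_ofLp (Fin d)).measure_preimage
      (MeasurableSet.univ_pi fun _ => measurableSet_Icc).nullMeasurableSet, volume_pi_pi]
  simp [Real.pi_pos.le, two_mul]

/-- Insert the coordinate `s` at position `i`. -/
def ins (i : Fin (d + 1)) (s : ℝ) (y : Euc d) : Euc (d + 1) :=
  WithLp.toLp 2 (i.insertNth s (WithLp.ofLp y) : Fin (d + 1) → ℝ)

theorem ins_add_single (i : Fin (d + 1)) (s h : ℝ) (y : Euc d) :
    ins i s y + EuclideanSpace.single i h = ins i (s + h) y := by
  ext j
  refine Fin.succAboveCases i ?_ (fun j => ?_) j <;> simp [ins]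

theorem continuous_ins (i : Fin (d + 1)) :
    Continuous fun p : ℝ × Euc d => ins i p.1 p.2 := by
  unfold ins
  fun_prop

theorem integral_cell_succ {E : Type*} [NormedAddCommGroup E] [NormedSpace ℝ E]
    (i : Fin (d + 1)) {f : Euc (d + 1) → E} (hf : Continuous f) :
    ∫ x in cell (d + 1), f x = ∫ y in cell d, ∫ s in (-Real.pi)..Real.pi, f (ins i s y) := by
  rw [setIntegral_cell_eq_pi]
  have hmp := (volume_preserving_piFinSuccAbove (fun _ : Fin (d + 1) => ℝ) i).symm
  rw [← hmp.setIntegral_preimage_emb (MeasurableEquiv.measurableEmbedding _)]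
  have hset : (MeasurableEquiv.piFinSuccAbove (fun _ : Fin (d + 1) => ℝ) i).symm ⁻¹'
      (Set.pi univ fun _ => Icc (-Real.pi) Real.pi) =
      Icc (-Real.pi) Real.pi ×ˢ (Set.pi univ fun _ : Fin d => Icc (-Real.pi) Real.pi) := by
    ext ⟨s, y⟩
    simp only [mem_preimage, Set.mem_pi, mem_univ, true_implies, mem_prod]
    rw [Fin.forall_iff_succAbove i]
    simp
  rw [hset, Measure.volume_eq_prod, ← setIntegral_prod_swap, setIntegral_prod,
    setIntegral_cell_eq_pi]
  · refine setIntegral_congr_fun (MeasurableSet.univ_pi fun _ => measurableSet_Icc) fun y _ => ?_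
    simp only
    rw [intervalIntegral.integral_of_le (by linarith [Real.pi_pos]), ← integral_Icc_eq_integral_Ioc]
    rfl
  · refine ContinuousOn.integrableOn_compact
      ((isCompact_univ_pi fun _ => isCompact_Icc).prod isCompact_Icc) (Continuous.continuousOn ?_)
    have : Continuous fun z : (Fin d → ℝ) × ℝ => ins i z.2 (WithLp.toLp 2 z.1) :=
      (continuous_ins i).comp (by fun_prop : Continuous fun z : (Fin d → ℝ) × ℝ =>
        ((z.2, WithLp.toLp 2 z.1) : ℝ × Euc d))
    exact hf.comp this

/-- The integral over the period cell of a derivative in a coordinate direction vanishes. -/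
theorem integral_cell_deriv_eq_zero {E : Type*} [NormedAddCommGroup E] [NormedSpace ℝ E]
    [CompleteSpace E] (i : Fin d) {F F' : Euc d → E}
    (hF : ∀ x, HasDerivAt (fun s : ℝ => F (x + EuclideanSpace.single i s)) (F' x) 0)
    (hF' : Continuous F')
    (hper : ∀ x, F (x + EuclideanSpace.single i (2 * Real.pi)) = F x) : ∫ x in cell d, F' x = 0 := by
  cases d with
  | zero => exact i.elim0
  | succ d =>
    rw [integral_cell_succ i hF']
    refine (setIntegral_congr_fun (measurableSet_cell d) fun y _ => ?_).trans
      (integral_zero (Euc d) E)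
    have hd : ∀ s, HasDerivAt (fun s => F (ins i s y)) (F' (ins i s y)) s := by
      intro s
      have := hF (ins i s y)
      simp only [ins_add_single] at this
      have h2 : HasDerivAt (fun r : ℝ => r - s) 1 s := (hasDerivAt_id s).sub_const s
      have h3 := HasDerivAt.scomp_of_eq (h := fun r : ℝ => r - s) s this h2 (by simp)
      simpa [Function.comp_def] using h3
    have hc : Continuous fun s => F' (ins i s y) :=
      hF'.comp ((continuous_ins i).comp (by fun_prop : Continuous fun s : ℝ => (s, y)))
    rw [intervalIntegral.integral_eq_sub_of_hasDerivAt (fun s _ => hd s)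
      (hc.intervalIntegrable _ _), sub_eq_zero]
    have := hper (ins i (-Real.pi) y)
    rw [ins_add_single] at this
    rw [← this]; congr 2; ring

theorem HasFDerivAt.hasDerivAt_single {E : Type*} [NormedAddCommGroup E] [NormedSpace ℝ E]
    {f : Euc d → E} {f' : Euc d →L[ℝ] E} {x : Euc d} (h : HasFDerivAt f f' x) (i : Fin d) :
    HasDerivAt (fun s : ℝ => f (x + EuclideanSpace.single i s)) (f' (EuclideanSpace.single i 1)) 0 := by
  have h1 : HasDerivAt (fun s : ℝ => x + EuclideanSpace.single i s)
      (EuclideanSpace.single i (1 : ℝ)) 0 := by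
    have : HasDerivAt (fun s : ℝ => x + s • EuclideanSpace.single i (1 : ℝ))
        ((1 : ℝ) • EuclideanSpace.single i (1 : ℝ)) 0 :=
      ((hasDerivAt_id (0 : ℝ)).smul_const _).const_add x
    have e : ∀ s : ℝ, s • EuclideanSpace.single i (1 : ℝ) = EuclideanSpace.single i s := fun s => by
      ext j; by_cases h : j = i <;> simp [h]
    simpa only [e, one_smul] using this
  exact HasFDerivAt.comp_hasDerivAt_of_eq 0 h h1 (by simp)

end Cell

/-! ### Functions of the horizontal variables on the three-torus. -/

section Horiz

theorem horiz_ins (s : ℝ) (y : Euc 2) : horiz (ins (Fin.last 2) s y) = y := by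
  ext j
  fin_cases j
  · exact Fin.insertNth_apply_succAbove (α := fun _ => ℝ) (Fin.last 2) s (WithLp.ofLp y) 0
  · exact Fin.insertNth_apply_succAbove (α := fun _ => ℝ) (Fin.last 2) s (WithLp.ofLp y) 1

/-- The horizontal projection as a continuous linear map. -/
def horizL : Euc 3 →L[ℝ] Euc 2 :=
  LinearMap.toContinuousLinearMap
    { toFun := horiz
      map_add' := fun x y => by ext j; fin_cases j <;> simp [horiz]
      map_smul' := fun c x => by ext j; fin_cases j <;> simp [horiz] }

@[simp] theorem horizL_apply (x : Euc 3) : horizL x = horiz x := rfl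

theorem contDiff_horiz {n : WithTop ℕ∞} : ContDiff ℝ n horiz := horizL.contDiff

theorem continuous_horiz : Continuous horiz := horizL.continuous

@[simp] theorem horiz_apply_zero (x : Euc 3) : horiz x 0 = x 0 := rfl

@[simp] theorem horiz_apply_one (x : Euc 3) : horiz x 1 = x 1 := rfl

theorem integral_cell_horiz {E : Type*} [NormedAddCommGroup E] [NormedSpace ℝ E]
    [CompleteSpace E]
    {f : Euc 2 → E} (hf : Continuous f) :
    ∫ x in cell 3, f (horiz x) = (2 * Real.pi) • ∫ y in cell 2, f y := by
  rw [integral_cell_succ (d := 2) (f := fun x => f (horiz x)) (Fin.last 2)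
    (hf.comp continuous_horiz)]
  simp only [horiz_ins, intervalIntegral.integral_const, integral_smul]
  congr 1; ring

theorem Periodic.comp_horiz {F : Type*} {f : Euc 2 → F} (hf : Periodic f) :
    Periodic fun x => f (horiz x) := by
  intro i x
  have key : ∀ j : Fin 3, horiz (x + EuclideanSpace.single j (2 * Real.pi)) =
      horiz x + horiz (EuclideanSpace.single j (2 * Real.pi)) := fun j => horizL.map_add _ _
  simp only
  rw [key]
  fin_cases i
  · have : horiz (EuclideanSpace.single 0 (2 * Real.pi)) = EuclideanSpace.single 0 (2 * Real.pi) := by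
      ext j; fin_cases j <;> simp [horiz]
    exact (congrArg (fun z => f (horiz x + z)) this).trans (hf 0 _)
  · have : horiz (EuclideanSpace.single 1 (2 * Real.pi)) = EuclideanSpace.single 1 (2 * Real.pi) := by
      ext j; fin_cases j <;> simp [horiz]
    exact (congrArg (fun z => f (horiz x + z)) this).trans (hf 1 _)
  · have : horiz (EuclideanSpace.single 2 (2 * Real.pi)) = 0 := by
      ext j; fin_cases j <;> simp [horiz]
    exact (congrArg (fun z => f (horiz x + z)) this).trans (by simp)

end Horiz

/-! ### Weighted sequence spaces on the frequency lattice. -/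

section Weights

variable {d : ℕ}

/-- The weight `(1 + |n|²)^{1/2}` on frequencies. -/
def freqWeight (n : Fin d → ℤ) : ℝ := √(1 + ∑ i, (n i : ℝ) ^ 2)

theorem freqWeight_sq (n : Fin d → ℤ) : freqWeight n ^ 2 = 1 + ∑ i, (n i : ℝ) ^ 2 :=
  Real.sq_sqrt (by positivity)

theorem one_le_freqWeight (n : Fin d → ℤ) : 1 ≤ freqWeight n := by
  rw [freqWeight, Real.one_le_sqrt]
  linarith [Finset.sum_nonneg fun i (_ : i ∈ Finset.univ) => sq_nonneg (n i : ℝ)]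

theorem freqWeight_pos (n : Fin d → ℤ) : 0 < freqWeight n :=
  one_pos.trans_le (one_le_freqWeight n)

theorem freqWeight_neg (n : Fin d → ℤ) : freqWeight (-n) = freqWeight n := by
  simp [freqWeight]

theorem abs_apply_le_freqWeight (n : Fin d → ℤ) (i : Fin d) : |(n i : ℝ)| ≤ freqWeight n := by
  apply Real.abs_le_sqrt
  have := Finset.single_le_sum (fun i _ => sq_nonneg (n i : ℝ)) (Finset.mem_univ i)
  linarith

/-- Comparison with the lattice sum of ‖z‖⁻⁴, which converges because 4 > d. The exponent 4 is
behind every loss of two derivatives in the embeddings below. -/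
theorem summable_freqWeight_inv_pow_four (hd : d ≤ 3) :
    Summable fun n : Fin d → ℤ => (freqWeight n ^ 4)⁻¹ := by
  classical
  let b := (EuclideanSpace.basisFun (Fin d) ℝ).toBasis
  let L : Submodule ℤ (Euc d) := Submodule.span ℤ (Set.range b)
  have hL := ZLattice.summable_norm_pow_inv L 4 (by
    rw [ZLattice.rank ℝ L, finrank_euclideanSpace_fin]; omega)
  let φ : (Fin d → ℤ) → L := fun n => ⟨∑ i, n i • b i,
    Submodule.sum_mem _ fun i _ => Submodule.smul_mem _ _ (Submodule.subset_span ⟨i, rfl⟩)⟩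
  have hφ : ∀ n i, (φ n : Euc d) i = n i := by
    intro n i
    simp [φ, b, EuclideanSpace.basisFun_apply, Pi.single_apply]
  have hinj : Function.Injective φ := by
    intro m n h
    ext i
    have := congrArg (fun z : L => (z : Euc d) i) h
    simpa [hφ] using this
  have h1 := hL.comp_injective hinj
  refine Summable.of_norm_bounded_eventually h1 ?_
  -- At frequency 0 the comparison term is 0⁻¹ = 0 while the weight is 1, so the bound is claimed
  -- only off that point.
  filter_upwards [Set.Finite.compl_mem_cofinite (Set.finite_singleton (0 : Fin d → ℤ))] with n hn
  have hn0 : φ n ≠ 0 := by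
    intro h
    apply hn
    ext i
    have := congrArg (fun z : L => (z : Euc d) i) h
    simpa [hφ] using this
  have hpos : 0 < ‖φ n‖ := norm_pos_iff.2 hn0
  have hle : ‖φ n‖ ≤ freqWeight n := by
    rw [Submodule.coe_norm, EuclideanSpace.norm_eq, freqWeight]
    apply Real.sqrt_le_sqrt
    simp [hφ]
  rw [Real.norm_of_nonneg (inv_nonneg.2 (pow_nonneg (freqWeight_pos n).le 4)), Function.comp_apply]
  rw [← inv_pow]
  have := freqWeight_pos n
  gcongr

/-- `c` has finite `H^j` norm. -/
def HSummable (j : ℕ) (c : (Fin d → ℤ) → ℂ) : Prop :=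
  Summable fun n => freqWeight n ^ (2 * j) * ‖c n‖ ^ 2

/-- The square of the `H^j` norm of a sequence of Fourier coefficients. -/
def hsq (j : ℕ) (c : (Fin d → ℤ) → ℂ) : ℝ := ∑' n, freqWeight n ^ (2 * j) * ‖c n‖ ^ 2

theorem hsq_nonneg (j : ℕ) (c : (Fin d → ℤ) → ℂ) : 0 ≤ hsq j c :=
  tsum_nonneg fun n => mul_nonneg (pow_nonneg (freqWeight_pos n).le _) (sq_nonneg _)

theorem HSummable.mono {j k : ℕ} (hjk : j ≤ k) {c : (Fin d → ℤ) → ℂ} (h : HSummable k c) :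
    HSummable j c := by
  refine Summable.of_nonneg_of_le
    (fun n => mul_nonneg (pow_nonneg (freqWeight_pos n).le _) (sq_nonneg _)) (fun n => ?_) h
  gcongr
  exact one_le_freqWeight n

theorem hsq_mono {j k : ℕ} (hjk : j ≤ k) {c : (Fin d → ℤ) → ℂ} (h : HSummable k c) :
    hsq j c ≤ hsq k c := by
  refine (h.mono hjk).tsum_le_tsum (fun n => ?_) h
  gcongr
  exact one_le_freqWeight n

theorem norm_sq_sub_le (a b : ℂ) : ‖a - b‖ ^ 2 ≤ 2 * ‖a‖ ^ 2 + 2 * ‖b‖ ^ 2 := by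
  have h := norm_sub_le a b
  nlinarith [sq_nonneg (‖a‖ - ‖b‖), norm_nonneg (a - b), norm_nonneg a, norm_nonneg b]

theorem HSummable.sub {j : ℕ} {a b : (Fin d → ℤ) → ℂ} (ha : HSummable j a) (hb : HSummable j b) :
    HSummable j (a - b) := by
  refine Summable.of_nonneg_of_le
    (fun n => mul_nonneg (pow_nonneg (freqWeight_pos n).le _) (sq_nonneg _)) (fun n => ?_)
    ((ha.mul_left 2).add (hb.mul_left 2))
  have := mul_le_mul_of_nonneg_left (norm_sq_sub_le (a n) (b n))
    (pow_nonneg (freqWeight_pos n).le (2 * j))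
  simp only [Pi.sub_apply]; linarith

theorem hsq_sub_le {j : ℕ} {a b : (Fin d → ℤ) → ℂ} (ha : HSummable j a) (hb : HSummable j b) :
    hsq j (a - b) ≤ 2 * hsq j a + 2 * hsq j b := by
  rw [hsq, hsq, hsq, ← tsum_mul_left, ← tsum_mul_left,
    ← (ha.mul_left 2).tsum_add (hb.mul_left 2)]
  refine (ha.sub hb).tsum_le_tsum (fun n => ?_) ((ha.mul_left 2).add (hb.mul_left 2))
  have := mul_le_mul_of_nonneg_left (norm_sq_sub_le (a n) (b n))
    (pow_nonneg (freqWeight_pos n).le (2 * j))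
  simp only [Pi.sub_apply]; linarith

/-- The constant of the embedding `H^{j+2} → {∑ |n|^j |c_n| < ∞}`. -/
def embConst (d : ℕ) : ℝ := √(∑' n : Fin d → ℤ, (freqWeight n ^ 4)⁻¹)

theorem embConst_nonneg (d : ℕ) : 0 ≤ embConst d := Real.sqrt_nonneg _

/-- Cauchy–Schwarz for the splitting ⟨n⟩^j|c| = ⟨n⟩⁻² · ⟨n⟩^{j+2}|c|. The case j = 0 is the
embedding of H² into C⁰, the case j = 1 that of H³ into C¹. -/
theorem HSummable.summable_and_tsum_le (hd : d ≤ 3) {j : ℕ} {c : (Fin d → ℤ) → ℂ}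
    (h : HSummable (j + 2) c) :
    (Summable fun n => freqWeight n ^ j * ‖c n‖) ∧
      ∑' n, freqWeight n ^ j * ‖c n‖ ≤ embConst d * √(hsq (j + 2) c) := by
  have h0 : ∀ n : Fin d → ℤ, 0 ≤ (freqWeight n ^ 2)⁻¹ := fun n => by
    have := freqWeight_pos n; positivity
  have h1 : ∀ n : Fin d → ℤ, 0 ≤ freqWeight n ^ (j + 2) * ‖c n‖ := fun n => by
    have := freqWeight_pos n; positivity
  have h2 : Summable fun n : Fin d → ℤ => (freqWeight n ^ 2)⁻¹ ^ (2 : ℝ) := by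
    simpa [← inv_pow, ← pow_mul] using summable_freqWeight_inv_pow_four hd
  have h3 : Summable fun n : Fin d → ℤ => (freqWeight n ^ (j + 2) * ‖c n‖) ^ (2 : ℝ) := by
    refine h.congr fun n => ?_
    rw [Real.rpow_ofNat]; ring
  have hs := Real.summable_mul_of_Lp_Lq_of_nonneg .two_two h0 h1 h2 h3
  have key := Real.inner_le_Lp_mul_Lq_tsum_of_nonneg .two_two h0 h1 h2 h3
  have e : ∀ n : Fin d → ℤ, (freqWeight n ^ 2)⁻¹ * (freqWeight n ^ (j + 2) * ‖c n‖) =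
      freqWeight n ^ j * ‖c n‖ := fun n => by
    have := (freqWeight_pos n).ne'
    rw [pow_add]; field_simp
  simp only [e] at key hs
  refine ⟨hs, key.trans_eq ?_⟩
  rw [embConst, hsq, Real.sqrt_eq_rpow, Real.sqrt_eq_rpow]
  congr 2
  · exact tsum_congr fun n => by rw [Real.rpow_ofNat]; ring
  · exact tsum_congr fun n => by rw [Real.rpow_ofNat]; ring

end Weights

/-! ### Characters of the torus and Fourier coefficients. -/

section Characters

variable {d : ℕ}

/-- The linear form `y ↦ i n · y`. -/
def phaseL (n : Fin d → ℤ) : Euc d →L[ℝ] ℂ :=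
  Complex.I • Complex.ofRealCLM.comp (∑ i, (n i : ℝ) • EuclideanSpace.proj i)

theorem phaseL_apply (n : Fin d → ℤ) (y : Euc d) :
    phaseL n y = Complex.I * ∑ i, (n i : ℂ) * (y i : ℂ) := by
  simp [phaseL]

theorem phaseL_single (n : Fin d → ℤ) (i : Fin d) :
    phaseL n (EuclideanSpace.single i 1) = Complex.I * n i := by
  rw [phaseL_apply, Finset.sum_eq_single i (fun j _ hj => by simp [hj]) (by simp)]
  simp

theorem norm_phaseL_le (n : Fin d → ℤ) : ‖phaseL n‖ ≤ freqWeight n := by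
  refine ContinuousLinearMap.opNorm_le_bound _ (freqWeight_pos n).le fun y => ?_
  have h1 : ‖phaseL n y‖ = |inner ℝ (WithLp.toLp 2 (fun i => (n i : ℝ)) : Euc d) y| := by
    rw [phaseL_apply, norm_mul, Complex.norm_I, one_mul]
    rw [show (∑ i, (n i : ℂ) * (y i : ℂ)) = ((∑ i, (n i : ℝ) * y i : ℝ) : ℂ) by push_cast; rfl,
      Complex.norm_real, Real.norm_eq_abs]
    congr 1
    simp [PiLp.inner_apply, mul_comm]
  rw [h1]
  refine (abs_real_inner_le_norm _ _).trans ?_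
  gcongr
  rw [EuclideanSpace.norm_eq, freqWeight]
  apply Real.sqrt_le_sqrt
  simp

/-- The character `x ↦ e^{i n · x}`. -/
def char (n : Fin d → ℤ) (x : Euc d) : ℂ := Complex.exp (phaseL n x)

theorem norm_char (n : Fin d → ℤ) (x : Euc d) : ‖char n x‖ = 1 := by
  rw [char, phaseL_apply, show (∑ i, (n i : ℂ) * (x i : ℂ)) = ((∑ i, (n i : ℝ) * x i : ℝ) : ℂ) by
    push_cast; rfl, mul_comm, Complex.norm_exp_ofReal_mul_I]

theorem continuous_char (n : Fin d → ℤ) : Continuous (char n) :=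
  Complex.continuous_exp.comp (phaseL n).continuous

theorem char_add (m n : Fin d → ℤ) (x : Euc d) : char (m + n) x = char m x * char n x := by
  rw [char, char, char, ← Complex.exp_add]
  simp only [phaseL_apply, ← mul_add, ← Finset.sum_add_distrib, Pi.add_apply]
  push_cast
  simp only [add_mul]

theorem char_neg (n : Fin d → ℤ) (x : Euc d) : char (-n) x = starRingEnd ℂ (char n x) := by
  rw [char, char, ← Complex.exp_conj]
  simp [phaseL_apply]

theorem char_zero (x : Euc d) : char (0 : Fin d → ℤ) x = 1 := by simp [char, phaseL_apply]

theorem hasFDerivAt_char (n : Fin d → ℤ) (x : Euc d) :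
    HasFDerivAt (char n) (char n x • phaseL n) x :=
  (phaseL n).hasFDerivAt.cexp

theorem periodic_char (n : Fin d → ℤ) : Periodic (char n) := by
  intro i x
  rw [char, char, map_add, Complex.exp_add, phaseL_apply n (EuclideanSpace.single _ _)]
  have : Complex.I * ∑ j, (n j : ℂ) * ((EuclideanSpace.single i (2 * Real.pi) : Euc d) j : ℂ) =
      n i * (2 * Real.pi * Complex.I) := by
    rw [Finset.sum_eq_single i (fun j _ hj => by simp [hj]) (by simp)]
    simp; ring
  rw [this, Complex.exp_int_mul_two_pi_mul_I, mul_one]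

theorem integral_char (n : Fin d → ℤ) :
    ∫ x in cell d, char n x = if n = 0 then (((2 * Real.pi) ^ d : ℝ) : ℂ) else 0 := by
  split_ifs with h
  · subst h
    simp [char_zero, volume_real_cell]
  · obtain ⟨i, hi⟩ := Function.ne_iff.1 h
    have hi' : (Complex.I * n i : ℂ) ≠ 0 := by simpa using hi
    have := integral_cell_deriv_eq_zero i (F := char n) (F' := fun x => char n x * (Complex.I * n i))
      (fun x => by
        have := HasFDerivAt.hasDerivAt_single (hasFDerivAt_char n x) i
        simpa [phaseL_single] using this)
      ((continuous_char n).mul continuous_const) (periodic_char n i)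
    rw [integral_mul_const] at this
    exact (mul_eq_zero.1 this).resolve_right hi'

theorem fourierCoeff_eq (f : Euc d → ℝ) (n : Fin d → ℤ) :
    fourierCoeff f n = (((2 * Real.pi) ^ d : ℝ) : ℂ)⁻¹ * ∫ x in cell d, (f x : ℂ) * char (-n) x := by
  rw [fourierCoeff]
  congr 2
  ext x
  rw [char, phaseL_apply]
  simp

theorem fourierCoeff_sub {f g : Euc d → ℝ} (hf : Continuous f) (hg : Continuous g) :
    fourierCoeff (f - g) = fourierCoeff f - fourierCoeff g := by
  ext n
  simp only [fourierCoeff_eq, Pi.sub_apply, ← mul_sub]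
  rw [← integral_sub]
  · simp [sub_mul]
  · exact integrableOn_cell ((Complex.continuous_ofReal.comp hf).mul (continuous_char _))
  · exact integrableOn_cell ((Complex.continuous_ofReal.comp hg).mul (continuous_char _))

end Characters

/-! ### Absolutely convergent Fourier series and their derivatives. -/

section Synthesis

variable {d : ℕ}

/-- The complex Fourier series with coefficients `c`. -/
def csynth (c : (Fin d → ℤ) → ℂ) (x : Euc d) : ℂ := ∑' n, c n * char n x

/-- The real part of the Fourier series with coefficients `c`. -/
def synth (c : (Fin d → ℤ) → ℂ) (x : Euc d) : ℝ := (csynth c x).re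

variable {c : (Fin d → ℤ) → ℂ}

theorem summable_mul_char (hc : Summable fun n => ‖c n‖) (x : Euc d) :
    Summable fun n => c n * char n x :=
  .of_norm (by simpa [norm_char] using hc)

theorem continuous_csynth (hc : Summable fun n => ‖c n‖) : Continuous (csynth c) :=
  continuous_tsum (fun n => continuous_const.mul (continuous_char n)) hc
    (fun n x => by simp [norm_char])

theorem continuous_synth (hc : Summable fun n => ‖c n‖) : Continuous (synth c) :=
  Complex.continuous_re.comp (continuous_csynth hc)

theorem periodic_synth (c : (Fin d → ℤ) → ℂ) : Periodic (synth c) := by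
  intro i x
  simp only [synth, csynth, periodic_char _ i x]

theorem abs_synth_le (hc : Summable fun n => ‖c n‖) (x : Euc d) : |synth c x| ≤ ∑' n, ‖c n‖ := by
  refine (Complex.abs_re_le_norm _).trans ?_
  refine (norm_tsum_le_tsum_norm (by simpa [norm_char] using hc)).trans_eq ?_
  simp [norm_char]

theorem synth_sub {a b : (Fin d → ℤ) → ℂ} (ha : Summable fun n => ‖a n‖)
    (hb : Summable fun n => ‖b n‖) : synth (a - b) = synth a - synth b := by
  ext x
  simp only [synth, csynth, Pi.sub_apply, ← Complex.sub_re]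
  rw [← (summable_mul_char ha x).tsum_sub (summable_mul_char hb x)]
  simp [sub_mul]

/-- The map π lets one interchange of sum and integral serve both the torus itself and series lifted
through `horiz`. -/
theorem integral_csynth_comp_mul {m : ℕ} {π : Euc m → Euc d} (hπ : Continuous π)
    (hc : Summable fun n => ‖c n‖) {φ : Euc m → ℂ} (hφ : Continuous φ) :
    ∫ x in cell m, csynth c (π x) * φ x = ∑' n, c n * ∫ x in cell m, char n (π x) * φ x := by
  obtain ⟨M, hM⟩ := (isCompact_cell m).exists_bound_of_continuousOn hφ.continuousOn
  have hint : ∀ n, IntegrableOn (fun x => c n * char n (π x) * φ x) (cell m) := fun n =>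
    integrableOn_cell ((continuous_const.mul ((continuous_char n).comp hπ)).mul hφ)
  have h := integral_tsum_of_summable_integral_norm (μ := volume.restrict (cell m)) hint
    (by
      refine Summable.of_nonneg_of_le (fun n => integral_nonneg fun x => norm_nonneg _) (fun n => ?_)
        (hc.mul_right (M * (volume : Measure (Euc m)).real (cell m)))
      have : ∀ x ∈ cell m, ‖c n * char n (π x) * φ x‖ ≤ ‖c n‖ * M := fun x hx => by
        rw [norm_mul, norm_mul, norm_char, mul_one]
        exact mul_le_mul_of_nonneg_left (hM x hx) (norm_nonneg _)
      calc ∫ x in cell m, ‖c n * char n (π x) * φ x‖ ≤ ∫ x in cell m, ‖c n‖ * M :=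
            setIntegral_mono_on (hint n).norm (integrableOn_const (isCompact_cell m).measure_ne_top)
              (measurableSet_cell m) this
        _ = _ := by simp; ring)
  simp only [csynth, ← tsum_mul_right]
  rw [← h]
  exact tsum_congr fun n => by simp only [mul_assoc, integral_const_mul]

theorem integral_csynth_mul (hc : Summable fun n => ‖c n‖) {φ : Euc d → ℂ} (hφ : Continuous φ) :
    ∫ x in cell d, csynth c x * φ x = ∑' n, c n * ∫ x in cell d, char n x * φ x :=
  integral_csynth_comp_mul continuous_id hc hφ

theorem integral_csynth_mul_char (hc : Summable fun n => ‖c n‖) (n : Fin d → ℤ) :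
    ∫ x in cell d, csynth c x * char (-n) x = ((2 * Real.pi) ^ d : ℝ) * c n := by
  rw [integral_csynth_mul hc (continuous_char _)]
  simp only [← char_add, integral_char, ← sub_eq_add_neg, sub_eq_zero]
  rw [tsum_eq_single n (fun m hm => by simp [hm])]
  simp [mul_comm]

/-- Taking the real part symmetrizes the coefficients, so no conjugation symmetry has to be tracked
along the evolution. -/
theorem fourierCoeff_synth (hc : Summable fun n => ‖c n‖) (n : Fin d → ℤ) :
    fourierCoeff (synth c) n = (c n + starRingEnd ℂ (c (-n))) / 2 := by
  have hpi : ((((2 * Real.pi) ^ d : ℝ)) : ℂ) ≠ 0 := by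
    exact_mod_cast (by positivity : (0 : ℝ) < (2 * Real.pi) ^ d).ne'
  have h1 := integral_csynth_mul_char hc n
  have h2 := congrArg (starRingEnd ℂ) (integral_csynth_mul_char hc (-n))
  rw [← integral_conj] at h2
  simp only [map_mul, Complex.conj_ofReal, neg_neg, ← char_neg] at h2
  have h3 : ∀ x, ((synth c x : ℝ) : ℂ) * char (-n) x =
      (csynth c x * char (-n) x + starRingEnd ℂ (csynth c x) * char (-n) x) / 2 := fun x => by
    rw [synth, Complex.re_eq_add_conj]; ring
  rw [fourierCoeff_eq]
  simp only [h3]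
  rw [integral_div, integral_add, h1, h2]
  · field_simp
  · exact integrableOn_cell ((continuous_csynth hc).mul (continuous_char _))
  · exact integrableOn_cell
      ((Complex.continuous_conj.comp (continuous_csynth hc)).mul (continuous_char _))

theorem hasFDerivAt_synth (hc : Summable fun n => freqWeight n ^ 1 * ‖c n‖) (x : Euc d) :
    HasFDerivAt (synth c) (Complex.reCLM.comp (∑' n, (c n * char n x) • phaseL n)) x := by
  have h1 : ∀ n x, HasFDerivAt (fun x => c n * char n x) ((c n * char n x) • phaseL n) x :=
    fun n x => by
      have := (hasFDerivAt_char n x).const_mul (c n)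
      rwa [smul_smul] at this
  have h := hasFDerivAt_tsum hc h1 (fun n x => ?_) (x₀ := 0) ?_ x
  · exact Complex.reCLM.hasFDerivAt.comp x h
  · rw [norm_smul, norm_mul, norm_char, mul_one, mul_comm, pow_one]
    exact mul_le_mul_of_nonneg_right (norm_phaseL_le n) (norm_nonneg _)
  · refine summable_mul_char (Summable.of_nonneg_of_le (fun n => norm_nonneg _) (fun n => ?_) hc) _
    exact le_mul_of_one_le_left (norm_nonneg _) (by simpa using one_le_freqWeight n)

theorem summable_smul_phaseL (hc : Summable fun n => freqWeight n ^ 1 * ‖c n‖) (x : Euc d) :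
    Summable fun n => (c n * char n x) • phaseL n := by
  refine Summable.of_norm_bounded hc fun n => ?_
  rw [norm_smul, norm_mul, norm_char, mul_one, mul_comm, pow_one]
  exact mul_le_mul_of_nonneg_right (norm_phaseL_le n) (norm_nonneg _)

theorem fderiv_synth_apply (hc : Summable fun n => freqWeight n ^ 1 * ‖c n‖) (x y : Euc d) :
    fderiv ℝ (synth c) x y = (∑' n, c n * char n x * phaseL n y).re := by
  rw [(hasFDerivAt_synth hc x).fderiv]
  simp only [ContinuousLinearMap.comp_apply, Complex.reCLM_apply]
  congr 1
  exact ((ContinuousLinearMap.apply ℝ ℂ y).map_tsum (summable_smul_phaseL hc x)).trans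
    (tsum_congr fun n => by simp)

theorem contDiff_synth (hc : Summable fun n => freqWeight n ^ 1 * ‖c n‖) :
    ContDiff ℝ 1 (synth c) := by
  rw [contDiff_one_iff_fderiv]
  refine ⟨fun x => (hasFDerivAt_synth hc x).differentiableAt, ?_⟩
  have : fderiv ℝ (synth c) = fun x => Complex.reCLM.comp (∑' n, (c n * char n x) • phaseL n) :=
    funext fun x => (hasFDerivAt_synth hc x).fderiv
  rw [this]
  refine (ContinuousLinearMap.compL ℝ (Euc d) ℂ ℝ Complex.reCLM).continuous.comp
    (continuous_tsum (fun n => ?_) hc (fun n x => ?_))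
  · exact (continuous_const.mul (continuous_char n)).smul continuous_const
  · rw [norm_smul, norm_mul, norm_char, mul_one, mul_comm, pow_one]
    exact mul_le_mul_of_nonneg_right (norm_phaseL_le n) (norm_nonneg _)

theorem norm_fderiv_synth_le (hc : Summable fun n => freqWeight n ^ 1 * ‖c n‖) (x : Euc d) :
    ‖fderiv ℝ (synth c) x‖ ≤ ∑' n, freqWeight n ^ 1 * ‖c n‖ := by
  rw [(hasFDerivAt_synth hc x).fderiv]
  refine (ContinuousLinearMap.opNorm_comp_le _ _).trans ?_
  rw [Complex.reCLM_norm, one_mul]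
  refine tsum_of_norm_bounded hc.hasSum fun n => ?_
  rw [norm_smul, norm_mul, norm_char, mul_one, mul_comm, pow_one]
  exact mul_le_mul_of_nonneg_right (norm_phaseL_le n) (norm_nonneg _)

end Synthesis

/-! ### Fourier inversion for periodic functions. -/

section Inversion

variable {d : ℕ}

theorem Periodic.add_int_mul {F : Type*} {f : Euc d → F} (hf : Periodic f) (m : Fin d → ℤ)
    (x : Euc d) : f (x + WithLp.toLp 2 fun i => (m i : ℝ) * (2 * Real.pi)) = f x := by
  have h1 : ∀ (i : Fin d) (x : Euc d), f (x + EuclideanSpace.single i ((m i : ℝ) * (2 * Real.pi))) = f x := by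
    intro i x
    have hp : Function.Periodic (fun s : ℝ => f (x + EuclideanSpace.single i s)) (2 * Real.pi) := by
      intro s
      have := hf i (x + EuclideanSpace.single i s)
      rw [add_assoc] at this
      simp only
      rw [← this]
      congr 2
      ext j; by_cases h : j = i <;> simp [h]
    have := hp.int_mul (m i) 0
    have e0 : (EuclideanSpace.single i (0 : ℝ) : Euc d) = 0 := by ext; simp
    simpa [e0] using this
  have h2 : ∀ s : Finset (Fin d), f (x + ∑ i ∈ s, EuclideanSpace.single i ((m i : ℝ) * (2 * Real.pi))) = f x := by
    intro s
    induction s using Finset.induction_on with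
    | empty => simp
    | insert i s hi ih => rw [Finset.sum_insert hi, add_comm (EuclideanSpace.single _ _), ← add_assoc,
        h1, ih]
  rw [← h2 Finset.univ]
  congr 2
  ext j
  simp [Pi.single_apply]

/-- After rescaling by 2π the function is ℤ^d-periodic and factors through the open quotient map
onto (ℝ/ℤ)^d, where the Fourier series theorems are stated. -/
theorem exists_torus_lift {f : Euc d → ℝ} (hf : Continuous f) (hper : Periodic f) :
    ∃ F : C(UnitAddTorus (Fin d), ℂ), ∀ y : Fin d → ℝ,
      F (fun i => (y i : UnitAddCircle)) = f ((2 * Real.pi) • WithLp.toLp 2 y) := by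
  have hq : IsOpenQuotientMap (fun (y : Fin d → ℝ) (i : Fin d) => (y i : UnitAddCircle)) :=
    IsOpenQuotientMap.piMap (fun _ : Fin d =>
      (QuotientAddGroup.isOpenQuotientMap_mk (N := AddSubgroup.zmultiples (1 : ℝ))))
  let g : C(Fin d → ℝ, ℂ) := ⟨fun y => f ((2 * Real.pi) • WithLp.toLp 2 y), by fun_prop⟩
  let q : C(Fin d → ℝ, UnitAddTorus (Fin d)) := ⟨_, hq.continuous⟩
  have hq' : Topology.IsQuotientMap q := hq.isQuotientMap
  have hfac : Function.FactorsThrough g q := by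
    intro y z hyz
    have hm : ∀ i, ∃ m : ℤ, z i = y i + m := by
      intro i
      have h := congrFun hyz i
      obtain ⟨m, hm⟩ := QuotientAddGroup.eq_iff_sub_mem.1
        (show ((z i : ℝ) : UnitAddCircle) = (y i : UnitAddCircle) from h.symm)
      refine ⟨m, ?_⟩
      have : (m : ℝ) = z i - y i := by simpa using hm
      linarith
    choose m hm using hm
    change (f _ : ℂ) = f _
    have := hper.add_int_mul m ((2 * Real.pi) • WithLp.toLp 2 y)
    rw [← this]
    congr 2
    ext i
    simp [hm]; ring
  exact ⟨hq'.lift g hfac, fun y => congrFun (congrArg DFunLike.coe (hq'.lift_comp g hfac)) y⟩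

theorem mFourier_coe (n : Fin d → ℤ) (y : Fin d → ℝ) :
    UnitAddTorus.mFourier n (fun i => (y i : UnitAddCircle)) =
      char n ((2 * Real.pi) • WithLp.toLp 2 y) := by
  simp only [UnitAddTorus.mFourier, ContinuousMap.coe_mk, fourier_coe_apply, ← Complex.exp_sum]
  rw [char, phaseL_apply, Finset.mul_sum]
  congr 1
  refine Finset.sum_congr rfl fun i _ => ?_
  simp
  ring

open scoped Pointwise in
theorem setIntegral_cell_scale (f : Euc d → ℂ) :
    ∫ y in {y : Fin d → ℝ | ∀ i, y i ∈ Ioc (-(1 / 2) : ℝ) (-(1 / 2) + 1)},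
      f ((2 * Real.pi) • WithLp.toLp 2 y) = (((2 * Real.pi) ^ d : ℝ) : ℂ)⁻¹ * ∫ x in cell d, f x := by
  have hpi := Real.pi_pos
  have h := Measure.setIntegral_comp_smul (volume : Measure (Fin d → ℝ))
    (fun y => f (WithLp.toLp 2 y)) (R := 2 * Real.pi)
    {y : Fin d → ℝ | ∀ i, y i ∈ Ioc (-(1 / 2) : ℝ) (-(1 / 2) + 1)} (by positivity)
  have hs : (2 * Real.pi) • {y : Fin d → ℝ | ∀ i, y i ∈ Ioc (-(1 / 2) : ℝ) (-(1 / 2) + 1)} =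
      Set.pi univ fun _ => Ioc (-Real.pi) Real.pi := by
    ext y
    rw [mem_smul_set_iff_inv_smul_mem₀ (by positivity)]
    simp only [mem_ofPred_eq, Set.mem_pi, mem_univ, true_implies, mem_Ioc, Pi.smul_apply, smul_eq_mul]
    refine forall_congr' fun i => and_congr ?_ ?_
    · rw [lt_inv_mul_iff₀ (by positivity)]; constructor <;> intro h <;> linarith
    · rw [inv_mul_le_iff₀ (by positivity)]; constructor <;> intro h <;> linarith
  rw [hs] at h
  have hae : (Set.pi univ fun _ : Fin d => Ioc (-Real.pi) Real.pi) =ᵐ[volume]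
      (Set.pi univ fun _ : Fin d => Icc (-Real.pi) Real.pi) := by
    have := Measure.univ_pi_Ioc_ae_eq_Icc (μ := fun _ : Fin d => (volume : Measure ℝ))
      (f := fun _ => -Real.pi) (g := fun _ => Real.pi)
    rwa [← Set.pi_univ_Icc] at this
  rw [setIntegral_congr_set hae, ← setIntegral_cell_eq_pi] at h
  refine Eq.trans h ?_
  rw [abs_of_pos (by positivity)]
  simp

/-- Fourier inversion for continuous periodic functions with summable Fourier coefficients. -/
theorem eq_synth_fourierCoeff {f : Euc d → ℝ} (hf : Continuous f) (hper : Periodic f)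
    (hs : Summable fun n => ‖fourierCoeff f n‖) : f = synth (fourierCoeff f) := by
  obtain ⟨F, hF⟩ := exists_torus_lift hf hper
  have hco : ∀ n, UnitAddTorus.mFourierCoeff F n = fourierCoeff f n := by
    intro n
    -- The base point -1/2 gives the fundamental domain (-1/2, 1/2]^d, whose dilation by 2π is the
    -- period cell up to a null set.
    rw [UnitAddTorus.mFourierCoeff_eq_integral F n (fun _ => -(1 / 2)), fourierCoeff_eq]
    simp only [hF, mFourier_coe]
    rw [setIntegral_cell_scale (fun x => char (-n) x • (f x : ℂ))]
    simp [mul_comm]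
  have hs' : Summable (UnitAddTorus.mFourierCoeff F) := by
    rw [funext hco]; exact hs.of_norm
  ext x
  have h := UnitAddTorus.hasSum_mFourier_series_apply_of_summable hs'
    (fun i => ((((2 * Real.pi)⁻¹ • x) i : ℝ) : UnitAddCircle))
  simp only [hco, mFourier_coe, hF] at h
  have hx : (2 * Real.pi) • WithLp.toLp 2 (WithLp.ofLp ((2 * Real.pi)⁻¹ • x)) = x := by
    rw [WithLp.toLp_ofLp, smul_inv_smul₀ (by positivity)]
  rw [hx] at h
  rw [synth, csynth, ← Complex.ofReal_re (f x), ← h.tsum_eq]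
  simp

end Inversion

/-! ### Sobolev norms, embeddings and the synthesis map. -/

section Sobolev

variable {d : ℕ}

theorem enorm_weight (k : ℕ) (c : (Fin d → ℤ) → ℂ) (n : Fin d → ℤ) :
    ENNReal.ofReal ((1 + ∑ i, (n i : ℝ) ^ 2) ^ k) * ‖c n‖ₑ ^ 2 =
      ENNReal.ofReal (freqWeight n ^ (2 * k) * ‖c n‖ ^ 2) := by
  rw [← freqWeight_sq, ← pow_mul, ENNReal.ofReal_mul (pow_nonneg (freqWeight_pos n).le _),
    ENNReal.ofReal_pow (norm_nonneg _), ofReal_norm]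

theorem HSummable.tsum_ofReal {k : ℕ} {c : (Fin d → ℤ) → ℂ} (h : HSummable k c) :
    ∑' n, ENNReal.ofReal (freqWeight n ^ (2 * k) * ‖c n‖ ^ 2) = ENNReal.ofReal (hsq k c) :=
  (ENNReal.ofReal_tsum_of_nonneg
    (fun n => mul_nonneg (pow_nonneg (freqWeight_pos n).le _) (sq_nonneg _)) h).symm

theorem sobolevSq_eq {k : ℕ} {f : Euc d → ℝ} (h : HSummable k (fourierCoeff f)) :
    sobolevSq k f = ENNReal.ofReal (hsq k (fourierCoeff f)) := by
  simp only [sobolevSq, enorm_weight]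
  exact h.tsum_ofReal

theorem sobolevSq_lt_top_iff {k : ℕ} {f : Euc d → ℝ} :
    sobolevSq k f < ⊤ ↔ HSummable k (fourierCoeff f) := by
  refine ⟨fun h => ?_, fun h => by rw [sobolevSq_eq h]; exact ENNReal.ofReal_lt_top⟩
  have h2 := ENNReal.summable_toReal h.ne
  refine h2.congr fun n => ?_
  rw [enorm_weight, ENNReal.toReal_ofReal]
  exact mul_nonneg (pow_nonneg (freqWeight_pos n).le _) (sq_nonneg _)

theorem sobolevNorm_lt_top_iff {k : ℕ} {f : Euc d → ℝ} :
    sobolevNorm k f < ⊤ ↔ HSummable k (fourierCoeff f) := by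
  rw [← sobolevSq_lt_top_iff, sobolevNorm, ENNReal.rpow_lt_top_iff_of_pos (by norm_num)]

theorem sobolevNorm_eq {k : ℕ} {f : Euc d → ℝ} (h : HSummable k (fourierCoeff f)) :
    sobolevNorm k f = ENNReal.ofReal (√(hsq k (fourierCoeff f))) := by
  rw [sobolevNorm, sobolevSq_eq h, ENNReal.ofReal_rpow_of_nonneg (hsq_nonneg _ _) (by norm_num),
    Real.sqrt_eq_rpow]

theorem vecSobolevNorm_lt_top_iff {m k : ℕ} {f : Euc d → Euc m} :
    vecSobolevNorm k f < ⊤ ↔ ∀ i, HSummable k (fourierCoeff fun x => f x i) := by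
  rw [vecSobolevNorm, ENNReal.rpow_lt_top_iff_of_pos (by norm_num), ENNReal.sum_lt_top]
  simp [sobolevSq_lt_top_iff]

theorem sobolevNorm_le_vecSobolevNorm {m k : ℕ} (f : Euc d → Euc m) (i : Fin m) :
    sobolevNorm k (fun x => f x i) ≤ vecSobolevNorm k f := by
  refine ENNReal.rpow_le_rpow ?_ (by norm_num)
  exact Finset.single_le_sum (f := fun i => sobolevSq k (fun x => f x i)) (fun _ _ => zero_le)
    (Finset.mem_univ i)

theorem summable_norm_of_summable {j : ℕ} {c : (Fin d → ℤ) → ℂ}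
    (hc : Summable fun n => freqWeight n ^ j * ‖c n‖) : Summable fun n => ‖c n‖ :=
  Summable.of_nonneg_of_le (fun _ => norm_nonneg _)
    (fun n => le_mul_of_one_le_left (norm_nonneg _) (one_le_pow₀ (one_le_freqWeight n))) hc

theorem HSummable.summable_norm (hd : d ≤ 3) {k : ℕ} (hk : 2 ≤ k) {c : (Fin d → ℤ) → ℂ}
    (h : HSummable k c) : Summable fun n => ‖c n‖ :=
  summable_norm_of_summable ((h.mono hk).summable_and_tsum_le (j := 0) hd).1

theorem HSummable.summable_weight (hd : d ≤ 3) {k : ℕ} (hk : 3 ≤ k) {c : (Fin d → ℤ) → ℂ}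
    (h : HSummable k c) : Summable fun n => freqWeight n ^ 1 * ‖c n‖ :=
  ((h.mono hk).summable_and_tsum_le (j := 1) hd).1

theorem MemSobolev.hSummable {k : ℕ} {f : Euc d → ℝ} (h : MemSobolev k f) :
    HSummable k (fourierCoeff f) := sobolevNorm_lt_top_iff.1 h.2.2

theorem MemSobolev.eq_synth (hd : d ≤ 3) {k : ℕ} (hk : 2 ≤ k) {f : Euc d → ℝ}
    (h : MemSobolev k f) : f = synth (fourierCoeff f) :=
  eq_synth_fourierCoeff h.1 h.2.1 (h.hSummable.summable_norm hd hk)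

theorem MemSobolev.contDiff (hd : d ≤ 3) {k : ℕ} (hk : 3 ≤ k) {f : Euc d → ℝ}
    (h : MemSobolev k f) : ContDiff ℝ 1 f := by
  rw [h.eq_synth hd (by omega)]
  exact contDiff_synth (h.hSummable.summable_weight hd hk)

theorem MemSobolev.abs_le (hd : d ≤ 3) {k : ℕ} (hk : 2 ≤ k) {f : Euc d → ℝ}
    (h : MemSobolev k f) (x : Euc d) :
    |f x| ≤ embConst d * (sobolevNorm k f).toReal := by
  have h2 := h.hSummable.mono hk
  conv_lhs => rw [h.eq_synth hd hk]
  refine (abs_synth_le (h.hSummable.summable_norm hd hk) x).trans ?_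
  rw [sobolevNorm_eq h.hSummable, ENNReal.toReal_ofReal (Real.sqrt_nonneg _)]
  have := (h2.summable_and_tsum_le (j := 0) hd).2
  simp only [pow_zero, one_mul] at this
  refine this.trans (mul_le_mul_of_nonneg_left (Real.sqrt_le_sqrt (hsq_mono hk h.hSummable))
    (embConst_nonneg d))

theorem MemSobolev.norm_fderiv_le (hd : d ≤ 3) {k : ℕ} (hk : 3 ≤ k) {f : Euc d → ℝ}
    (h : MemSobolev k f) (x : Euc d) :
    ‖fderiv ℝ f x‖ ≤ embConst d * (sobolevNorm k f).toReal := by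
  have h2 := h.hSummable.mono hk
  conv_lhs => rw [h.eq_synth hd (by omega)]
  refine (norm_fderiv_synth_le (h.hSummable.summable_weight hd hk) x).trans ?_
  rw [sobolevNorm_eq h.hSummable, ENNReal.toReal_ofReal (Real.sqrt_nonneg _)]
  refine (h2.summable_and_tsum_le (j := 1) hd).2.trans
    (mul_le_mul_of_nonneg_left (Real.sqrt_le_sqrt (hsq_mono hk h.hSummable)) (embConst_nonneg d))

theorem VecMemSobolev.apply {m k : ℕ} {f : Euc d → Euc m} (h : VecMemSobolev k f) (i : Fin m) :
    MemSobolev k fun x => f x i :=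
  ⟨by have := h.1; fun_prop, fun j x => congrArg (fun z : Euc m => z i) (h.2.1 j x),
    (sobolevNorm_le_vecSobolevNorm f i).trans_lt h.2.2⟩

/-- The weight is even in n, so the symmetrization produced by the real part is a contraction in
H^k. -/
theorem hSummable_fourierCoeff_synth {k : ℕ} {c : (Fin d → ℤ) → ℂ} (h : HSummable k c)
    (hs : Summable fun n => ‖c n‖) :
    HSummable k (fourierCoeff (synth c)) ∧ hsq k (fourierCoeff (synth c)) ≤ hsq k c := by
  have hneg : Summable fun n : Fin d → ℤ => freqWeight n ^ (2 * k) * ‖c (-n)‖ ^ 2 := by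
    have := (Equiv.neg (Fin d → ℤ)).summable_iff.2 h
    simpa [Function.comp_def, freqWeight_neg] using this
  have hneg' : ∑' n : Fin d → ℤ, freqWeight n ^ (2 * k) * ‖c (-n)‖ ^ 2 = hsq k c := by
    rw [hsq, ← (Equiv.neg (Fin d → ℤ)).tsum_eq]
    simp [freqWeight_neg]
  have hle : ∀ n : Fin d → ℤ, freqWeight n ^ (2 * k) * ‖fourierCoeff (synth c) n‖ ^ 2 ≤
      1 / 2 * (freqWeight n ^ (2 * k) * ‖c n‖ ^ 2) +
        1 / 2 * (freqWeight n ^ (2 * k) * ‖c (-n)‖ ^ 2) := by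
    intro n
    have hw : 0 ≤ freqWeight n ^ (2 * k) := pow_nonneg (freqWeight_pos n).le _
    have h1 : ‖fourierCoeff (synth c) n‖ ≤ (‖c n‖ + ‖c (-n)‖) / 2 := by
      rw [fourierCoeff_synth hs, norm_div, Complex.norm_ofNat]
      have := norm_add_le (c n) (starRingEnd ℂ (c (-n)))
      rw [RCLike.norm_conj] at this
      linarith
    have h2 : ‖fourierCoeff (synth c) n‖ ^ 2 ≤ 1 / 2 * ‖c n‖ ^ 2 + 1 / 2 * ‖c (-n)‖ ^ 2 := by
      nlinarith [sq_nonneg (‖c n‖ - ‖c (-n)‖), norm_nonneg (c n), norm_nonneg (c (-n)),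
        norm_nonneg (fourierCoeff (synth c) n)]
    nlinarith
  have hsum := (h.mul_left (1 / 2)).add (hneg.mul_left (1 / 2))
  have h1 : HSummable k (fourierCoeff (synth c)) := Summable.of_nonneg_of_le
    (fun n => mul_nonneg (pow_nonneg (freqWeight_pos n).le _) (sq_nonneg _)) hle hsum
  refine ⟨h1, (h1.tsum_le_tsum hle hsum).trans_eq ?_⟩
  rw [(h.mul_left (1 / 2)).tsum_add (hneg.mul_left (1 / 2)), tsum_mul_left, tsum_mul_left, hneg']
  change 1 / 2 * hsq k c + _ = _
  ring

theorem memSobolev_synth {k : ℕ} {c : (Fin d → ℤ) → ℂ} (h : HSummable k c)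
    (hs : Summable fun n => ‖c n‖) : MemSobolev k (synth c) :=
  ⟨continuous_synth hs, periodic_synth c,
    sobolevNorm_lt_top_iff.2 (hSummable_fourierCoeff_synth h hs).1⟩

theorem sobolevNorm_synth_le {k : ℕ} {c : (Fin d → ℤ) → ℂ} (h : HSummable k c)
    (hs : Summable fun n => ‖c n‖) :
    sobolevNorm k (synth c) ≤ ENNReal.ofReal (√(hsq k c)) := by
  obtain ⟨h1, h2⟩ := hSummable_fourierCoeff_synth h hs
  rw [sobolevNorm_eq h1]
  exact ENNReal.ofReal_le_ofReal (Real.sqrt_le_sqrt h2)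

theorem MemSobolev.sub {k : ℕ} {f g : Euc d → ℝ} (hf : MemSobolev k f) (hg : MemSobolev k g) :
    MemSobolev k (f - g) := by
  refine ⟨hf.1.sub hg.1, fun i x => ?_, sobolevNorm_lt_top_iff.2 ?_⟩
  · simp only [Pi.sub_apply, hf.2.1 i x, hg.2.1 i x]
  · rw [fourierCoeff_sub hf.1 hg.1]
    exact hf.hSummable.sub hg.hSummable

end Sobolev

/-! ### Sobolev norms of lifted functions. -/

section Lift

theorem horiz_add_single_two (x : Euc 3) (s : ℝ) :
    horiz (x + EuclideanSpace.single 2 s) = horiz x := by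
  ext j; fin_cases j <;> simp [horiz]

/-- If the vertical frequency vanishes, x₃ integrates out; otherwise the integrand is, up to a
nonzero factor, an x₃-derivative. With the normalized coefficients the lift is therefore isometric
in every H^k. -/
theorem fourierCoeff_comp_horiz {f : Euc 2 → ℝ} (hf : Continuous f) (n : Fin 3 → ℤ) :
    fourierCoeff (fun x => f (horiz x)) n =
      if n 2 = 0 then fourierCoeff f ![n 0, n 1] else 0 := by
  have hchar : ∀ x : Euc 3, n 2 = 0 → char (-n) x = char (-![n 0, n 1]) (horiz x) := by
    intro x hn
    simp only [char, phaseL_apply, Fin.sum_univ_three, Fin.sum_univ_two, Pi.neg_apply, hn]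
    simp
  split_ifs with h
  · rw [fourierCoeff_eq, fourierCoeff_eq]
    simp only [hchar _ h]
    rw [integral_cell_horiz (f := fun y => (f y : ℂ) * char (-![n 0, n 1]) y)
      ((Complex.continuous_ofReal.comp hf).mul (continuous_char _)), Complex.real_smul, ← mul_assoc]
    congr 1
    have := Real.pi_ne_zero
    push_cast
    field_simp
  · have hne : (Complex.I * (-n) 2 : ℂ) ≠ 0 := by simpa using h
    have hc : Continuous fun x : Euc 3 => (f (horiz x) : ℂ) :=
      Complex.continuous_ofReal.comp (hf.comp continuous_horiz)
    have hshift := horiz_add_single_two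
    have := integral_cell_deriv_eq_zero (d := 3) 2
      (F := fun x => (f (horiz x) : ℂ) * char (-n) x)
      (F' := fun x => (f (horiz x) : ℂ) * char (-n) x * (Complex.I * (-n) 2))
      (fun x => by
        have h1 := HasFDerivAt.hasDerivAt_single (hasFDerivAt_char (-n) x) 2
        simp only [hshift]
        have := h1.const_mul (f (horiz x) : ℂ)
        simpa [phaseL_single, mul_assoc] using this)
      ((hc.mul (continuous_char _)).mul continuous_const)
      (fun x => by
        simp only [hshift, periodic_char (-n) 2 x])
    rw [integral_mul_const] at this
    rw [fourierCoeff_eq, (mul_eq_zero.1 this).resolve_right hne, mul_zero]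

theorem sobolevSq_comp_horiz (k : ℕ) {f : Euc 2 → ℝ} (hf : Continuous f) :
    sobolevSq k (fun x => f (horiz x)) = sobolevSq k f := by
  rw [sobolevSq, sobolevSq]
  let ι : (Fin 2 → ℤ) → (Fin 3 → ℤ) := fun n => ![n 0, n 1, 0]
  have hι : Function.Injective ι := by
    intro m n h
    have h0 := congrFun h 0
    have h1 := congrFun h 1
    ext i; fin_cases i
    · simpa [ι] using h0
    · simpa [ι] using h1
  rw [← hι.tsum_eq]
  · refine tsum_congr fun n => ?_
    have : ![n 0, n 1] = n := by ext i; fin_cases i <;> rfl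
    rw [fourierCoeff_comp_horiz hf]
    simp [ι, Fin.sum_univ_succ, this]
  · intro n hn
    have h2 : n 2 = 0 := by
      by_contra h
      apply hn
      simp [fourierCoeff_comp_horiz hf, h]
    refine ⟨![n 0, n 1], ?_⟩
    ext i; fin_cases i <;> simp [ι, h2]

end Lift

theorem le_mul_exp_of_deriv_right_le {f f' : ℝ → ℝ} {T G : ℝ}
    (hf : ContinuousOn f (Icc 0 T))
    (hf' : ∀ t ∈ Ico 0 T, HasDerivWithinAt f (f' t) (Ici t) t)
    (hle : ∀ t ∈ Ico 0 T, f' t ≤ G * f t) {t : ℝ} (ht : t ∈ Icc 0 T) :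
    f t ≤ f 0 * Real.exp (G * t) := by
  have := le_gronwallBound_of_liminf_deriv_right_le (f' := f') (δ := f 0) (K := G) (ε := 0) hf
    (fun x hx r hr => (hf' x hx).liminf_right_slope_le hr) le_rfl
    (fun x hx => by simpa using hle x hx) t ht
  simpa [gronwallBound_ε0] using this

/-! ### Galerkin approximation of ∂_t c = A²c for a skew kernel. -/

section Abstract

open scoped Classical

variable {ι : Type*}

/-- A real skew-symmetric kernel supported on the neighbourhood relation `nb`. -/
structure IsSkewKernel (K : ι → ι → ℝ) (nb : ι → Finset ι) : Prop where
  skew : ∀ n m, K n m = -K m n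
  supp : ∀ n m, m ∉ nb n → K n m = 0
  symm : ∀ n m, m ∈ nb n → n ∈ nb m

/-- The operator with kernel `K`. -/
def kerOp (K : ι → ι → ℝ) (nb : ι → Finset ι) (c : ι → ℂ) (n : ι) : ℂ :=
  ∑ m ∈ nb n, K n m • c m

/-- The compression to `S` of the operator with kernel `K`. -/
def truncOp (K : ι → ι → ℝ) (S : Finset ι) (c : ι → ℂ) (n : ι) : ℂ :=
  if n ∈ S then ∑ m ∈ S, K n m • c m else 0

/-- `truncOp` as an endomorphism of `S → ℂ`. -/
def truncL (K : ι → ι → ℝ) (S : Finset ι) : (S → ℂ) →L[ℝ] (S → ℂ) :=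
  LinearMap.toContinuousLinearMap
    { toFun := fun c n => ∑ m : S, K n m • c m
      map_add' := fun a b => by ext n : 1; simp [Finset.sum_add_distrib]
      map_smul' := fun r a => by
        ext n : 1
        simp [Finset.mul_sum, mul_left_comm] }

/-- The Galerkin approximation of the evolution `∂_t c = A² c`. -/
def gal (K : ι → ι → ℝ) (S : Finset ι) (c₀ : ι → ℂ) (t : ℝ) (n : ι) : ℂ :=
  if h : n ∈ S then
    NormedSpace.exp (t • (truncL K S * truncL K S)) (fun m : S => c₀ m) ⟨n, h⟩ else 0

variable {K : ι → ι → ℝ} {nb : ι → Finset ι}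

theorem gal_zero (S : Finset ι) (c₀ : ι → ℂ) (n : ι) :
    gal K S c₀ 0 n = if n ∈ S then c₀ n else 0 := by
  by_cases h : n ∈ S
  · have e : (0 : ℝ) • (truncL K S * truncL K S) = 0 := zero_smul ℝ (truncL K S * truncL K S)
    rw [gal, dif_pos h, if_pos h, e, NormedSpace.exp_zero]; rfl
  · simp [gal, h]

theorem gal_of_notMem {S : Finset ι} {n : ι} (h : n ∉ S) (c₀ : ι → ℂ) (t : ℝ) :
    gal K S c₀ t n = 0 := by
  simp [gal, h]

theorem gal_sub (S : Finset ι) (a b : ι → ℂ) (t : ℝ) :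
    gal K S (a - b) t = gal K S a t - gal K S b t := by
  ext n
  by_cases h : n ∈ S
  · have : (fun m : S => (a - b) m) = (fun m : S => a m) - fun m : S => b m := rfl
    rw [gal, dif_pos h, this, map_sub]
    simp [gal, h]
  · simp [gal, h]

theorem truncOp_eq_truncL (S : Finset ι) (c : ι → ℂ) (n : S) :
    truncOp K S c n = truncL K S (fun m => c m) n := by
  have : truncL K S (fun m => c m) n = ∑ m : S, K n m • c m := rfl
  rw [this, truncOp, if_pos n.2, ← Finset.sum_coe_sort S (fun m => K n m • c m)]

theorem hasDerivAt_gal (S : Finset ι) (c₀ : ι → ℂ) (n : ι) (t : ℝ) :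
    HasDerivAt (fun t => gal K S c₀ t n) (truncOp K S (truncOp K S (gal K S c₀ t)) n) t := by
  by_cases h : n ∈ S
  · have h1 := hasDerivAt_exp_smul_const' (𝕂 := ℝ) (truncL K S * truncL K S) t
    have h2 := (h1.clm_apply (hasDerivAt_const t (fun m : S => c₀ m)))
    have h3 := (hasDerivAt_pi.1 h2) ⟨n, h⟩
    have e : (fun m : S => gal K S c₀ t m) =
        NormedSpace.exp (t • (truncL K S * truncL K S)) (fun m : S => c₀ m) := by
      ext m; simp [gal]
    have e2 : truncOp K S (truncOp K S (gal K S c₀ t)) n =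
        ((truncL K S * truncL K S) * NormedSpace.exp (t • (truncL K S * truncL K S)))
          (fun m : S => c₀ m) ⟨n, h⟩ := by
      rw [truncOp_eq_truncL S _ ⟨n, h⟩]
      simp only [truncOp_eq_truncL, e]
      rfl
    rw [e2]
    simpa [gal, h] using h3
  · simp only [gal_of_notMem h, truncOp, h, if_false]
    exact hasDerivAt_const t 0

theorem hasDerivAt_truncOp {S : Finset ι} {c : ℝ → ι → ℂ} {c' : ι → ℂ} {t : ℝ}
    (h : ∀ n, HasDerivAt (fun t => c t n) (c' n) t) (n : ι) :
    HasDerivAt (fun t => truncOp K S (c t) n) (truncOp K S c' n) t := by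
  by_cases hn : n ∈ S
  · simp only [truncOp, hn, if_true]
    exact HasDerivAt.fun_sum fun m _ => (h m).const_smul (K n m)
  · simp only [truncOp, hn, if_false]
    exact hasDerivAt_const t 0

/-- Truncation only drops terms, so pointwise majorants propagate exactly as for the full kernel,
uniformly in S. Iterated four times, this bounds the second time derivative A⁴c. -/
theorem norm_truncOp_le (hK : IsSkewKernel K nb) {γ γ' : ι → ℝ} (hγ : ∀ n, 0 ≤ γ n)
    (hγ' : ∀ n, ∑ m ∈ nb n, |K n m| * γ m ≤ γ' n) (S : Finset ι) {c : ι → ℂ}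
    (hc : ∀ n, ‖c n‖ ≤ γ n) (n : ι) : ‖truncOp K S c n‖ ≤ γ' n := by
  have h0 : 0 ≤ ∑ m ∈ nb n, |K n m| * γ m :=
    Finset.sum_nonneg fun m _ => mul_nonneg (abs_nonneg _) (hγ m)
  rw [truncOp]
  split_ifs
  · refine (norm_sum_le _ _).trans (le_trans ?_ (hγ' n))
    calc ∑ m ∈ S, ‖K n m • c m‖ ≤ ∑ m ∈ S, |K n m| * γ m := by
          refine Finset.sum_le_sum fun m _ => ?_
          rw [norm_smul, Real.norm_eq_abs]
          exact mul_le_mul_of_nonneg_left (hc m) (abs_nonneg _)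
      _ = ∑ m ∈ S.filter (· ∈ nb n), |K n m| * γ m := by
          rw [Finset.sum_filter]
          refine Finset.sum_congr rfl fun m _ => ?_
          split_ifs with hm
          · rfl
          · simp [hK.supp n m hm]
      _ ≤ _ := Finset.sum_le_sum_of_subset_of_nonneg (fun m hm => (Finset.mem_filter.1 hm).2)
          fun m _ _ => mul_nonneg (abs_nonneg _) (hγ m)
  · simpa using h0.trans (hγ' n)

/-- Young's inequality: -w x² + ‖r‖ x is maximal at x = ‖r‖/(2w). -/
theorem neg_mul_sq_sub_inner_le {w : ℝ} (hw : 0 < w) (r z : ℂ) :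
    -(w * ‖z‖ ^ 2) - inner ℝ r z ≤ ‖r‖ ^ 2 / (4 * w) := by
  have h1 : -inner ℝ r z ≤ ‖r‖ * ‖z‖ := by
    have := abs_real_inner_le_norm r z
    linarith [neg_abs_le (inner ℝ r z)]
  rw [le_div_iff₀ (by positivity)]
  nlinarith [sq_nonneg (‖r‖ - 2 * w * ‖z‖)]

/-- With z = Ac, skewness turns ⟨wc, Az⟩ into -⟨wz, z⟩ - ⟨[A, w]c, z⟩. The first term absorbs z and
leaves ‖[A, w]c‖²/(4w), which the hypothesis on K²(w m - w n)² bounds by the energy, with one factor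
D from Cauchy–Schwarz over neighbours and one from double counting. -/
theorem energy_deriv_le (hK : IsSkewKernel K nb) {w : ι → ℝ} (hw : ∀ n, 0 < w n) {C : ℝ} {D : ℕ}
    (hC0 : 0 ≤ C) (hC : ∀ n, ∀ m ∈ nb n, K n m ^ 2 * (w m - w n) ^ 2 ≤ C * (w n * w m))
    (hD : ∀ n, (nb n).card ≤ D) (S : Finset ι) (c : ι → ℂ) :
    ∑ n ∈ S, w n * inner ℝ (c n) (truncOp K S (truncOp K S c) n) ≤
      D ^ 2 * C / 4 * ∑ n ∈ S, w n * ‖c n‖ ^ 2 := by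
  set z := truncOp K S c with hz
  -- This is the commutator [A, w] applied to c, restricted to S.
  let r : ι → ℂ := fun m => ∑ n ∈ S, (K m n * (w n - w m)) • c n
  have h1 : ∑ n ∈ S, w n * inner ℝ (c n) (truncOp K S z n) =
      ∑ m ∈ S, (-(w m * ‖z m‖ ^ 2) - inner ℝ (r m) (z m)) := by
    have e1 : ∀ n ∈ S, w n * inner ℝ (c n) (truncOp K S z n) =
        ∑ m ∈ S, inner ℝ ((w n * K n m) • c n) (z m) := by
      intro n hn
      rw [truncOp, if_pos hn, inner_sum, Finset.mul_sum]
      refine Finset.sum_congr rfl fun m _ => ?_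
      rw [real_inner_smul_left, real_inner_smul_right, mul_assoc]
    rw [Finset.sum_congr rfl e1, Finset.sum_comm]
    refine Finset.sum_congr rfl fun m hm => ?_
    rw [← sum_inner]
    -- Skewness together with w n = w m + (w n - w m).
    have e2 : ∑ n ∈ S, (w n * K n m) • c n = -(w m • z m) - r m := by
      simp only [r, hz, truncOp, if_pos hm, Finset.smul_sum, ← Finset.sum_neg_distrib,
        ← Finset.sum_sub_distrib]
      refine Finset.sum_congr rfl fun n _ => ?_
      rw [hK.skew n m, smul_smul, ← neg_smul, ← sub_smul]
      congr 1; ring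
    rw [e2, inner_sub_left, inner_neg_left, real_inner_smul_left, real_inner_self_eq_norm_sq]
  rw [h1]
  have h2 : ∀ m ∈ S, -(w m * ‖z m‖ ^ 2) - inner ℝ (r m) (z m) ≤
      D * C / 4 * ∑ n ∈ S, if n ∈ nb m then w n * ‖c n‖ ^ 2 else 0 := by
    intro m _
    refine (neg_mul_sq_sub_inner_le (hw m) _ _).trans ?_
    rw [div_le_iff₀ (by have := hw m; positivity)]
    have hr : r m = ∑ n ∈ S.filter (· ∈ nb m), (K m n * (w n - w m)) • c n := by
      rw [Finset.sum_filter]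
      refine Finset.sum_congr rfl fun n _ => ?_
      split_ifs with hn
      · rfl
      · simp [hK.supp m n hn]
    have hcard : ((S.filter (· ∈ nb m)).card : ℝ) ≤ D := by
      refine le_trans ?_ (Nat.cast_le.2 (hD m))
      exact_mod_cast Finset.card_le_card fun n hn => (Finset.mem_filter.1 hn).2
    calc ‖r m‖ ^ 2 ≤ (∑ n ∈ S.filter (· ∈ nb m), ‖(K m n * (w n - w m)) • c n‖) ^ 2 := by
          rw [hr]; gcongr; exact norm_sum_le _ _
      _ ≤ (S.filter (· ∈ nb m)).card * ∑ n ∈ S.filter (· ∈ nb m),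
            ‖(K m n * (w n - w m)) • c n‖ ^ 2 := sq_sum_le_card_mul_sum_sq
      _ ≤ D * ∑ n ∈ S.filter (· ∈ nb m), C * (w m * w n) * ‖c n‖ ^ 2 := by
          gcongr with n hn
          rw [norm_smul, mul_pow, Real.norm_eq_abs, sq_abs, mul_pow]
          exact mul_le_mul_of_nonneg_right (hC m n (Finset.mem_filter.1 hn).2) (sq_nonneg _)
      _ = _ := by
          rw [← Finset.sum_filter, Finset.mul_sum, Finset.mul_sum, Finset.sum_mul]
          refine Finset.sum_congr rfl fun n _ => ?_
          ring
  refine (Finset.sum_le_sum h2).trans ?_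
  rw [← Finset.mul_sum, Finset.sum_comm]
  -- A given n is a neighbour of at most D indices m: the second factor D.
  have h3 : ∀ n ∈ S, (∑ m ∈ S, if n ∈ nb m then w n * ‖c n‖ ^ 2 else 0) ≤
      D * (w n * ‖c n‖ ^ 2) := by
    intro n _
    rw [← Finset.sum_filter, Finset.sum_const, nsmul_eq_mul]
    have := hw n
    gcongr
    refine (Finset.card_le_card fun m hm => ?_).trans (hD n)
    exact hK.symm _ _ (Finset.mem_filter.1 hm).2
  refine (mul_le_mul_of_nonneg_left (Finset.sum_le_sum h3) (by positivity)).trans_eq ?_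
  rw [← Finset.mul_sum]; ring

theorem energy_gal_le (hK : IsSkewKernel K nb) {w : ι → ℝ} (hw : ∀ n, 0 < w n) {C : ℝ} {D : ℕ}
    (hC0 : 0 ≤ C) (hC : ∀ n, ∀ m ∈ nb n, K n m ^ 2 * (w m - w n) ^ 2 ≤ C * (w n * w m))
    (hD : ∀ n, (nb n).card ≤ D) (S : Finset ι) (c₀ : ι → ℂ) {t : ℝ} (ht : 0 ≤ t) :
    ∑ n ∈ S, w n * ‖gal K S c₀ t n‖ ^ 2 ≤
      (∑ n ∈ S, w n * ‖c₀ n‖ ^ 2) * Real.exp (D ^ 2 * C / 2 * t) := by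
  have hd : ∀ t, HasDerivAt (fun t => ∑ n ∈ S, w n * ‖gal K S c₀ t n‖ ^ 2)
      (∑ n ∈ S, w n * (2 * inner ℝ (gal K S c₀ t n)
        (truncOp K S (truncOp K S (gal K S c₀ t)) n))) t := fun t =>
    HasDerivAt.fun_sum fun n _ => ((hasDerivAt_gal S c₀ n t).norm_sq).const_mul (w n)
  have := le_mul_exp_of_deriv_right_le (T := t) (G := D ^ 2 * C / 2)
    (fun s _ => (hd s).continuousAt.continuousWithinAt) (fun s _ => (hd s).hasDerivWithinAt)
    (fun s _ => by
      have := energy_deriv_le hK hw hC0 hC hD S (gal K S c₀ s)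
      have e : ∑ n ∈ S, w n * (2 * inner ℝ (gal K S c₀ s n)
          (truncOp K S (truncOp K S (gal K S c₀ s)) n)) = 2 * ∑ n ∈ S, w n *
          inner ℝ (gal K S c₀ s n) (truncOp K S (truncOp K S (gal K S c₀ s)) n) := by
        rw [Finset.mul_sum]; exact Finset.sum_congr rfl fun n _ => by ring
      rw [e]; linarith) ⟨ht, le_rfl⟩
  refine this.trans_eq ?_
  congr 1
  exact Finset.sum_congr rfl fun n hn => by rw [gal_zero, if_pos hn]

/-- Here γ i majorizes A^i c, and the second time derivative is A⁴c. The quadratic remainder is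
independent of S, so it survives a merely pointwise limit and yields the time derivative there
without any convergence of derivatives. -/
theorem taylor_gal (hK : IsSkewKernel K nb) {γ : ℕ → ι → ℝ} (hγ0 : ∀ i n, 0 ≤ γ i n)
    (hγ : ∀ i n, ∑ m ∈ nb n, |K n m| * γ i m ≤ γ (i + 1) n) {S : Finset ι} {c₀ : ι → ℂ} {T : ℝ}
    (hb : ∀ t ∈ Icc 0 T, ∀ n, ‖gal K S c₀ t n‖ ≤ γ 0 n) (n : ι) {t t' : ℝ} (ht : t ∈ Icc 0 T)
    (ht' : t' ∈ Icc 0 T) :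
    ‖gal K S c₀ t' n - gal K S c₀ t n - (t' - t) • truncOp K S (truncOp K S (gal K S c₀ t)) n‖ ≤
      γ 4 n * (t' - t) ^ 2 := by
  set c := gal K S c₀
  have hd1 : ∀ n t, HasDerivAt (fun t => c t n) (truncOp K S (truncOp K S (c t)) n) t :=
    fun n t => hasDerivAt_gal S c₀ n t
  have hd2 : ∀ t, HasDerivAt (fun t => truncOp K S (truncOp K S (c t)) n)
      (truncOp K S (truncOp K S (truncOp K S (truncOp K S (c t)))) n) t := fun t =>
    hasDerivAt_truncOp (fun m => hasDerivAt_truncOp (fun k => hd1 k t) m) n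
  have hb2 : ∀ s ∈ Icc 0 T, ‖truncOp K S (truncOp K S (truncOp K S (truncOp K S (c s)))) n‖ ≤ γ 4 n :=
    fun s hs => norm_truncOp_le hK (hγ0 3) (hγ 3) S
      (norm_truncOp_le hK (hγ0 2) (hγ 2) S (norm_truncOp_le hK (hγ0 1) (hγ 1) S
        (norm_truncOp_le hK (hγ0 0) (hγ 0) S (hb s hs)))) n
  have hsub : uIcc t t' ⊆ Icc 0 T := uIcc_subset_Icc ht ht'
  have h1 : ∀ x ∈ uIcc t t', ‖truncOp K S (truncOp K S (c x)) n - truncOp K S (truncOp K S (c t)) n‖ ≤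
      γ 4 n * ‖t' - t‖ := by
    intro x hx
    refine ((convex_uIcc t t').norm_image_sub_le_of_norm_hasDerivWithin_le
      (fun s _ => (hd2 s).hasDerivWithinAt) (fun s hs => hb2 s (hsub hs)) left_mem_uIcc hx).trans ?_
    gcongr
    · exact hγ0 4 n
    · simpa [Real.norm_eq_abs] using abs_sub_left_of_mem_uIcc hx
  have h2 := (convex_uIcc t t').norm_image_sub_le_of_norm_hasDerivWithin_le
      (f := fun s => c s n - s • truncOp K S (truncOp K S (c t)) n)
      (f' := fun s => truncOp K S (truncOp K S (c s)) n - truncOp K S (truncOp K S (c t)) n)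
      (fun s _ => ((hd1 n s).sub (by
        simpa using (hasDerivAt_id s).smul_const (truncOp K S (truncOp K S (c t)) n))).hasDerivWithinAt)
      h1 left_mem_uIcc right_mem_uIcc
  have e : c t' n - c t n - (t' - t) • truncOp K S (truncOp K S (c t)) n =
      c t' n - t' • truncOp K S (truncOp K S (c t)) n -
        (c t n - t • truncOp K S (truncOp K S (c t)) n) := by
    rw [sub_smul]; ring
  rw [e]
  refine h2.trans_eq ?_
  rw [mul_assoc, ← pow_two, Real.norm_eq_abs, sq_abs]

end Abstract

/-! ### Passage to the limit along an ultrafilter. -/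

section Limit

open scoped Classical

variable {ι : Type*} {K : ι → ι → ℝ} {nb : ι → Finset ι}

/-- An ultrafilter of larger and larger finite index sets. -/
def exhaustion (ι : Type*) : Ultrafilter (Finset ι) := Ultrafilter.of atTop

theorem exhaustion_le : (exhaustion ι : Filter (Finset ι)) ≤ atTop := Ultrafilter.of_le _

theorem eventually_exhaustion (T : Finset ι) : ∀ᶠ S in (exhaustion ι : Filter (Finset ι)), T ⊆ S :=
  exhaustion_le (eventually_ge_atTop T)

/-- The solution of `∂_t c = A² c` obtained as a limit of Galerkin approximations. -/
def evol (K : ι → ι → ℝ) (c₀ : ι → ℂ) (t : ℝ) (n : ι) : ℂ :=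
  limUnder (exhaustion ι : Filter (Finset ι)) fun S => gal K S c₀ t n

theorem norm_gal_sq_le (hK : IsSkewKernel K nb) {D : ℕ} (hD : ∀ n, (nb n).card ≤ D) {c₀ : ι → ℂ}
    (hc₀ : Summable fun n => ‖c₀ n‖ ^ 2) {t : ℝ} (ht : 0 ≤ t) (S : Finset ι) (n : ι) :
    ‖gal K S c₀ t n‖ ^ 2 ≤ ∑' n, ‖c₀ n‖ ^ 2 := by
  by_cases hn : n ∈ S
  · have h := energy_gal_le hK (w := fun _ => 1) (fun _ => one_pos) le_rfl (by simp) hD S c₀ ht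
    simp only [one_mul, mul_zero, zero_div, zero_mul, Real.exp_zero, mul_one] at h
    exact (Finset.single_le_sum (f := fun n => ‖gal K S c₀ t n‖ ^ 2) (fun _ _ => sq_nonneg _)
      hn).trans (h.trans (hc₀.sum_le_tsum S fun _ _ => sq_nonneg _))
  · rw [gal_of_notMem hn]
    simpa using tsum_nonneg fun n => sq_nonneg ‖c₀ n‖

/-- An ultrafilter on a compact ball converges, so no diagonal extraction is needed. The same
ultrafilter serves all data and all times; this makes the limit evolution linear in the datum
(`evol_sub`). -/
theorem tendsto_gal (hK : IsSkewKernel K nb) {D : ℕ} (hD : ∀ n, (nb n).card ≤ D) {c₀ : ι → ℂ}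
    (hc₀ : Summable fun n => ‖c₀ n‖ ^ 2) {t : ℝ} (ht : 0 ≤ t) (n : ι) :
    Tendsto (fun S => gal K S c₀ t n) (exhaustion ι) (𝓝 (evol K c₀ t n)) := by
  apply tendsto_nhds_limUnder
  obtain ⟨x, -, hx⟩ := (isCompact_closedBall (0 : ℂ) (√(∑' n, ‖c₀ n‖ ^ 2))).ultrafilter_le_nhds
    ((exhaustion ι).map fun S => gal K S c₀ t n) (by
      rw [le_principal_iff, Ultrafilter.mem_coe, Ultrafilter.mem_map]
      refine Filter.mem_of_superset Filter.univ_mem fun S _ => ?_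
      rw [mem_preimage, mem_closedBall_zero_iff]
      exact Real.le_sqrt_of_sq_le (norm_gal_sq_le hK hD hc₀ ht S n))
  exact ⟨x, hx⟩

theorem evol_zero (hK : IsSkewKernel K nb) {D : ℕ} (hD : ∀ n, (nb n).card ≤ D) {c₀ : ι → ℂ}
    (hc₀ : Summable fun n => ‖c₀ n‖ ^ 2) : evol K c₀ 0 = c₀ := by
  ext n
  refine tendsto_nhds_unique (tendsto_gal hK hD hc₀ le_rfl n) (tendsto_const_nhds.congr' ?_)
  filter_upwards [eventually_exhaustion {n}] with S hS
  rw [gal_zero, if_pos (hS (Finset.mem_singleton_self n))]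

theorem evol_sub (hK : IsSkewKernel K nb) {D : ℕ} (hD : ∀ n, (nb n).card ≤ D) {a b : ι → ℂ}
    (ha : Summable fun n => ‖a n‖ ^ 2) (hb : Summable fun n => ‖b n‖ ^ 2)
    (hab : Summable fun n => ‖(a - b) n‖ ^ 2) {t : ℝ} (ht : 0 ≤ t) :
    evol K (a - b) t = evol K a t - evol K b t := by
  ext n
  refine tendsto_nhds_unique (tendsto_gal hK hD hab ht n) ?_
  simp only [gal_sub, Pi.sub_apply]
  exact (tendsto_gal hK hD ha ht n).sub (tendsto_gal hK hD hb ht n)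

theorem sum_evol_le (hK : IsSkewKernel K nb) {w : ι → ℝ} (hw : ∀ n, 0 < w n) {C : ℝ}
    {D : ℕ} (hC0 : 0 ≤ C) (hC : ∀ n, ∀ m ∈ nb n, K n m ^ 2 * (w m - w n) ^ 2 ≤ C * (w n * w m))
    (hD : ∀ n, (nb n).card ≤ D) {c₀ : ι → ℂ} (hc₀ : Summable fun n => ‖c₀ n‖ ^ 2)
    (hwc : Summable fun n => w n * ‖c₀ n‖ ^ 2) {t : ℝ} (ht : 0 ≤ t) (T : Finset ι) :
    ∑ n ∈ T, w n * ‖evol K c₀ t n‖ ^ 2 ≤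
      (∑' n, w n * ‖c₀ n‖ ^ 2) * Real.exp (D ^ 2 * C / 2 * t) := by
  refine le_of_tendsto (tendsto_finsetSum T fun n _ =>
    ((tendsto_gal hK hD hc₀ ht n).norm.pow 2).const_mul (w n)) ?_
  filter_upwards [eventually_exhaustion T] with S hS
  have h0 : ∀ n ∈ S, 0 ≤ w n * ‖gal K S c₀ t n‖ ^ 2 := fun n _ => by have := hw n; positivity
  refine (Finset.sum_le_sum_of_subset_of_nonneg hS fun n hn _ => h0 n hn).trans
    ((energy_gal_le hK hw hC0 hC hD S c₀ ht).trans ?_)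
  gcongr
  exact hwc.sum_le_tsum S fun n _ => by have := hw n; positivity

theorem taylor_evol (hK : IsSkewKernel K nb) {D : ℕ} (hD : ∀ n, (nb n).card ≤ D) {c₀ : ι → ℂ}
    (hc₀ : Summable fun n => ‖c₀ n‖ ^ 2) {γ : ℕ → ι → ℝ} (hγ0 : ∀ i n, 0 ≤ γ i n)
    (hγ : ∀ i n, ∑ m ∈ nb n, |K n m| * γ i m ≤ γ (i + 1) n) {T : ℝ}
    (hb : ∀ S, ∀ t ∈ Icc 0 T, ∀ n, ‖gal K S c₀ t n‖ ≤ γ 0 n) (n : ι) {t t' : ℝ} (ht : t ∈ Icc 0 T)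
    (ht' : t' ∈ Icc 0 T) :
    ‖evol K c₀ t' n - evol K c₀ t n - (t' - t) • kerOp K nb (kerOp K nb (evol K c₀ t)) n‖ ≤
      γ 4 n * (t' - t) ^ 2 := by
  -- Each row of K is finite, so for fixed n the truncated operator eventually sees the whole row,
  -- and pointwise convergence is enough.
  have hop : ∀ (c : Finset ι → ι → ℂ) (c' : ι → ℂ),
      (∀ n, Tendsto (fun S => c S n) (exhaustion ι) (𝓝 (c' n))) →
      ∀ n, Tendsto (fun S => truncOp K S (c S) n) (exhaustion ι) (𝓝 (kerOp K nb c' n)) := by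
    intro c c' hc n
    have h1 : Tendsto (fun S => ∑ m ∈ nb n, K n m • c S m) (exhaustion ι) (𝓝 (kerOp K nb c' n)) :=
      tendsto_finsetSum _ fun m _ => (hc m).const_smul (K n m)
    refine h1.congr' ?_
    filter_upwards [eventually_exhaustion (insert n (nb n))] with S hS
    rw [truncOp, if_pos (hS (Finset.mem_insert_self _ _))]
    refine Finset.sum_subset (fun m hm => hS (Finset.mem_insert_of_mem hm)) fun m _ hm => ?_
    simp [hK.supp n m hm]
  have hlim := fun s (hs : s ∈ Icc 0 T) n => tendsto_gal hK hD hc₀ hs.1 n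
  refine le_of_tendsto (((hlim t' ht' n).sub (hlim t ht n)).sub
    ((hop _ _ (hop _ _ (hlim t ht)) n).const_smul (t' - t))).norm (Eventually.of_forall fun S => ?_)
  exact taylor_gal hK hγ0 hγ (hb S) n ht ht'

end Limit

/-! ### The matrix of v·∇ and its commutator with the Sobolev weight. -/

section CellularKernel

/-- The frequencies occurring in the cellular flow. -/
def shifts : Finset (Fin 2 → ℤ) := {![1, 1], ![1, -1], ![-1, 1], ![-1, -1]}

/-- The neighbours of a frequency. -/
def nbh (n : Fin 2 → ℤ) : Finset (Fin 2 → ℤ) := shifts.map (addLeftEmbedding n)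

/-- The matrix of `v · ∇` in the basis of characters, `v` being the cellular flow. -/
def cellKer (n m : Fin 2 → ℤ) : ℝ :=
  if m ∈ nbh n then (((n 1 : ℝ) - m 1) * n 1 - ((n 0 : ℝ) - m 0) * n 0) / 4 else 0

theorem mem_shifts_iff {e : Fin 2 → ℤ} :
    e ∈ shifts ↔ (e 0 = 1 ∨ e 0 = -1) ∧ (e 1 = 1 ∨ e 1 = -1) := by
  have h : ∀ a b : ℤ, e = ![a, b] ↔ e 0 = a ∧ e 1 = b := fun a b => by
    constructor
    · rintro rfl; simp
    · rintro ⟨rfl, rfl⟩; ext i; fin_cases i <;> rfl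
  simp only [shifts, Finset.mem_insert, Finset.mem_singleton, h]
  tauto

theorem mem_nbh_iff {n m : Fin 2 → ℤ} : m ∈ nbh n ↔ m - n ∈ shifts := by
  simp only [nbh, Finset.mem_map, addLeftEmbedding_apply]
  constructor
  · rintro ⟨e, he, rfl⟩; simpa using he
  · intro h; exact ⟨_, h, by abel⟩

theorem neg_mem_shifts {e : Fin 2 → ℤ} (h : e ∈ shifts) : -e ∈ shifts := by
  rw [mem_shifts_iff] at h ⊢
  simp only [Pi.neg_apply]
  omega

theorem card_nbh_le (n : Fin 2 → ℤ) : (nbh n).card ≤ 4 := by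
  rw [nbh, Finset.card_map]; decide

theorem shift_cases {e : Fin 2 → ℤ} (h : e ∈ shifts) :
    ((e 0 : ℝ) = 1 ∨ (e 0 : ℝ) = -1) ∧ ((e 1 : ℝ) = 1 ∨ (e 1 : ℝ) = -1) := by
  obtain ⟨h0, h1⟩ := mem_shifts_iff.1 h
  constructor
  · rcases h0 with h | h <;> simp [h]
  · rcases h1 with h | h <;> simp [h]

/-- Skewness expresses div v = 0. For e = m - n, K(n, m) + K(m, n) = ((e 1)² - (e 0)²)/4, which
vanishes since both entries are ±1. -/
theorem isSkewKernel_cellKer : IsSkewKernel cellKer nbh where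
  supp n m h := by simp [cellKer, h]
  symm n m h := by
    rw [mem_nbh_iff] at h ⊢
    simpa using neg_mem_shifts h
  skew n m := by
    have hsymm : m ∈ nbh n ↔ n ∈ nbh m := by
      simp only [mem_nbh_iff]
      constructor <;> intro h <;> simpa using neg_mem_shifts h
    by_cases h : m ∈ nbh n
    · have h2 := hsymm.1 h
      rw [cellKer, cellKer, if_pos h, if_pos h2]
      obtain ⟨h0, h1⟩ := shift_cases (mem_nbh_iff.1 h)
      simp only [Pi.sub_apply, Int.cast_sub] at h0 h1
      have a0 : ((m 0 : ℝ) - n 0) ^ 2 = 1 := by rcases h0 with h | h <;> rw [h] <;> norm_num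
      have a1 : ((m 1 : ℝ) - n 1) ^ 2 = 1 := by rcases h1 with h | h <;> rw [h] <;> norm_num
      linear_combination (a1 - a0) / 4
    · have h2 : n ∉ nbh m := fun h' => h (hsymm.2 h')
      rw [cellKer, cellKer, if_neg h, if_neg h2, neg_zero]

theorem cellKer_add {n e : Fin 2 → ℤ} (he : e ∈ shifts) :
    cellKer n (n + e) = ((e 0 : ℝ) * n 0 - e 1 * n 1) / 4 := by
  rw [cellKer, if_pos (by rw [mem_nbh_iff]; simpa using he)]
  simp only [Pi.add_apply]; push_cast; ring

theorem sq_freqWeight_two (n : Fin 2 → ℤ) :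
    freqWeight n ^ 2 = 1 + (n 0 : ℝ) ^ 2 + (n 1 : ℝ) ^ 2 := by
  rw [freqWeight_sq, Fin.sum_univ_two]; ring

theorem abs_cellKer_le (n m : Fin 2 → ℤ) : |cellKer n m| ≤ freqWeight n := by
  by_cases h : m ∈ nbh n
  · obtain ⟨e, he, rfl⟩ : ∃ e ∈ shifts, n + e = m := by simpa [nbh] using h
    rw [cellKer_add he]
    have h0 := abs_le.1 (abs_apply_le_freqWeight n 0)
    have h1 := abs_le.1 (abs_apply_le_freqWeight n 1)
    have := freqWeight_pos n
    obtain ⟨a | a, b | b⟩ := shift_cases he <;> rw [a, b, abs_le] <;> constructor <;> linarith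
  · rw [cellKer, if_neg h, abs_zero]; exact (freqWeight_pos n).le

theorem freqWeight_sq_add_sub {n e : Fin 2 → ℤ} (he : e ∈ shifts) :
    |freqWeight (n + e) ^ 2 - freqWeight n ^ 2| ≤ 6 * freqWeight n := by
  rw [sq_freqWeight_two, sq_freqWeight_two]
  have h0 := abs_le.1 (abs_apply_le_freqWeight n 0)
  have h1 := abs_le.1 (abs_apply_le_freqWeight n 1)
  have := one_le_freqWeight n
  simp only [Pi.add_apply]; push_cast
  obtain ⟨a | a, b | b⟩ := shift_cases he <;> rw [a, b, abs_le] <;> constructor <;> nlinarith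

theorem freqWeight_add_le {n e : Fin 2 → ℤ} (he : e ∈ shifts) :
    freqWeight (n + e) ≤ 3 * freqWeight n := by
  have h := abs_le.1 (freqWeight_sq_add_sub (n := n) he)
  have h1 := one_le_freqWeight n
  refine le_of_sq_le_sq ?_ (by linarith)
  nlinarith

theorem freqWeight_le_add {n e : Fin 2 → ℤ} (he : e ∈ shifts) :
    freqWeight n ≤ 3 * freqWeight (n + e) := by
  simpa using freqWeight_add_le (n := n + e) (neg_mem_shifts he)

/-- The commutator constant of the weight `|n|^{2k}`. -/
def commConst (k : ℕ) : ℝ := 36 * k ^ 2 * 81 ^ k * 9 ^ k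

/-- The kernel is O(⟨n⟩) and the weight difference O(⟨n⟩^{2k-1}), so the squared product is
O(⟨n⟩^{4k}). Neighbouring weights are comparable within a factor 3, which lets one factor ⟨n⟩^{2k}
be replaced by ⟨m⟩^{2k}. -/
theorem cellKer_commutator (k : ℕ) (n : Fin 2 → ℤ) : ∀ m ∈ nbh n,
    cellKer n m ^ 2 * (freqWeight m ^ (2 * k) - freqWeight n ^ (2 * k)) ^ 2 ≤
      commConst k * (freqWeight n ^ (2 * k) * freqWeight m ^ (2 * k)) := by
  intro m hm
  obtain ⟨e, he, rfl⟩ : ∃ e ∈ shifts, n + e = m := by simpa [nbh] using hm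
  rcases Nat.eq_zero_or_pos k with rfl | hk
  · simp [commConst]
  set a := freqWeight n
  set b := freqWeight (n + e)
  have ha : 1 ≤ a := one_le_freqWeight n
  have hb : 1 ≤ b := one_le_freqWeight _
  have hba : b ≤ 3 * a := freqWeight_add_le he
  have hab : a ≤ 3 * b := freqWeight_le_add he
  have hK : cellKer n (n + e) ^ 2 ≤ a ^ 2 := sq_le_sq' (abs_le.1 (abs_cellKer_le _ _)).1
    (abs_le.1 (abs_cellKer_le _ _)).2
  have h1 : |b ^ (2 * k) - a ^ (2 * k)| ≤ 6 * a * k * (9 * a ^ 2) ^ (k - 1) := by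
    rw [pow_mul, pow_mul]
    refine (abs_pow_sub_pow_le _ _ _).trans ?_
    have hm : max |b ^ 2| |a ^ 2| ≤ 9 * a ^ 2 := by
      rw [abs_of_nonneg (sq_nonneg _), abs_of_nonneg (sq_nonneg _)]
      exact max_le (by nlinarith) (by nlinarith)
    gcongr
    exact freqWeight_sq_add_sub he
  have h2 : (b ^ (2 * k) - a ^ (2 * k)) ^ 2 ≤ (6 * a * k * (9 * a ^ 2) ^ (k - 1)) ^ 2 := by
    rw [← sq_abs]; gcongr
  have h3 : a ^ (2 * k) ≤ 9 ^ k * b ^ (2 * k) := by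
    rw [pow_mul, pow_mul, ← mul_pow]
    gcongr; nlinarith
  obtain ⟨j, rfl⟩ : ∃ j, k = j + 1 := ⟨k - 1, by omega⟩
  simp only [Nat.add_sub_cancel] at h2
  calc cellKer n (n + e) ^ 2 * (b ^ (2 * (j + 1)) - a ^ (2 * (j + 1))) ^ 2
      ≤ a ^ 2 * (6 * a * (j + 1 : ℕ) * (9 * a ^ 2) ^ j) ^ 2 := by gcongr
    _ = 36 * (j + 1 : ℕ) ^ 2 * 81 ^ j * (a ^ (2 * (j + 1)) * a ^ (2 * (j + 1))) := by
        rw [show (81 : ℝ) ^ j = (9 ^ j) ^ 2 by rw [← pow_mul, mul_comm, pow_mul]; norm_num,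
          mul_pow 9 (a ^ 2) j]
        ring
    _ ≤ 36 * (j + 1 : ℕ) ^ 2 * 81 ^ (j + 1) *
        (a ^ (2 * (j + 1)) * (9 ^ (j + 1) * b ^ (2 * (j + 1)))) := by
        gcongr
        · norm_num
        · omega
    _ = _ := by rw [commConst]; ring

/-- The operator `v · ∇` on Fourier coefficients. -/
def opA (c : (Fin 2 → ℤ) → ℂ) : (Fin 2 → ℤ) → ℂ := kerOp cellKer nbh c

theorem opA_apply (c : (Fin 2 → ℤ) → ℂ) (n : Fin 2 → ℤ) :
    opA c n = ∑ e ∈ shifts, cellKer n (n + e) • c (n + e) := by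
  simp [opA, kerOp, nbh]

theorem opA_sub (a b : (Fin 2 → ℤ) → ℂ) : opA (a - b) = opA a - opA b := by
  ext n; simp [opA_apply, mul_sub, Finset.sum_sub_distrib]

/-- Majorants are kept as quotients of natural powers of the weight, so growth and decay are treated
alike; each application of A raises the numerator exponent by one. -/
theorem sum_nbh_le (j i : ℕ) {M : ℝ} (hM : 0 ≤ M) (n : Fin 2 → ℤ) :
    ∑ m ∈ nbh n, |cellKer n m| * (M * (freqWeight m ^ i / freqWeight m ^ j)) ≤
      4 * 3 ^ (i + j) * M * (freqWeight n ^ (i + 1) / freqWeight n ^ j) := by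
  have hterm : ∀ m ∈ nbh n, |cellKer n m| * (M * (freqWeight m ^ i / freqWeight m ^ j)) ≤
      3 ^ (i + j) * M * (freqWeight n ^ (i + 1) / freqWeight n ^ j) := by
    intro m hm
    obtain ⟨e, he, rfl⟩ : ∃ e ∈ shifts, n + e = m := by simpa [nbh] using hm
    have ha := freqWeight_pos n
    have hb := freqWeight_pos (n + e)
    have h1 : freqWeight (n + e) ^ i / freqWeight (n + e) ^ j ≤
        3 ^ (i + j) * (freqWeight n ^ i / freqWeight n ^ j) := by
      rw [div_le_iff₀ (by positivity)]
      calc freqWeight (n + e) ^ i ≤ (3 * freqWeight n) ^ i := by gcongr; exact freqWeight_add_le he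
        _ = 3 ^ i * (freqWeight n ^ i / freqWeight n ^ j) * freqWeight n ^ j := by
            field_simp
            rw [mul_pow]
        _ ≤ 3 ^ i * (freqWeight n ^ i / freqWeight n ^ j) * (3 * freqWeight (n + e)) ^ j := by
            gcongr; exact freqWeight_le_add he
        _ = _ := by rw [mul_pow, pow_add]; ring
    calc |cellKer n (n + e)| * (M * (freqWeight (n + e) ^ i / freqWeight (n + e) ^ j))
        ≤ freqWeight n * (M * (3 ^ (i + j) * (freqWeight n ^ i / freqWeight n ^ j))) := by
          gcongr; exact abs_cellKer_le _ _
      _ = _ := by rw [pow_succ]; ring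
  refine (Finset.sum_le_card_nsmul _ _ _ hterm).trans ?_
  rw [nsmul_eq_mul]
  have ha := freqWeight_pos n
  have : ((nbh n).card : ℝ) ≤ 4 := by exact_mod_cast card_nbh_le n
  calc _ ≤ 4 * (3 ^ (i + j) * M * (freqWeight n ^ (i + 1) / freqWeight n ^ j)) := by gcongr
    _ = _ := by ring

theorem norm_opA_le {c : (Fin 2 → ℤ) → ℂ} {M : ℝ} (hM : 0 ≤ M) {i j : ℕ}
    (hc : ∀ n, ‖c n‖ ≤ M * (freqWeight n ^ i / freqWeight n ^ j)) (n : Fin 2 → ℤ) :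
    ‖opA c n‖ ≤ 4 * 3 ^ (i + j) * M * (freqWeight n ^ (i + 1) / freqWeight n ^ j) := by
  rw [opA, kerOp]
  refine (norm_sum_le _ _).trans (le_trans (Finset.sum_le_sum fun m _ => ?_) (sum_nbh_le j i hM n))
  rw [norm_smul, Real.norm_eq_abs]
  exact mul_le_mul_of_nonneg_left (hc m) (abs_nonneg _)

theorem hSummable_shift {k : ℕ} {c : (Fin 2 → ℤ) → ℂ} (h : HSummable k c) (e : Fin 2 → ℤ) :
    Summable fun n => freqWeight (n + e) ^ (2 * k) * ‖c (n + e)‖ ^ 2 :=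
  (Equiv.addRight e).summable_iff.2 h

theorem hSummable_opA {k : ℕ} {c : (Fin 2 → ℤ) → ℂ} (h : HSummable (k + 1) c) :
    HSummable k (opA c) ∧ hsq k (opA c) ≤ 16 * 9 ^ (k + 1) * hsq (k + 1) c := by
  have hle : ∀ n, freqWeight n ^ (2 * k) * ‖opA c n‖ ^ 2 ≤ ∑ e ∈ shifts,
      4 * 9 ^ (k + 1) * (freqWeight (n + e) ^ (2 * (k + 1)) * ‖c (n + e)‖ ^ 2) := by
    intro n
    have hn := freqWeight_pos n
    have hcard : (shifts.card : ℝ) = 4 := by norm_num [show shifts.card = 4 by decide]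
    calc freqWeight n ^ (2 * k) * ‖opA c n‖ ^ 2
        ≤ freqWeight n ^ (2 * k) * (∑ e ∈ shifts, freqWeight n * ‖c (n + e)‖) ^ 2 := by
          rw [opA_apply]
          gcongr
          refine (norm_sum_le _ _).trans (Finset.sum_le_sum fun e _ => ?_)
          rw [norm_smul, Real.norm_eq_abs]
          gcongr
          exact abs_cellKer_le _ _
      _ ≤ freqWeight n ^ (2 * k) * (4 * ∑ e ∈ shifts, (freqWeight n * ‖c (n + e)‖) ^ 2) := by
          gcongr
          rw [← hcard]
          exact sq_sum_le_card_mul_sum_sq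
      _ = ∑ e ∈ shifts, 4 * (freqWeight n ^ (2 * (k + 1)) * ‖c (n + e)‖ ^ 2) := by
          rw [Finset.mul_sum, Finset.mul_sum]
          exact Finset.sum_congr rfl fun e _ => by ring
      _ ≤ _ := by
          refine Finset.sum_le_sum fun e he => ?_
          have h1 : freqWeight n ^ (2 * (k + 1)) ≤ 9 ^ (k + 1) * freqWeight (n + e) ^ (2 * (k + 1)) := by
            rw [pow_mul, pow_mul, ← mul_pow]
            gcongr
            nlinarith [freqWeight_le_add (n := n) he, freqWeight_pos (n + e)]
          calc 4 * (freqWeight n ^ (2 * (k + 1)) * ‖c (n + e)‖ ^ 2)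
              ≤ 4 * (9 ^ (k + 1) * freqWeight (n + e) ^ (2 * (k + 1)) * ‖c (n + e)‖ ^ 2) := by gcongr
            _ = _ := by ring
  have hs : ∀ e ∈ shifts, Summable fun n =>
      4 * 9 ^ (k + 1) * (freqWeight (n + e) ^ (2 * (k + 1)) * ‖c (n + e)‖ ^ 2) :=
    fun e _ => (hSummable_shift h e).mul_left _
  have hsum := summable_sum hs
  have h1 : HSummable k (opA c) := Summable.of_nonneg_of_le
    (fun n => mul_nonneg (pow_nonneg (freqWeight_pos n).le _) (sq_nonneg _)) hle hsum
  refine ⟨h1, (h1.tsum_le_tsum hle hsum).trans_eq ?_⟩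
  rw [Summable.tsum_finsetSum hs]
  have : ∀ e ∈ shifts, ∑' n, 4 * 9 ^ (k + 1) * (freqWeight (n + e) ^ (2 * (k + 1)) * ‖c (n + e)‖ ^ 2)
      = 4 * 9 ^ (k + 1) * hsq (k + 1) c := by
    intro e _
    rw [tsum_mul_left]
    congr 1
    exact (Equiv.addRight e).tsum_eq fun n => freqWeight n ^ (2 * (k + 1)) * ‖c n‖ ^ 2
  rw [Finset.sum_congr rfl this, Finset.sum_const, show shifts.card = 4 by decide, nsmul_eq_mul]
  push_cast; ring

/-- Skew-symmetry of `v · ∇` as a summation by parts. -/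
theorem tsum_opA_mul {c l : (Fin 2 → ℤ) → ℂ} {L : ℝ} (hL : 0 ≤ L) {i j : ℕ}
    (hl : ∀ n, ‖l n‖ ≤ L * (freqWeight n ^ i / freqWeight n ^ j))
    (hc : Summable fun n => freqWeight n ^ (i + 1) / freqWeight n ^ j * ‖c n‖) :
    Summable (fun n => opA c n * l n) ∧ Summable (fun n => c n * opA l n) ∧
      ∑' n, opA c n * l n = -∑' n, c n * opA l n := by
  have h2 : ∀ e ∈ shifts, Summable fun n => c n * (cellKer n (n + e) • l (n + e)) := by
    intro e he
    refine Summable.of_norm_bounded (hc.mul_left (L * 3 ^ (i + j))) fun n => ?_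
    have ha := freqWeight_pos n
    have hb := freqWeight_pos (n + e)
    have h1 : freqWeight (n + e) ^ i / freqWeight (n + e) ^ j ≤
        3 ^ (i + j) * (freqWeight n ^ i / freqWeight n ^ j) := by
      rw [div_le_iff₀ (by positivity)]
      calc freqWeight (n + e) ^ i ≤ (3 * freqWeight n) ^ i := by gcongr; exact freqWeight_add_le he
        _ = 3 ^ i * (freqWeight n ^ i / freqWeight n ^ j) * freqWeight n ^ j := by
            field_simp
            rw [mul_pow]
        _ ≤ 3 ^ i * (freqWeight n ^ i / freqWeight n ^ j) * (3 * freqWeight (n + e)) ^ j := by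
            gcongr; exact freqWeight_le_add he
        _ = _ := by rw [mul_pow, pow_add]; ring
    calc ‖c n * (cellKer n (n + e) • l (n + e))‖ = ‖c n‖ * (|cellKer n (n + e)| * ‖l (n + e)‖) := by
          rw [norm_mul, norm_smul, Real.norm_eq_abs]
      _ ≤ ‖c n‖ * (freqWeight n * (L * (3 ^ (i + j) * (freqWeight n ^ i / freqWeight n ^ j)))) := by
          gcongr
          · exact abs_cellKer_le _ _
          · exact (hl _).trans (mul_le_mul_of_nonneg_left h1 hL)
      _ = _ := by rw [pow_succ]; ring
  -- The translation n ↦ n + e turns the contribution of the shift e into minus that of -e on the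
  -- other side; summing over e then only permutes the shifts.
  have h3 : ∀ e ∈ shifts, HasSum (fun n => (cellKer n (n + e) • c (n + e)) * l n)
      (-∑' n, c n * (cellKer n (n + -e) • l (n + -e))) := by
    intro e he
    have h4 := (h2 _ (neg_mem_shifts he)).hasSum.neg
    rw [← (Equiv.addRight e).hasSum_iff] at h4
    refine HasSum.congr_fun h4 fun n => ?_
    have := isSkewKernel_cellKer.skew n (n + e)
    simp only [Function.comp_apply, Equiv.coe_addRight, add_neg_cancel_right, Complex.real_smul, this]
    push_cast; ring
  have e1 : (fun n => opA c n * l n) =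
      fun n => ∑ e ∈ shifts, (cellKer n (n + e) • c (n + e)) * l n := by
    ext n; rw [opA_apply, Finset.sum_mul]
  have e2 : (fun n => c n * opA l n) =
      fun n => ∑ e ∈ shifts, c n * (cellKer n (n + e) • l (n + e)) := by
    ext n; rw [opA_apply, Finset.mul_sum]
  rw [e1, e2]
  refine ⟨summable_sum fun e he => (h3 e he).summable, summable_sum h2, ?_⟩
  rw [Summable.tsum_finsetSum fun e he => (h3 e he).summable, Summable.tsum_finsetSum h2,
    Finset.sum_congr rfl fun e he => (h3 e he).tsum_eq, Finset.sum_neg_distrib]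
  congr 1
  exact Finset.sum_bij' (fun e _ => -e) (fun e _ => -e) (fun e he => neg_mem_shifts he)
    (fun e he => neg_mem_shifts he) (fun e _ => neg_neg e) (fun e _ => neg_neg e) (fun e _ => rfl)

end CellularKernel

/-! ### The evolution on Fourier coefficients: bounds, continuity, differentiability. -/

section Flow

/-- The solution operator of `∂_t c = (v · ∇)² c` on Fourier coefficients. -/
def flow (c₀ : (Fin 2 → ℤ) → ℂ) (t : ℝ) : (Fin 2 → ℤ) → ℂ := evol cellKer c₀ t

variable {c₀ : (Fin 2 → ℤ) → ℂ}

theorem HSummable.l2 {d k : ℕ} {c : (Fin d → ℤ) → ℂ} (h : HSummable k c) :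
    Summable fun n => ‖c n‖ ^ 2 := by
  simpa [HSummable] using h.mono (Nat.zero_le k)

theorem flow_zero {k : ℕ} (h : HSummable k c₀) : flow c₀ 0 = c₀ :=
  evol_zero isSkewKernel_cellKer card_nbh_le h.l2

theorem flow_sub {k : ℕ} {a b : (Fin 2 → ℤ) → ℂ} (ha : HSummable k a) (hb : HSummable k b) {t : ℝ}
    (ht : 0 ≤ t) : flow (a - b) t = flow a t - flow b t :=
  evol_sub isSkewKernel_cellKer card_nbh_le ha.l2 hb.l2 (ha.sub hb).l2 ht

/-- The exponential growth rate of the `H^k` norm squared. -/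
def growthRate (k : ℕ) : ℝ := (4 : ℕ) ^ 2 * commConst k / 2

theorem commConst_nonneg (k : ℕ) : 0 ≤ commConst k := by unfold commConst; positivity

theorem growthRate_nonneg (k : ℕ) : 0 ≤ growthRate k := by
  have := commConst_nonneg k; unfold growthRate; positivity

theorem hSummable_flow {k : ℕ} (h : HSummable k c₀) {t : ℝ} (ht : 0 ≤ t) :
    HSummable k (flow c₀ t) ∧ hsq k (flow c₀ t) ≤ hsq k c₀ * Real.exp (growthRate k * t) := by
  have hb := fun T => sum_evol_le isSkewKernel_cellKer (w := fun n => freqWeight n ^ (2 * k))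
    (fun n => pow_pos (freqWeight_pos n) _) (commConst_nonneg k)
    (fun n => cellKer_commutator k n) card_nbh_le h.l2 h ht T
  have h0 : ∀ n, 0 ≤ freqWeight n ^ (2 * k) * ‖flow c₀ t n‖ ^ 2 := fun n =>
    mul_nonneg (pow_nonneg (freqWeight_pos n).le _) (sq_nonneg _)
  have h1 : HSummable k (flow c₀ t) := summable_of_sum_le h0 hb
  exact ⟨h1, h1.tsum_le_of_sum_le hb⟩

theorem norm_le_of_weighted {d k : ℕ} {z : ℂ} {n : Fin d → ℤ} {B : ℝ}
    (h : freqWeight n ^ (2 * k) * ‖z‖ ^ 2 ≤ B) : ‖z‖ ≤ √B * (freqWeight n ^ 0 / freqWeight n ^ k) := by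
  have hn := freqWeight_pos n
  rw [pow_zero, mul_one_div, le_div_iff₀ (by positivity)]
  apply Real.le_sqrt_of_sq_le
  refine le_trans (le_of_eq ?_) h
  ring

theorem norm_flow_le {k : ℕ} (h : HSummable k c₀) {t : ℝ} (ht : 0 ≤ t) (n : Fin 2 → ℤ) :
    ‖flow c₀ t n‖ ≤ √(hsq k c₀ * Real.exp (growthRate k * t)) *
      (freqWeight n ^ 0 / freqWeight n ^ k) := by
  obtain ⟨h1, h2⟩ := hSummable_flow h ht
  refine norm_le_of_weighted (le_trans ?_ h2)
  exact h1.le_tsum n fun m _ => mul_nonneg (pow_nonneg (freqWeight_pos m).le _) (sq_nonneg _)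

/-- The H^k bound gives coefficients O(⟨n⟩^{-k}), and the remainder costs four powers through A⁴.
The constant is uniform over times in [0, T], so the expansion can be summed against decaying
functionals. -/
theorem exists_flow_taylor {k : ℕ} (h : HSummable k c₀) (T : ℝ) :
    ∃ M : ℝ, 0 ≤ M ∧ ∀ n, ∀ t ∈ Icc 0 T, ∀ t' ∈ Icc 0 T,
      ‖flow c₀ t' n - flow c₀ t n - (t' - t) • opA (opA (flow c₀ t)) n‖ ≤
        M * (freqWeight n ^ 4 / freqWeight n ^ k) * (t' - t) ^ 2 := by
  let B := hsq k c₀ * Real.exp (growthRate k * T)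
  -- The base 4·3^(i+k) is the cost of the i-th application of A and increases with i, so its i-th
  -- power dominates the product of the previous costs.
  let γ : ℕ → (Fin 2 → ℤ) → ℝ := fun i n =>
    (4 * 3 ^ (i + k)) ^ i * √B * (freqWeight n ^ i / freqWeight n ^ k)
  have hw := fun n : Fin 2 → ℤ => freqWeight_pos n
  refine ⟨(4 * 3 ^ (4 + k)) ^ 4 * √B, by positivity, fun n t ht t' ht' => ?_⟩
  refine taylor_evol isSkewKernel_cellKer card_nbh_le h.l2 (γ := γ)
    (fun i n => by have := hw n; simp only [γ]; positivity) (fun i n => ?_) (fun S s hs n => ?_) n ht ht'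
  · refine (sum_nbh_le k i (by positivity) n).trans ?_
    have := hw n
    have e : 4 * 3 ^ (i + k) * ((4 * 3 ^ (i + k)) ^ i * √B) * (freqWeight n ^ (i + 1) / freqWeight n ^ k) =
        (4 * 3 ^ (i + k)) ^ (i + 1) * √B * (freqWeight n ^ (i + 1) / freqWeight n ^ k) := by ring
    rw [e]
    simp only [γ]
    gcongr <;> norm_num
  · have hB := hsq_nonneg k c₀
    have : ‖gal cellKer S c₀ s n‖ ≤ √B * (freqWeight n ^ 0 / freqWeight n ^ k) := by
      apply norm_le_of_weighted
      by_cases hn : n ∈ S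
      · refine (Finset.single_le_sum
          (f := fun n => freqWeight n ^ (2 * k) * ‖gal cellKer S c₀ s n‖ ^ 2)
          (fun m _ => mul_nonneg (pow_nonneg (hw m).le _) (sq_nonneg _)) hn).trans
          ((energy_gal_le isSkewKernel_cellKer (fun n => pow_pos (hw n) _) (commConst_nonneg k)
            (fun n => cellKer_commutator k n) card_nbh_le S c₀ hs.1).trans ?_)
        refine mul_le_mul (h.sum_le_tsum S fun m _ => mul_nonneg (pow_nonneg (hw m).le _)
          (sq_nonneg _)) ?_ (Real.exp_pos _).le hB
        rw [Real.exp_le_exp]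
        exact mul_le_mul_of_nonneg_left hs.2 (growthRate_nonneg k)
      · rw [gal_of_notMem hn, norm_zero, zero_pow two_ne_zero, mul_zero]; positivity
    simpa [γ] using this

theorem tendsto_flow_apply {k : ℕ} (h : HSummable k c₀) {t : ℝ} (ht : 0 ≤ t) (n : Fin 2 → ℤ) :
    Tendsto (fun s => flow c₀ s n) (𝓝[Ici 0] t) (𝓝 (flow c₀ t n)) := by
  obtain ⟨M, hM, hb⟩ := exists_flow_taylor h (t + 1)
  have h1 : Tendsto (fun s => flow c₀ s n - flow c₀ t n - (s - t) • opA (opA (flow c₀ t)) n)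
      (𝓝[Ici 0] t) (𝓝 0) := by
    have h2 : Tendsto (fun s => M * (freqWeight n ^ 4 / freqWeight n ^ k) * (s - t) ^ 2)
        (𝓝[Ici 0] t) (𝓝 0) := by
      refine Tendsto.mono_left ?_ nhdsWithin_le_nhds
      have : Continuous fun s => M * (freqWeight n ^ 4 / freqWeight n ^ k) * (s - t) ^ 2 := by fun_prop
      simpa using this.tendsto t
    refine squeeze_zero_norm' ?_ h2
    filter_upwards [self_mem_nhdsWithin, mem_nhdsWithin_of_mem_nhds (Iio_mem_nhds (lt_add_one t))]
      with s hs hs'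
    exact hb n t ⟨ht, by linarith⟩ s ⟨hs, le_of_lt hs'⟩
  have h3 : Tendsto (fun s : ℝ => (s - t) • opA (opA (flow c₀ t)) n) (𝓝[Ici 0] t) (𝓝 0) := by
    refine Tendsto.mono_left ?_ nhdsWithin_le_nhds
    have : Continuous fun s : ℝ => (s - t) • opA (opA (flow c₀ t)) n := by fun_prop
    simpa using this.tendsto t
  have := (h1.add h3).add_const (flow c₀ t n)
  simpa using this

/-- Two extra derivatives provide the summable majorant ⟨n⟩⁻⁴, and dominated convergence upgrades
coefficientwise continuity to H^k. -/
theorem tendsto_hsq_flow_of_regular {k : ℕ} (h : HSummable (k + 2) c₀) {t : ℝ} (ht : 0 ≤ t) :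
    Tendsto (fun s => hsq k (flow c₀ s - flow c₀ t)) (𝓝[Ici 0] t) (𝓝 0) := by
  let B := hsq (k + 2) c₀ * Real.exp (growthRate (k + 2) * (t + 1))
  have hB0 := hsq_nonneg (k + 2) c₀
  have hbd : ∀ s, 0 ≤ s → s ≤ t + 1 → ∀ n,
      freqWeight n ^ (2 * k) * ‖flow c₀ s n‖ ^ 2 ≤ B * (freqWeight n ^ 4)⁻¹ := by
    intro s hs hs1 n
    obtain ⟨h1, h2⟩ := hSummable_flow h hs
    have h3 := h1.le_tsum n fun m _ => mul_nonneg (pow_nonneg (freqWeight_pos m).le _) (sq_nonneg _)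
    have h4 : hsq (k + 2) c₀ * Real.exp (growthRate (k + 2) * s) ≤ B := by
      refine mul_le_mul_of_nonneg_left (Real.exp_le_exp.2 ?_) hB0
      exact mul_le_mul_of_nonneg_left hs1 (growthRate_nonneg _)
    have hn := freqWeight_pos n
    rw [← div_eq_mul_inv, le_div_iff₀ (by positivity)]
    refine le_trans (le_of_eq ?_) (h3.trans (h2.trans h4))
    ring
  have hlim : ∀ n, Tendsto (fun s => freqWeight n ^ (2 * k) * ‖(flow c₀ s - flow c₀ t) n‖ ^ 2)
      (𝓝[Ici 0] t) (𝓝 0) := fun n => by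
    have := (((tendsto_flow_apply h ht n).sub_const (flow c₀ t n)).norm.pow 2).const_mul
      (freqWeight n ^ (2 * k))
    simpa using this
  have := tendsto_tsum_of_dominated_convergence (bound := fun n => 4 * (B * (freqWeight n ^ 4)⁻¹))
    (((summable_freqWeight_inv_pow_four (d := 2) (by norm_num)).mul_left B).mul_left 4) hlim (by
      filter_upwards [self_mem_nhdsWithin, mem_nhdsWithin_of_mem_nhds (Iio_mem_nhds (lt_add_one t))]
        with s hs hs' n
      have hw : 0 ≤ freqWeight n ^ (2 * k) := pow_nonneg (freqWeight_pos n).le _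
      rw [Real.norm_of_nonneg (mul_nonneg hw (sq_nonneg _))]
      have h1 := hbd s hs (le_of_lt hs') n
      have h2 := hbd t ht (by linarith) n
      have h3 := mul_le_mul_of_nonneg_left (norm_sq_sub_le (flow c₀ s n) (flow c₀ t n)) hw
      simp only [Pi.sub_apply]
      linarith)
  simpa [hsq] using this

/-- Restriction of a sequence to a finite set of frequencies. -/
def cutoff (F : Finset (Fin 2 → ℤ)) (c : (Fin 2 → ℤ) → ℂ) : (Fin 2 → ℤ) → ℂ :=
  fun n => if n ∈ F then c n else 0

theorem hSummable_cutoff (F : Finset (Fin 2 → ℤ)) (c : (Fin 2 → ℤ) → ℂ) (k : ℕ) :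
    HSummable k (cutoff F c) :=
  summable_of_ne_finset_zero (s := F) fun n hn => by simp [cutoff, hn]

theorem tendsto_hsq_sub_cutoff {k : ℕ} {c : (Fin 2 → ℤ) → ℂ} (h : HSummable k c) :
    Tendsto (fun F => hsq k (c - cutoff F c)) atTop (𝓝 0) := by
  have h1 : ∀ F : Finset (Fin 2 → ℤ), hsq k (c - cutoff F c) =
      hsq k c - ∑ n ∈ F, freqWeight n ^ (2 * k) * ‖c n‖ ^ 2 := by
    intro F
    have e1 : ∑ n ∈ F, freqWeight n ^ (2 * k) * ‖c n‖ ^ 2 =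
        ∑' n, freqWeight n ^ (2 * k) * ‖cutoff F c n‖ ^ 2 := by
      rw [tsum_eq_sum (s := F) fun n hn => by simp [cutoff, hn]]
      exact Finset.sum_congr rfl fun n hn => by simp [cutoff, hn]
    rw [e1, hsq, hsq, ← h.tsum_sub (hSummable_cutoff F c k)]
    refine tsum_congr fun n => ?_
    by_cases hn : n ∈ F <;> simp [cutoff, hn]
  simp only [h1]
  have := (tendsto_const_nhds (x := hsq k c)).sub h.hasSum
  simpa [hsq] using this

/-- Density argument: the datum is split into a finite part, covered by the regular case, and a
remainder small in H^k, which stays small on [0, t + 1] by linearity and the growth bound. -/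
theorem tendsto_hsq_flow {k : ℕ} (h : HSummable k c₀) {t : ℝ} (ht : 0 ≤ t) :
    Tendsto (fun s => hsq k (flow c₀ s - flow c₀ t)) (𝓝[Ici 0] t) (𝓝 0) := by
  rw [Metric.tendsto_nhds]
  intro ε hε
  set R := Real.exp (growthRate k * (t + 1))
  have hR : 0 < R := Real.exp_pos _
  -- With this choice the remainder contributes at most 2(2ε/16 + 2ε/16) = ε/2 below, and the finite
  -- part less than 2·ε/4.
  obtain ⟨F, hF⟩ := ((tendsto_hsq_sub_cutoff h).eventually
    (gt_mem_nhds (by positivity : (0 : ℝ) < ε / (16 * R)))).exists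
  set a := cutoff F c₀
  have ha := hSummable_cutoff F c₀ k
  have hreg := tendsto_hsq_flow_of_regular (hSummable_cutoff F c₀ (k + 2)) ht
  filter_upwards [hreg.eventually (gt_mem_nhds (by positivity : (0 : ℝ) < ε / 4)), self_mem_nhdsWithin,
    mem_nhdsWithin_of_mem_nhds (Iio_mem_nhds (lt_add_one t))] with s hs hs0 hs1
  have hs0' : 0 ≤ s := hs0
  have hb : ∀ r, 0 ≤ r → r ≤ t + 1 → HSummable k (flow (c₀ - a) r) ∧
      hsq k (flow (c₀ - a) r) ≤ ε / 16 := by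
    intro r hr hr1
    obtain ⟨h1, h2⟩ := hSummable_flow (h.sub ha) hr
    refine ⟨h1, h2.trans ?_⟩
    have h3 : Real.exp (growthRate k * r) ≤ R :=
      Real.exp_le_exp.2 (mul_le_mul_of_nonneg_left hr1 (growthRate_nonneg k))
    calc _ ≤ ε / (16 * R) * R := by
          have := hsq_nonneg k (c₀ - a)
          gcongr
      _ = ε / 16 := by field_simp
  obtain ⟨hs2, hs3⟩ := hb s hs0' (le_of_lt hs1)
  obtain ⟨ht2, ht3⟩ := hb t ht (by linarith)
  have e : flow c₀ s - flow c₀ t = (flow (c₀ - a) s - flow (c₀ - a) t) - (flow a t - flow a s) := by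
    rw [flow_sub h ha hs0', flow_sub h ha ht]; abel
  have hfa := (hSummable_flow ha ht).1.sub (hSummable_flow ha hs0').1
  have hsym : hsq k (flow a t - flow a s) = hsq k (flow a s - flow a t) := by
    simp only [hsq, Pi.sub_apply, norm_sub_rev]
  have h1 := hsq_sub_le (hs2.sub ht2) hfa
  have h2 := hsq_sub_le hs2 ht2
  rw [e, Real.dist_0_eq_abs, abs_of_nonneg (hsq_nonneg _ _)]
  linarith

/-- Linear functionals of the flow are differentiable in time, provided that the initial datum is
regular enough compared with the functional. -/
theorem hasDerivWithinAt_tsum_flow {k i j : ℕ} (h : HSummable k c₀) {l : (Fin 2 → ℤ) → ℂ} {L : ℝ}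
    (hL : 0 ≤ L) (hl : ∀ n, ‖l n‖ ≤ L * (freqWeight n ^ i / freqWeight n ^ j)) (hij : i + 8 ≤ j + k)
    {t : ℝ} (ht : 0 ≤ t) :
    HasDerivWithinAt (fun s => ∑' n, flow c₀ s n * l n)
      (∑' n, flow c₀ t n * opA (opA l) n) (Ici 0) t := by
  have hsum : ∀ m : ℕ, m + 4 ≤ j + k →
      Summable fun n : Fin 2 → ℤ => freqWeight n ^ m / freqWeight n ^ (j + k) := by
    intro m hm
    refine Summable.of_nonneg_of_le (fun n => by have := freqWeight_pos n; positivity) (fun n => ?_)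
      (summable_freqWeight_inv_pow_four (d := 2) (by norm_num))
    have hn := freqWeight_pos n
    rw [← one_div, div_le_div_iff₀ (by positivity) (by positivity), one_mul, ← pow_add]
    exact pow_le_pow_right₀ (one_le_freqWeight n) hm
  have hprod : ∀ {a b : (Fin 2 → ℤ) → ℂ} {p q : ℕ} {P Q : ℝ}, 0 ≤ P →
      (∀ n, ‖a n‖ ≤ P * (freqWeight n ^ p / freqWeight n ^ k)) →
      (∀ n, ‖b n‖ ≤ Q * (freqWeight n ^ q / freqWeight n ^ j)) → p + q + 4 ≤ j + k →
      Summable fun n => a n * b n := by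
    intro a b p q P Q hP ha hb hpq
    refine Summable.of_norm_bounded ((hsum (p + q) hpq).mul_left (P * Q)) fun n => ?_
    have hn := freqWeight_pos n
    rw [norm_mul]
    refine (mul_le_mul (ha n) (hb n) (norm_nonneg _) (by positivity)).trans_eq ?_
    rw [pow_add, pow_add]; field_simp
  have hflow := fun s (hs : 0 ≤ s) n => norm_flow_le h hs n
  have hA := norm_opA_le (Real.sqrt_nonneg _) (hflow t ht)
  have hA2 := norm_opA_le (by positivity) hA
  have hAl := norm_opA_le hL hl
  have hweight : ∀ {a : (Fin 2 → ℤ) → ℂ} {p q : ℕ} {P : ℝ}, 0 ≤ P →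
      (∀ n, ‖a n‖ ≤ P * (freqWeight n ^ p / freqWeight n ^ k)) → p + q + 4 ≤ j + k →
      Summable fun n => freqWeight n ^ q / freqWeight n ^ j * ‖a n‖ := by
    intro a p q P hP ha hpq
    refine Summable.of_nonneg_of_le (fun n => by have := freqWeight_pos n; positivity) (fun n => ?_)
      ((hsum (p + q) hpq).mul_left P)
    have hn := freqWeight_pos n
    refine (mul_le_mul_of_nonneg_left (ha n) (by positivity)).trans_eq ?_
    rw [pow_add, pow_add]; field_simp
  -- Two summations by parts move A² from the flow to the functional.
  have hparts : ∑' n, opA (opA (flow c₀ t)) n * l n = ∑' n, flow c₀ t n * opA (opA l) n := by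
    rw [(tsum_opA_mul hL hl (hweight (by positivity) hA (by omega))).2.2,
      (tsum_opA_mul (by positivity) hAl
        (hweight (Real.sqrt_nonneg _) (hflow t ht) (by omega))).2.2, neg_neg]
  rw [← hparts]
  obtain ⟨M, hM, hb⟩ := exists_flow_taylor h (t + 1)
  have hs0 := hprod (Real.sqrt_nonneg _) (hflow t ht) hl (by omega)
  have hs2 := hprod (by positivity) hA2 hl (by omega)
  -- The Taylor remainder is O(⟨n⟩^{4-k}) and the functional O(⟨n⟩^{i-j}); the series converges
  -- because i + 8 ≤ j + k leaves four powers of decay.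
  set Z := M * L * ∑' n : Fin 2 → ℤ, freqWeight n ^ (4 + i) / freqWeight n ^ (j + k)
  have hest : ∀ᶠ s in 𝓝[Ici 0] t, ‖∑' n, flow c₀ s n * l n - ∑' n, flow c₀ t n * l n -
      (s - t) • ∑' n, opA (opA (flow c₀ t)) n * l n‖ ≤ Z * (s - t) ^ 2 := by
    filter_upwards [self_mem_nhdsWithin, mem_nhdsWithin_of_mem_nhds (Iio_mem_nhds (lt_add_one t))]
      with s hs hs'
    have hss := hprod (Real.sqrt_nonneg _) (hflow s hs) hl (by omega)
    rw [← hss.tsum_sub hs0, ← hs2.tsum_const_smul (s - t),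
      ← (hss.sub hs0).tsum_sub (hs2.const_smul (s - t))]
    have hZ : Z * (s - t) ^ 2 = ∑' n : Fin 2 → ℤ,
        M * L * (s - t) ^ 2 * (freqWeight n ^ (4 + i) / freqWeight n ^ (j + k)) := by
      rw [tsum_mul_left]; ring
    rw [hZ]
    refine tsum_of_norm_bounded ((hsum (4 + i) (by omega)).mul_left _).hasSum fun n => ?_
    have hn := freqWeight_pos n
    have e : flow c₀ s n * l n - flow c₀ t n * l n - (s - t) • (opA (opA (flow c₀ t)) n * l n) =
        (flow c₀ s n - flow c₀ t n - (s - t) • opA (opA (flow c₀ t)) n) * l n := by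
      rw [sub_mul, sub_mul, smul_mul_assoc]
    rw [e, norm_mul]
    refine (mul_le_mul (hb n t ⟨ht, by linarith⟩ s ⟨hs, le_of_lt hs'⟩) (hl n) (norm_nonneg _)
      (by positivity)).trans_eq ?_
    rw [pow_add, pow_add]; field_simp
  rw [hasDerivWithinAt_iff_isLittleO]
  refine Asymptotics.IsBigO.trans_isLittleO (g := fun s => (s - t) ^ 2) ?_ ?_
  · refine Asymptotics.IsBigO.of_bound Z ?_
    filter_upwards [hest] with s hs
    rwa [Real.norm_of_nonneg (sq_nonneg _)]
  · have : Tendsto (fun s : ℝ => s - t) (𝓝[Ici 0] t) (𝓝 0) := by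
      refine Tendsto.mono_left ?_ nhdsWithin_le_nhds
      simpa using (continuous_sub_right t).tendsto t
    have h2 := (Asymptotics.isLittleO_one_iff ℝ).2 this
    have h3 := h2.mul_isBigO (Asymptotics.isBigO_refl (fun s => s - t) (𝓝[Ici 0] t))
    simpa [pow_two] using h3

end Flow

/-! ### The cellular flow in physical space. -/

section CellularFlow

theorem euc_single_zero {d : ℕ} (i : Fin d) : (EuclideanSpace.single i (0 : ℝ) : Euc d) = 0 := by
  ext; simp

theorem char_eq_exp_mul_exp (n : Fin 2 → ℤ) (x : Euc 2) :
    char n x = Complex.exp (x 0 * Complex.I) ^ n 0 * Complex.exp (x 1 * Complex.I) ^ n 1 := by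
  rw [char, phaseL_apply, Fin.sum_univ_two, mul_add, Complex.exp_add, ← Complex.exp_int_mul,
    ← Complex.exp_int_mul]
  congr 2 <;> ring

/-- The characters diagonalize the derivatives: `v · ∇ e^{i n · x}` in terms of characters. -/
theorem opA_char (n : Fin 2 → ℤ) (x : Euc 2) :
    opA (fun m => char m x) n = -(char n x * phaseL n (cellularFlow x)) := by
  have hsum : opA (fun m => char m x) n = ∑ e ∈ shifts,
      ((((e 0 : ℝ) * n 0 - e 1 * n 1) / 4 : ℝ) : ℂ) * (char n x * char e x) := by
    rw [opA_apply]
    refine Finset.sum_congr rfl fun e he => ?_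
    rw [cellKer_add he, char_add, Complex.real_smul]
  have hp : Complex.exp (x 0 * Complex.I) = Complex.cos (x 0) + Complex.sin (x 0) * Complex.I :=
    Complex.exp_mul_I _
  have hq : Complex.exp (x 1 * Complex.I) = Complex.cos (x 1) + Complex.sin (x 1) * Complex.I :=
    Complex.exp_mul_I _
  have hp' : (Complex.exp (x 0 * Complex.I))⁻¹ = Complex.cos (x 0) - Complex.sin (x 0) * Complex.I := by
    rw [← Complex.exp_neg, ← neg_mul, Complex.exp_mul_I, Complex.cos_neg, Complex.sin_neg]; ring
  have hq' : (Complex.exp (x 1 * Complex.I))⁻¹ = Complex.cos (x 1) - Complex.sin (x 1) * Complex.I := by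
    rw [← Complex.exp_neg, ← neg_mul, Complex.exp_mul_I, Complex.cos_neg, Complex.sin_neg]; ring
  rw [hsum, shifts, Finset.sum_insert (by decide), Finset.sum_insert (by decide),
    Finset.sum_insert (by decide), Finset.sum_singleton]
  simp only [char_eq_exp_mul_exp ![_, _], Matrix.cons_val_zero, Matrix.cons_val_one, zpow_neg,
    zpow_one, hp', hq']
  simp only [hp, hq]
  rw [phaseL_apply, Fin.sum_univ_two]
  simp only [cellularFlow, PiLp.toLp_apply, Matrix.cons_val_zero, Matrix.cons_val_one]
  push_cast
  ring

/-- Summation by parts against n ↦ e^{in·x} moves the operator from the coefficients to the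
characters, where `opA_char` identifies it with v·∇ up to the sign that skewness supplies. -/
theorem advect_synth {c : (Fin 2 → ℤ) → ℂ} (hc : Summable fun n => freqWeight n ^ 1 * ‖c n‖) :
    advect cellularFlow (synth c) = synth (opA c) := by
  ext x
  have h := tsum_opA_mul (c := c) (l := fun n => char n x) (L := 1) (i := 0) (j := 0) one_pos.le
    (fun n => by simp [norm_char]) (by simpa using hc)
  rw [advect, fderiv_synth_apply hc, synth, csynth, h.2.2, ← tsum_neg]
  congr 1
  exact tsum_congr fun n => by rw [opA_char]; ring

/-- The cellular flow on `𝕋³`. -/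
def cellularFlow₃ : Euc 3 → Euc 3 := twoHalf cellularFlow 0

theorem contDiff_cellularFlow {n : WithTop ℕ∞} : ContDiff ℝ n cellularFlow := by
  rw [contDiff_euclidean]
  intro i
  fin_cases i
  · change ContDiff ℝ n fun x : Euc 2 => -(Real.sin (x 0) * Real.cos (x 1))
    fun_prop
  · change ContDiff ℝ n fun x : Euc 2 => Real.cos (x 0) * Real.sin (x 1)
    fun_prop

theorem contDiff_twoHalf {n : WithTop ℕ∞} {w : Euc 2 → Euc 2} {h : Euc 2 → ℝ} (hw : ContDiff ℝ n w)
    (hh : ContDiff ℝ n h) : ContDiff ℝ n (twoHalf w h) := by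
  have h1 := contDiff_euclidean.1 (hw.comp contDiff_horiz)
  rw [contDiff_euclidean]
  intro i
  fin_cases i
  · exact h1 0
  · exact h1 1
  · exact hh.comp contDiff_horiz

theorem continuous_twoHalf {w : Euc 2 → Euc 2} {h : Euc 2 → ℝ} (hw : Continuous w)
    (hh : Continuous h) : Continuous (twoHalf w h) :=
  contDiff_zero.1 (contDiff_twoHalf (contDiff_zero.2 hw) (contDiff_zero.2 hh))

theorem periodic_cellularFlow : Periodic cellularFlow := by
  intro i x
  ext j
  fin_cases i <;> fin_cases j <;> simp [cellularFlow]

theorem Periodic.twoHalf {w : Euc 2 → Euc 2} {h : Euc 2 → ℝ} (hw : Periodic w) (hh : Periodic h) :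
    Periodic (twoHalf w h) := by
  intro i x
  simp only [MRE.twoHalf, hw.comp_horiz i x, hh.comp_horiz i x]

theorem contDiff_cellularFlow₃ {n : WithTop ℕ∞} : ContDiff ℝ n cellularFlow₃ :=
  contDiff_twoHalf contDiff_cellularFlow contDiff_const

theorem periodic_cellularFlow₃ : Periodic cellularFlow₃ :=
  periodic_cellularFlow.twoHalf fun _ _ => rfl

theorem cellularFlow₃_eq (x : Euc 3) : cellularFlow₃ x =
    (-(Real.sin (x 0) * Real.cos (x 1))) • EuclideanSpace.single 0 1 +
      (Real.cos (x 0) * Real.sin (x 1)) • EuclideanSpace.single 1 1 := by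
  ext j
  fin_cases j <;> simp [cellularFlow₃, twoHalf, cellularFlow]

/-- Derivatives along the cellular flow have zero mean. -/
theorem integral_fderiv_cellularFlow₃ {E : Type*} [NormedAddCommGroup E] [NormedSpace ℝ E]
    [CompleteSpace E] {f : Euc 3 → E} (hf : ContDiff ℝ 1 f) (hper : Periodic f) :
    ∫ x in cell 3, fderiv ℝ f x (cellularFlow₃ x) = 0 := by
  have hd := hf.differentiable one_ne_zero
  have hc : ∀ y, Continuous fun x => fderiv ℝ f x y := fun y =>
    (hf.continuous_fderiv one_ne_zero).clm_apply continuous_const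
  have h0 := integral_cell_deriv_eq_zero (d := 3) 0
    (F := fun x => (-(Real.sin (x 0) * Real.cos (x 1))) • f x)
    (F' := fun x => (-(Real.sin (x 0) * Real.cos (x 1))) • fderiv ℝ f x (EuclideanSpace.single 0 1) +
      (-(Real.cos (x 0) * Real.cos (x 1))) • f x)
    (fun x => by
      have h1 := HasFDerivAt.hasDerivAt_single (hd x).hasFDerivAt 0
      have h2 : HasDerivAt (fun s : ℝ => -(Real.sin ((x + EuclideanSpace.single 0 s : Euc 3) 0) *
          Real.cos ((x + EuclideanSpace.single 0 s : Euc 3) 1))) (-(Real.cos (x 0) * Real.cos (x 1))) 0 := by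
        have h3 : HasDerivAt (fun s : ℝ => x 0 + s) 1 0 := (hasDerivAt_id 0).const_add _
        simpa using (h3.sin.mul_const (Real.cos (x 1))).fun_neg
      simpa [euc_single_zero] using h2.fun_smul h1)
    (by have := hf.continuous; have := hc (EuclideanSpace.single 0 1); fun_prop)
    (fun x => by rw [hper 0 x]; simp)
  have h1 := integral_cell_deriv_eq_zero (d := 3) 1
    (F := fun x => (Real.cos (x 0) * Real.sin (x 1)) • f x)
    (F' := fun x => (Real.cos (x 0) * Real.sin (x 1)) • fderiv ℝ f x (EuclideanSpace.single 1 1) +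
      (Real.cos (x 0) * Real.cos (x 1)) • f x)
    (fun x => by
      have h1 := HasFDerivAt.hasDerivAt_single (hd x).hasFDerivAt 1
      have h2 : HasDerivAt (fun s : ℝ => Real.cos ((x + EuclideanSpace.single 1 s : Euc 3) 0) *
          Real.sin ((x + EuclideanSpace.single 1 s : Euc 3) 1)) (Real.cos (x 0) * Real.cos (x 1)) 0 := by
        have h3 : HasDerivAt (fun s : ℝ => x 1 + s) 1 0 := (hasDerivAt_id 0).const_add _
        simpa using (h3.sin.const_mul (Real.cos (x 0)))
      simpa [euc_single_zero] using h2.fun_smul h1)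
    (by have := hf.continuous; have := hc (EuclideanSpace.single 1 1); fun_prop)
    (fun x => by rw [hper 1 x]; simp)
  -- In the sum the zero-order terms ∓cos x₀ cos x₁ f cancel, which is div v = 0.
  have h2 := congrArg₂ (· + ·) h0 h1
  simp only [add_zero] at h2
  rw [← integral_add] at h2
  · rw [← h2]
    refine setIntegral_congr_fun (measurableSet_cell 3) fun x _ => ?_
    simp only [cellularFlow₃_eq, map_add, map_smul]
    rw [neg_smul (Real.cos (x 0) * Real.cos (x 1))]
    abel
  · apply integrableOn_cell
    have := hf.continuous; have := hc (EuclideanSpace.single 0 1); fun_prop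
  · apply integrableOn_cell
    have := hf.continuous; have := hc (EuclideanSpace.single 1 1); fun_prop

end CellularFlow

/-! ### The linear equation tested against smooth functions on the three-torus. -/

section WeakForm

theorem Periodic.fderiv {d : ℕ} {F : Type*} [NormedAddCommGroup F] [NormedSpace ℝ F]
    {f : Euc d → F} (hf : Periodic f) : Periodic (fderiv ℝ f) := by
  intro i x
  rw [← fderiv_comp_add_right]
  congr 1
  exact funext (hf i)

/-- Smooth periodic functions. -/
def SmoothPeriodic {d : ℕ} (Ψ : Euc d → ℝ) : Prop := ContDiff ℝ ∞ Ψ ∧ Periodic Ψ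

theorem SmoothPeriodic.fderiv_apply {d : ℕ} {Ψ : Euc d → ℝ} (h : SmoothPeriodic Ψ)
    {X : Euc d → Euc d} (hX : ContDiff ℝ ∞ X) (hXp : Periodic X) :
    SmoothPeriodic fun x => fderiv ℝ Ψ x (X x) :=
  ⟨(h.1.fderiv_right (m := ∞) (by simp)).clm_apply hX,
    fun i x => by simp only [h.2.fderiv i x, hXp i x]⟩

/-- The integral of a function on `𝕋³` against a horizontal character. -/
def modeInt (Ψ : Euc 3 → ℝ) (n : Fin 2 → ℤ) : ℂ :=
  ∫ x in cell 3, char n (horiz x) * (Ψ x : ℂ)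

theorem continuous_char_horiz (n : Fin 2 → ℤ) : Continuous fun x : Euc 3 => char n (horiz x) :=
  (continuous_char n).comp continuous_horiz

theorem integral_synth_horiz_mul {c : (Fin 2 → ℤ) → ℂ} (hc : Summable fun n => ‖c n‖)
    {Ψ : Euc 3 → ℝ} (hΨ : Continuous Ψ) :
    ∫ x in cell 3, synth c (horiz x) * Ψ x = (∑' n, c n * modeInt Ψ n).re := by
  have h := integral_csynth_comp_mul continuous_horiz hc (φ := fun x => (Ψ x : ℂ)) (by fun_prop)
  have h1 : IntegrableOn (fun x => csynth c (horiz x) * (Ψ x : ℂ)) (cell 3) :=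
    integrableOn_cell (((continuous_csynth hc).comp continuous_horiz).mul (by fun_prop))
  have h2 := integral_re h1
  rw [h] at h2
  refine Eq.trans ?_ h2
  exact setIntegral_congr_fun (measurableSet_cell 3) fun x _ => by simp [synth]

theorem hasFDerivAt_char_horiz_mul (n : Fin 2 → ℤ) {Ψ : Euc 3 → ℝ} (h : SmoothPeriodic Ψ)
    (x : Euc 3) : HasFDerivAt (fun x => char n (horiz x) * (Ψ x : ℂ))
      (char n (horiz x) • Complex.ofRealCLM.comp (fderiv ℝ Ψ x) +
        (Ψ x : ℂ) • (char n (horiz x) • (phaseL n).comp horizL)) x := by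
  have h1 : HasFDerivAt (fun x : Euc 3 => char n (horiz x))
      ((char n (horiz x) • phaseL n).comp horizL) x :=
    (hasFDerivAt_char n (horizL x)).comp x horizL.hasFDerivAt
  have h2 : HasFDerivAt (fun x : Euc 3 => (Ψ x : ℂ)) (Complex.ofRealCLM.comp (fderiv ℝ Ψ x)) x :=
    Complex.ofRealCLM.hasFDerivAt.comp x (h.1.differentiable (by simp) x).hasFDerivAt
  exact h1.mul h2

theorem periodic_char_horiz_mul (n : Fin 2 → ℤ) {Ψ : Euc 3 → ℝ} (h : SmoothPeriodic Ψ) :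
    Periodic fun x => char n (horiz x) * (Ψ x : ℂ) := fun i x => by
  simp only [(periodic_char n).comp_horiz i x, h.2 i x]

theorem modeInt_partial (n : Fin 2 → ℤ) (i : Fin 2) {Ψ : Euc 3 → ℝ} (h : SmoothPeriodic Ψ) :
    modeInt (fun x => fderiv ℝ Ψ x (EuclideanSpace.single i.castSucc 1)) n =
      -(Complex.I * n i) * modeInt Ψ n := by
  have hc : Continuous fun x => fderiv ℝ Ψ x (EuclideanSpace.single i.castSucc 1) :=
    (h.fderiv_apply contDiff_const (fun _ _ => rfl)).1.continuous
  have hh : horiz (EuclideanSpace.single i.castSucc 1) = EuclideanSpace.single i 1 := by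
    ext j; fin_cases i <;> fin_cases j <;> simp [horiz]
  have h0 := integral_cell_deriv_eq_zero i.castSucc
    (F := fun x => char n (horiz x) * (Ψ x : ℂ))
    (F' := fun x => char n (horiz x) * (fderiv ℝ Ψ x (EuclideanSpace.single i.castSucc 1) : ℝ) +
      (Complex.I * n i) * (char n (horiz x) * (Ψ x : ℂ)))
    (fun x => by
      have := HasFDerivAt.hasDerivAt_single (hasFDerivAt_char_horiz_mul n h x) i.castSucc
      convert this using 1
      simp [hh, phaseL_single]
      ring)
    (by
      have := continuous_char_horiz n
      have := h.1.continuous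
      fun_prop)
    (periodic_char_horiz_mul n h i.castSucc)
  rw [integral_add, integral_const_mul] at h0
  · rw [modeInt, modeInt]; linear_combination h0
  · exact integrableOn_cell ((continuous_char_horiz n).mul (by fun_prop))
  · exact integrableOn_cell (continuous_const.mul ((continuous_char_horiz n).mul
      (Complex.continuous_ofReal.comp h.1.continuous)))

/-- Replacing Ψ by (1 - Δ_H)Ψ multiplies the mode integral by ⟨n⟩², so smoothness yields decay
faster than any power. -/
theorem exists_modeInt_bound (m : ℕ) {Ψ : Euc 3 → ℝ} (h : SmoothPeriodic Ψ) :
    ∃ L : ℝ, 0 ≤ L ∧ ∀ n, ‖modeInt Ψ n‖ ≤ L * (freqWeight n ^ 0 / freqWeight n ^ (2 * m)) := by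
  induction m generalizing Ψ with
  | zero =>
    obtain ⟨M, hM⟩ := (isCompact_cell 3).exists_bound_of_continuousOn h.1.continuous.continuousOn
    refine ⟨max M 0 * (volume : Measure (Euc 3)).real (cell 3), by positivity, fun n => ?_⟩
    have := norm_setIntegral_le_of_norm_le_const (μ := volume) (s := cell 3) (C := max M 0)
      (f := fun x => char n (horiz x) * (Ψ x : ℂ)) (isCompact_cell 3).measure_lt_top
      (fun x hx => by
        rw [norm_mul, norm_char, one_mul, Complex.norm_real]
        exact (hM x hx).trans (le_max_left _ _))
    simpa [modeInt] using this
  | succ m ih =>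
    let p : Fin 2 → (Euc 3 → ℝ) → Euc 3 → ℝ := fun i Ψ x =>
      fderiv ℝ Ψ x (EuclideanSpace.single i.castSucc 1)
    have hp : ∀ i {Ψ : Euc 3 → ℝ}, SmoothPeriodic Ψ → SmoothPeriodic (p i Ψ) := fun i Ψ hΨ =>
      hΨ.fderiv_apply contDiff_const (fun _ _ => rfl)
    have h0 := hp 0 (hp 0 h)
    have h1 := hp 1 (hp 1 h)
    have hL : SmoothPeriodic fun x => Ψ x - p 0 (p 0 Ψ) x - p 1 (p 1 Ψ) x :=
      ⟨(h.1.sub h0.1).sub h1.1, fun i x => by simp only [h.2 i x, h0.2 i x, h1.2 i x]⟩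
    obtain ⟨L, hL0, hLb⟩ := ih hL
    refine ⟨L, hL0, fun n => ?_⟩
    have hint : ∀ {Φ : Euc 3 → ℝ}, SmoothPeriodic Φ →
        IntegrableOn (fun x => char n (horiz x) * (Φ x : ℂ)) (cell 3) := fun hΦ =>
      integrableOn_cell ((continuous_char_horiz n).mul
        (Complex.continuous_ofReal.comp hΦ.1.continuous))
    have e : modeInt (fun x => Ψ x - p 0 (p 0 Ψ) x - p 1 (p 1 Ψ) x) n =
        ((freqWeight n ^ 2 : ℝ) : ℂ) * modeInt Ψ n := by
      have e1 : modeInt (fun x => Ψ x - p 0 (p 0 Ψ) x - p 1 (p 1 Ψ) x) n =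
          modeInt Ψ n - modeInt (p 0 (p 0 Ψ)) n - modeInt (p 1 (p 1 Ψ)) n := by
        simp only [modeInt]
        have hi : IntegrableOn (fun x => char n (horiz x) * (Ψ x : ℂ) -
            char n (horiz x) * (p 0 (p 0 Ψ) x : ℂ)) (cell 3) := (hint h).sub (hint h0)
        rw [← integral_sub (hint h) (hint h0), ← integral_sub hi (hint h1)]
        refine setIntegral_congr_fun (measurableSet_cell 3) fun x _ => ?_
        simp only [Complex.ofReal_sub]
        ring
      rw [e1, modeInt_partial n 0 (hp 0 h), modeInt_partial n 0 h, modeInt_partial n 1 (hp 1 h),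
        modeInt_partial n 1 h, sq_freqWeight_two]
      push_cast
      linear_combination (-(n 0 : ℂ) ^ 2 * modeInt Ψ n - (n 1 : ℂ) ^ 2 * modeInt Ψ n) * Complex.I_sq
    have h2 := hLb n
    have hn := freqWeight_pos n
    rw [e, norm_mul, Complex.norm_real, Real.norm_of_nonneg (sq_nonneg _)] at h2
    have e2 : L * (freqWeight n ^ 0 / freqWeight n ^ (2 * (m + 1))) =
        L * (freqWeight n ^ 0 / freqWeight n ^ (2 * m)) / freqWeight n ^ 2 := by
      rw [mul_add, pow_add]; field_simp
    rw [e2, le_div_iff₀ (by positivity), mul_comm]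
    exact h2

/-- In the index n the operator acts on characters as -v·∇, and integrating along the
divergence-free v moves the derivative to Ψ. -/
theorem opA_modeInt {Ψ : Euc 3 → ℝ} (h : SmoothPeriodic Ψ) :
    opA (modeInt Ψ) = modeInt (advect cellularFlow₃ Ψ) := by
  ext n
  have hadv := h.fderiv_apply contDiff_cellularFlow₃ periodic_cellularFlow₃
  have hint : ∀ m, IntegrableOn (fun x => char m (horiz x) * (Ψ x : ℂ)) (cell 3) := fun m =>
    integrableOn_cell ((continuous_char_horiz m).mul
      (Complex.continuous_ofReal.comp h.1.continuous))
  have hh : ∀ x, horiz (cellularFlow₃ x) = cellularFlow (horiz x) := fun x => by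
    ext j; fin_cases j <;> simp [cellularFlow₃, twoHalf, horiz]
  have e1 : opA (modeInt Ψ) n =
      ∫ x in cell 3, -(char n (horiz x) * phaseL n (cellularFlow (horiz x)) * (Ψ x : ℂ)) := by
    rw [opA_apply]
    simp only [modeInt, ← integral_smul]
    have hi : ∀ e ∈ shifts, Integrable (fun x => cellKer n (n + e) • (char (n + e) (horiz x) * (Ψ x : ℂ)))
        (volume.restrict (cell 3)) := fun e _ => (hint (n + e)).smul (cellKer n (n + e))
    rw [← integral_finsetSum _ hi]
    refine setIntegral_congr_fun (measurableSet_cell 3) fun x _ => ?_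
    have := congrArg (· * (Ψ x : ℂ)) (opA_char n (horiz x))
    simp only [opA_apply, Finset.sum_mul, smul_mul_assoc] at this
    rw [this]; ring
  have hC : ContDiff ℝ 1 fun x => char n (horiz x) * (Ψ x : ℂ) := by
    have hchar : ContDiff ℝ 1 fun x : Euc 3 => char n (horiz x) :=
      (phaseL n).contDiff.cexp.comp contDiff_horiz
    exact hchar.mul (Complex.ofRealCLM.contDiff.comp (h.1.of_le (by simp)))
  have h0 := integral_fderiv_cellularFlow₃ hC (periodic_char_horiz_mul n h)
  have e2 : ∀ x, fderiv ℝ (fun x => char n (horiz x) * (Ψ x : ℂ)) x (cellularFlow₃ x) =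
      char n (horiz x) * (advect cellularFlow₃ Ψ x : ℝ) -
        -(char n (horiz x) * phaseL n (cellularFlow (horiz x)) * (Ψ x : ℂ)) := fun x => by
    rw [(hasFDerivAt_char_horiz_mul n h x).fderiv]
    simp [advect, hh]
    ring
  simp only [e2] at h0
  rw [integral_sub, sub_eq_zero] at h0
  · rw [e1, ← h0, modeInt]
  · exact integrableOn_cell ((continuous_char_horiz n).mul
      (Complex.continuous_ofReal.comp hadv.1.continuous))
  · refine integrableOn_cell ((((continuous_char_horiz n).mul ?_).mul
      (Complex.continuous_ofReal.comp h.1.continuous)).neg)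
    exact (phaseL n).continuous.comp
      ((contDiff_cellularFlow (n := 0)).continuous.comp continuous_horiz)

/-- The weak form of `∂_t g = (v · ∇)² g`, tested on `𝕋³`. -/
theorem hasDerivWithinAt_integral_flow {c₀ : (Fin 2 → ℤ) → ℂ} {k : ℕ} (hk : 2 ≤ k)
    (hc : HSummable k c₀) {Ψ : Euc 3 → ℝ} (h : SmoothPeriodic Ψ) {t : ℝ} (ht : 0 ≤ t) :
    HasDerivWithinAt (fun s => ∫ x in cell 3, synth (flow c₀ s) (horiz x) * Ψ x)
      (∫ x in cell 3, synth (flow c₀ t) (horiz x) *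
        advect cellularFlow₃ (advect cellularFlow₃ Ψ) x) (Ici 0) t := by
  have h1 : SmoothPeriodic (advect cellularFlow₃ Ψ) :=
    h.fderiv_apply contDiff_cellularFlow₃ periodic_cellularFlow₃
  have h2 : SmoothPeriodic (advect cellularFlow₃ (advect cellularFlow₃ Ψ)) :=
    h1.fderiv_apply contDiff_cellularFlow₃ periodic_cellularFlow₃
  -- Decay of order 8 meets the requirement i + 8 ≤ j + k with i = 0 and j = 8, whatever k is.
  obtain ⟨L, hL, hLb⟩ := exists_modeInt_bound 4 h
  have hs : ∀ s, 0 ≤ s → Summable fun n => ‖flow c₀ s n‖ := fun s hs =>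
    (hSummable_flow hc hs).1.summable_norm (by norm_num) hk
  have hd := hasDerivWithinAt_tsum_flow hc hL hLb (by omega) ht
  rw [opA_modeInt h, opA_modeInt h1] at hd
  have hd' := Complex.reCLM.hasFDerivAt.comp_hasDerivWithinAt t hd
  rw [integral_synth_horiz_mul (hs t ht) h2.1.continuous]
  exact hd'.congr (fun s hs' => integral_synth_horiz_mul (hs s hs') h.1.continuous)
    (integral_synth_horiz_mul (hs t ht) h.1.continuous)

end WeakForm

/-! ### Sobolev regularity of fields independent of x₃. -/

section TwoHalf

/-- The coefficients `a`, `b` at the frequencies `(1, 1)`, `(1, -1)`. -/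
def twoModes (a b : ℂ) : (Fin 2 → ℤ) → ℂ :=
  fun n => if n = ![1, 1] then a else if n = ![1, -1] then b else 0

theorem twoModes_eq_zero {a b : ℂ} {n : Fin 2 → ℤ}
    (hn : n ∉ ({![1, 1], ![1, -1]} : Finset (Fin 2 → ℤ))) : twoModes a b n = 0 := by
  simp only [Finset.mem_insert, Finset.mem_singleton, not_or] at hn
  simp [twoModes, hn.1, hn.2]

theorem synth_twoModes (a b : ℂ) (x : Euc 2) :
    synth (twoModes a b) x = (a * char ![1, 1] x + b * char ![1, -1] x).re := by
  rw [synth, csynth, tsum_eq_sum (s := {![1, 1], ![1, -1]}) fun n hn => by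
    rw [twoModes_eq_zero hn, zero_mul]]
  rw [Finset.sum_insert (by decide), Finset.sum_singleton]
  have : (![1, -1] : Fin 2 → ℤ) ≠ ![1, 1] := by decide
  simp [twoModes, this]

theorem memSobolev_twoModes (k : ℕ) (a b : ℂ) : MemSobolev k (synth (twoModes a b)) := by
  refine memSobolev_synth ?_ ?_
  · exact summable_of_ne_finset_zero (s := {![1, 1], ![1, -1]}) fun n hn => by
      rw [twoModes_eq_zero hn]; simp
  · exact summable_of_ne_finset_zero (s := {![1, 1], ![1, -1]}) fun n hn => by
      rw [twoModes_eq_zero hn]; simp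

/-- The components are the real parts of (i/2)(e^{i(x₀+x₁)} + e^{i(x₀-x₁)}) and (i/2)(-e^{i(x₀+x₁)}
+ e^{i(x₀-x₁)}). -/
theorem memSobolev_cellularFlow (k : ℕ) (i : Fin 2) : MemSobolev k fun x => cellularFlow x i := by
  have hp : ∀ x : ℝ, Complex.exp (x * Complex.I) = Complex.cos x + Complex.sin x * Complex.I :=
    fun x => Complex.exp_mul_I _
  have hq : ∀ x : ℝ, (Complex.exp (x * Complex.I))⁻¹ = Complex.cos x - Complex.sin x * Complex.I :=
    fun x => by rw [← Complex.exp_neg, ← neg_mul, Complex.exp_mul_I, Complex.cos_neg,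
      Complex.sin_neg]; ring
  have key : ∀ a b : ℂ, ∀ x : Euc 2, synth (twoModes a b) x =
      (a * ((Complex.cos (x 0) + Complex.sin (x 0) * Complex.I) *
        (Complex.cos (x 1) + Complex.sin (x 1) * Complex.I)) +
       b * ((Complex.cos (x 0) + Complex.sin (x 0) * Complex.I) *
        (Complex.cos (x 1) - Complex.sin (x 1) * Complex.I))).re := fun a b x => by
    rw [synth_twoModes, char_eq_exp_mul_exp, char_eq_exp_mul_exp]
    simp only [Matrix.cons_val_zero, Matrix.cons_val_one, zpow_one, zpow_neg, hq]
    simp only [hp]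
  fin_cases i
  · convert memSobolev_twoModes k (Complex.I / 2) (Complex.I / 2) using 1
    ext x
    rw [key]
    simp only [← Complex.ofReal_cos, ← Complex.ofReal_sin]
    simp [cellularFlow, -Complex.ofReal_cos, -Complex.ofReal_sin]
    ring
  · convert memSobolev_twoModes k (-Complex.I / 2) (Complex.I / 2) using 1
    ext x
    rw [key]
    simp only [← Complex.ofReal_cos, ← Complex.ofReal_sin]
    simp [cellularFlow, -Complex.ofReal_cos, -Complex.ofReal_sin]
    ring

theorem memSobolev_zero {d : ℕ} (k : ℕ) : MemSobolev k (0 : Euc d → ℝ) :=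
  ⟨continuous_const, fun _ _ => rfl, by
    simp [sobolevNorm, sobolevSq, fourierCoeff]⟩

theorem vecMemSobolev_twoHalf {k : ℕ} {w : Euc 2 → Euc 2} {h : Euc 2 → ℝ}
    (hw : ∀ i, MemSobolev k fun x => w x i) (hh : MemSobolev k h) :
    VecMemSobolev k (twoHalf w h) := by
  have hwc : Continuous w := (PiLp.continuous_toLp 2 _).comp (continuous_pi fun i => (hw i).1)
  refine ⟨continuous_twoHalf hwc hh.1,
    Periodic.twoHalf (fun i x => by ext j; exact (hw j).2.1 i x) hh.2.1, ?_⟩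
  rw [vecSobolevNorm_lt_top_iff]
  intro i
  rw [← sobolevSq_lt_top_iff]
  fin_cases i
  · have := sobolevSq_comp_horiz k (hw 0).1
    exact this.trans_lt (sobolevSq_lt_top_iff.2 (hw 0).hSummable)
  · have := sobolevSq_comp_horiz k (hw 1).1
    exact this.trans_lt (sobolevSq_lt_top_iff.2 (hw 1).hSummable)
  · exact (sobolevSq_comp_horiz k hh.1).trans_lt (sobolevSq_lt_top_iff.2 hh.hSummable)

theorem sobolevNorm_le_twoHalf {k : ℕ} {w : Euc 2 → Euc 2} (hw : Continuous w) (h : Euc 2 → ℝ)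
    (i : Fin 2) : sobolevNorm k (fun x => w x i) ≤ vecSobolevNorm k (twoHalf w h) := by
  have hc : Continuous fun x => w x i := by fun_prop
  have h1 := sobolevNorm_le_vecSobolevNorm (k := k) (twoHalf w h) i.castSucc
  rw [sobolevNorm, ← sobolevSq_comp_horiz k hc]
  convert h1 using 3
  fin_cases i <;> rfl

theorem sobolevNorm_le_twoHalf_two {k : ℕ} (w : Euc 2 → Euc 2) {h : Euc 2 → ℝ}
    (hh : Continuous h) : sobolevNorm k h ≤ vecSobolevNorm k (twoHalf w h) := by
  have h1 := sobolevNorm_le_vecSobolevNorm (k := k) (twoHalf w h) 2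
  rw [sobolevNorm, ← sobolevSq_comp_horiz k hh]
  exact h1

theorem vecSobolevNorm_twoHalf_zero {k : ℕ} {h : Euc 2 → ℝ} (hh : Continuous h) :
    vecSobolevNorm k (twoHalf 0 h) = sobolevNorm k h := by
  have h0 : sobolevSq k (fun _ : Euc 3 => (0 : ℝ)) = 0 := by simp [sobolevSq, fourierCoeff]
  rw [vecSobolevNorm, Fin.sum_univ_three, sobolevNorm, ← sobolevSq_comp_horiz k hh]
  have e : ∀ x, twoHalf 0 h x 0 = 0 ∧ twoHalf 0 h x 1 = 0 ∧ twoHalf 0 h x 2 = h (horiz x) :=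
    fun x => ⟨rfl, rfl, rfl⟩
  simp only [e, h0, zero_add]

theorem twoHalf_sub (w : Euc 2 → Euc 2) (h h' : Euc 2 → ℝ) :
    twoHalf w h - twoHalf w h' = twoHalf 0 (h - h') := by
  ext x j
  fin_cases j <;> simp [twoHalf]

end TwoHalf

/-! ### Sobolev continuity in time of g and of v·∇g. -/

section FlowRegularity

variable {c₀ : (Fin 2 → ℤ) → ℂ} {k : ℕ} {t : ℝ}

theorem memSobolev_synth_flow (hk : 2 ≤ k) (h : HSummable k c₀) (ht : 0 ≤ t) :
    MemSobolev k (synth (flow c₀ t)) :=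
  memSobolev_synth (hSummable_flow h ht).1 ((hSummable_flow h ht).1.summable_norm (by norm_num) hk)

theorem memSobolev_synth_opA_flow (hk : 3 ≤ k) (h : HSummable k c₀) (ht : 0 ≤ t) :
    MemSobolev (k - 1) (synth (opA (flow c₀ t))) := by
  obtain ⟨j, rfl⟩ : ∃ j, k = j + 1 := ⟨k - 1, by omega⟩
  have h1 := (hSummable_opA (hSummable_flow h ht).1).1
  exact memSobolev_synth h1 (h1.summable_norm (by norm_num) (by omega))

theorem tendsto_ofReal_sqrt {α : Type*} {l : Filter α} {f : α → ℝ} (hf : Tendsto f l (𝓝 0)) :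
    Tendsto (fun s => ENNReal.ofReal √(f s)) l (𝓝 0) := by
  have := ENNReal.tendsto_ofReal ((Real.continuous_sqrt.tendsto 0).comp hf)
  simpa using this

theorem tendsto_sobolevNorm_flow (hk : 2 ≤ k) (h : HSummable k c₀) (ht : 0 ≤ t) :
    Tendsto (fun s => sobolevNorm k (synth (flow c₀ s) - synth (flow c₀ t))) (𝓝[Ici 0] t) (𝓝 0) := by
  refine tendsto_of_tendsto_of_tendsto_of_le_of_le' tendsto_const_nhds
    (tendsto_ofReal_sqrt (tendsto_hsq_flow h ht)) (Eventually.of_forall fun _ => zero_le) ?_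
  filter_upwards [self_mem_nhdsWithin] with s hs
  have hs1 := (hSummable_flow h hs).1
  have ht1 := (hSummable_flow h ht).1
  have hd := hs1.sub ht1
  rw [← synth_sub (hs1.summable_norm (by norm_num) hk) (ht1.summable_norm (by norm_num) hk)]
  exact sobolevNorm_synth_le hd (hd.summable_norm (by norm_num) hk)

theorem tendsto_sobolevNorm_opA_flow (hk : 3 ≤ k) (h : HSummable k c₀) (ht : 0 ≤ t) :
    Tendsto (fun s => sobolevNorm (k - 1) (synth (opA (flow c₀ s)) - synth (opA (flow c₀ t))))
      (𝓝[Ici 0] t) (𝓝 0) := by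
  obtain ⟨j, rfl⟩ : ∃ j, k = j + 1 := ⟨k - 1, by omega⟩
  have hj : 2 ≤ j := by omega
  have h0 : Tendsto (fun s => 16 * 9 ^ (j + 1) * hsq (j + 1) (flow c₀ s - flow c₀ t))
      (𝓝[Ici 0] t) (𝓝 0) := by
    simpa using (tendsto_hsq_flow h ht).const_mul (16 * 9 ^ (j + 1))
  refine tendsto_of_tendsto_of_tendsto_of_le_of_le' tendsto_const_nhds
    (tendsto_ofReal_sqrt h0) (Eventually.of_forall fun _ => zero_le) ?_
  filter_upwards [self_mem_nhdsWithin] with s hs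
  have hs1 := (hSummable_flow h hs).1
  have ht1 := (hSummable_flow h ht).1
  have hd := hSummable_opA (hs1.sub ht1)
  rw [← synth_sub ((hSummable_opA hs1).1.summable_norm (by norm_num) hj)
    ((hSummable_opA ht1).1.summable_norm (by norm_num) hj), ← opA_sub]
  exact (sobolevNorm_synth_le hd.1 (hd.1.summable_norm (by norm_num) hj)).trans
    (ENNReal.ofReal_le_ofReal (Real.sqrt_le_sqrt hd.2))

end FlowRegularity

/-! ### Divergence-free conditions and zero mean for the ansatz. -/

section WeakForms

/-- Vertical derivatives of periodic functions have zero mean against horizontal functions. -/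
theorem integral_horiz_mul_fderiv_vertical {h : Euc 2 → ℝ} (hh : Continuous h) {f : Euc 3 → ℝ}
    (hf : ContDiff ℝ 1 f) (hper : Periodic f) :
    ∫ x in cell 3, h (horiz x) * fderiv ℝ f x (EuclideanSpace.single 2 1) = 0 := by
  refine integral_cell_deriv_eq_zero (d := 3) 2 (F := fun x => h (horiz x) * f x) (fun x => ?_) ?_
    fun x => ?_
  · simp only [horiz_add_single_two]
    exact (HasFDerivAt.hasDerivAt_single (hf.differentiable one_ne_zero x).hasFDerivAt 2).const_mul _
  · exact (hh.comp continuous_horiz).mul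
      ((hf.continuous_fderiv one_ne_zero).clm_apply continuous_const)
  · simp only [horiz_add_single_two, hper 2 x]

theorem twoHalf_eq (w : Euc 2 → Euc 2) (h : Euc 2 → ℝ) (x : Euc 3) :
    twoHalf w h x = twoHalf w 0 x + h (horiz x) • EuclideanSpace.single 2 1 := by
  ext j; fin_cases j <;> simp [twoHalf]

theorem twoHalf_zero_eq (h : Euc 2 → ℝ) (x : Euc 3) :
    twoHalf 0 h x = h (horiz x) • EuclideanSpace.single 2 1 := by
  ext j; fin_cases j <;> simp [twoHalf]

theorem divFree_twoHalf_zero {h : Euc 2 → ℝ} (hh : Continuous h) : DivFree (twoHalf 0 h) := by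
  intro φ hφ hper
  simp only [twoHalf_zero_eq, map_smul, smul_eq_mul]
  exact integral_horiz_mul_fderiv_vertical hh (hφ.of_le (by simp)) hper

theorem divFree_twoHalf_cellularFlow {h : Euc 2 → ℝ} (hh : Continuous h) :
    DivFree (twoHalf cellularFlow h) := by
  intro φ hφ hper
  have hφ1 : ContDiff ℝ 1 φ := hφ.of_le (by simp)
  have hc := hφ1.continuous_fderiv one_ne_zero
  simp only [twoHalf_eq cellularFlow h, map_add, map_smul, smul_eq_mul]
  rw [integral_add, integral_horiz_mul_fderiv_vertical hh hφ1 hper, add_zero]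
  · exact integral_fderiv_cellularFlow₃ hφ1 hper
  · exact integrableOn_cell (hc.clm_apply (contDiff_cellularFlow₃ (n := 0)).continuous)
  · exact integrableOn_cell ((hh.comp continuous_horiz).mul (hc.clm_apply continuous_const))

theorem horiz_cellularFlow₃ (x : Euc 3) : horiz (cellularFlow₃ x) = cellularFlow (horiz x) := by
  ext j; fin_cases j <;> simp [cellularFlow₃, twoHalf, horiz]

theorem hasFDerivAt_comp_horiz {E : Type*} [NormedAddCommGroup E] [NormedSpace ℝ E] {g : Euc 2 → E}
    (hg : ContDiff ℝ 1 g) (x : Euc 3) :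
    HasFDerivAt (fun x => g (horiz x)) ((fderiv ℝ g (horiz x)).comp horizL) x :=
  HasFDerivAt.comp (g := g) x (hg.differentiable one_ne_zero (horizL x)).hasFDerivAt
    horizL.hasFDerivAt

theorem advect_comp_horiz {g : Euc 2 → ℝ} (hg : ContDiff ℝ 1 g) :
    advect cellularFlow₃ (fun x => g (horiz x)) = fun x => advect cellularFlow g (horiz x) := by
  ext x
  rw [advect, (hasFDerivAt_comp_horiz hg x).fderiv, advect, ← horiz_cellularFlow₃]
  rfl

theorem integral_twoHalf_advect {g : Euc 2 → ℝ} (hg : ContDiff ℝ 1 g) (hper : Periodic g) :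
    ∫ x in cell 3, twoHalf 0 (advect cellularFlow g) x = 0 := by
  have h0 := integral_fderiv_cellularFlow₃ (f := fun x => g (horiz x)) (hg.comp contDiff_horiz)
    hper.comp_horiz
  have h1 := congrFun (advect_comp_horiz hg)
  simp only [advect] at h1
  simp only [twoHalf_zero_eq]
  rw [integral_smul_const]
  simp only [advect, ← h1, h0, zero_smul]

end WeakForms

/-! ### Componentwise calculus in Euclidean space. -/

section Components

variable {d m : ℕ}

theorem norm_le_sum_abs (y : Euc m) : ‖y‖ ≤ ∑ i, |y i| := by
  have h : y = ∑ i, EuclideanSpace.single i (y i) := by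
    ext j; simp [Finset.sum_apply]
  calc ‖y‖ = ‖∑ i, EuclideanSpace.single i (y i)‖ := by rw [← h]
    _ ≤ ∑ i, ‖EuclideanSpace.single i (y i)‖ := norm_sum_le _ _
    _ = ∑ i, |y i| := by simp

theorem hasFDerivAt_apply {f : Euc d → Euc m} {x : Euc d} {f' : Euc d →L[ℝ] Euc m}
    (hf : HasFDerivAt f f' x) (i : Fin m) :
    HasFDerivAt (fun x => f x i) ((EuclideanSpace.proj i : Euc m →L[ℝ] ℝ).comp f') x :=
  (EuclideanSpace.proj i : Euc m →L[ℝ] ℝ).hasFDerivAt.comp x hf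

theorem fderiv_apply_apply {f : Euc d → Euc m} {x : Euc d} (hf : DifferentiableAt ℝ f x) (y : Euc d)
    (i : Fin m) : fderiv ℝ f x y i = fderiv ℝ (fun x => f x i) x y := by
  rw [(hasFDerivAt_apply hf.hasFDerivAt i).fderiv]; rfl

theorem norm_fderiv_le_sum {f : Euc d → Euc m} {x : Euc d} (hf : DifferentiableAt ℝ f x) :
    ‖fderiv ℝ f x‖ ≤ ∑ i, ‖fderiv ℝ (fun x => f x i) x‖ := by
  refine ContinuousLinearMap.opNorm_le_bound _ (Finset.sum_nonneg fun _ _ => norm_nonneg _) fun y => ?_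
  refine (norm_le_sum_abs _).trans ?_
  rw [Finset.sum_mul]
  refine Finset.sum_le_sum fun i _ => ?_
  rw [fderiv_apply_apply hf]
  exact (fderiv ℝ (fun x => f x i) x).le_opNorm y

theorem gradient_apply {p : Euc d → ℝ} (x : Euc d) (i : Fin d) :
    gradient p x i = fderiv ℝ p x (EuclideanSpace.single i 1) := by
  rw [← inner_gradient_left, EuclideanSpace.inner_single_right]
  simp

theorem norm_gradient (p : Euc d → ℝ) (x : Euc d) : ‖gradient p x‖ = ‖fderiv ℝ p x‖ := by
  rw [gradient, LinearIsometryEquiv.norm_map]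

theorem inner_three (a b : Euc 3) : inner ℝ a b = a 0 * b 0 + a 1 * b 1 + a 2 * b 2 := by
  rw [PiLp.inner_apply, Fin.sum_univ_three]
  simp only [RCLike.inner_apply, conj_trivial]
  ring

end Components

/-! ### The magnetic nonlinearity on the ansatz. -/

section Evolution

/-- The integral of the magnetic nonlinearity of a field `(v, h)` against a test field. -/
theorem integral_twoHalf_evolution {h : Euc 2 → ℝ} (hh : ContDiff ℝ 1 h) (hper : Periodic h)
    (hac : Continuous (advect cellularFlow h)) {Φ : Euc 3 → Euc 3} (hΦ : ContDiff ℝ ∞ Φ)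
    (hΦp : Periodic Φ) :
    ∫ x in cell 3, (inner ℝ (twoHalf cellularFlow h x)
          (fderiv ℝ Φ x (twoHalf 0 (advect cellularFlow h) x)) -
        inner ℝ (twoHalf 0 (advect cellularFlow h) x) (fderiv ℝ Φ x (twoHalf cellularFlow h x))) =
      ∫ x in cell 3, h (horiz x) *
        advect cellularFlow₃ (advect cellularFlow₃ fun x => Φ x 2) x := by
  set a := advect cellularFlow h with ha
  have hΦi : ∀ i, SmoothPeriodic fun x => Φ x i := fun i =>
    ⟨contDiff_euclidean.1 hΦ i, fun j x => by simp only [hΦp j x]⟩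
  have hΦ1 : ∀ i, ContDiff ℝ 1 fun x => Φ x i := fun i => (hΦi i).1.of_le (by simp)
  have hD : ∀ i x y, fderiv ℝ Φ x y i = fderiv ℝ (fun x => Φ x i) x y := fun i x y =>
    fderiv_apply_apply (hΦ.differentiable (by simp) x) y i
  have hv : ∀ i, Continuous fun x => cellularFlow x i := fun i =>
    (memSobolev_cellularFlow 0 i).1
  -- The horizontal components of Φ enter only through x₃-derivatives multiplied by functions of the
  -- horizontal variables, and these integrate to zero.
  have h0 := integral_horiz_mul_fderiv_vertical (h := fun y => a y * cellularFlow y 0)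
    (hac.mul (hv 0)) (hΦ1 0) (hΦi 0).2
  have h1 := integral_horiz_mul_fderiv_vertical (h := fun y => a y * cellularFlow y 1)
    (hac.mul (hv 1)) (hΦ1 1) (hΦi 1).2
  set P := advect cellularFlow₃ fun x => Φ x 2 with hP
  have hPs : SmoothPeriodic P := (hΦi 2).fderiv_apply contDiff_cellularFlow₃ periodic_cellularFlow₃
  have hQs : SmoothPeriodic (advect cellularFlow₃ P) :=
    hPs.fderiv_apply contDiff_cellularFlow₃ periodic_cellularFlow₃
  have hhh : ContDiff ℝ 1 fun x => h (horiz x) := hh.comp contDiff_horiz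
  have hP1 : ContDiff ℝ 1 P := hPs.1.of_le (by simp)
  -- The zero mean of v·∇(hP) transfers v·∇ from h to P.
  have h2 := integral_fderiv_cellularFlow₃ (f := fun x => h (horiz x) * P x)
    (hhh.mul hP1) (fun i x => by simp only [hper.comp_horiz i x, hPs.2 i x])
  have hadv := congrFun (advect_comp_horiz hh)
  have e : ∀ x, fderiv ℝ (fun x => h (horiz x) * P x) x (cellularFlow₃ x) =
      h (horiz x) * advect cellularFlow₃ P x + a (horiz x) * P x := fun x => by
    rw [fderiv_fun_mul (hhh.differentiable one_ne_zero x) (hP1.differentiable one_ne_zero x)]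
    have := hadv x
    simp only [advect] at this ⊢
    simp only [add_apply, smul_apply, smul_eq_mul, this, ha,
      advect]
    ring
  simp only [e] at h2
  have hcont : ∀ i, Continuous fun x =>
      fderiv ℝ (fun x => Φ x i) x (EuclideanSpace.single 2 1) := fun i =>
    ((hΦ1 i).continuous_fderiv one_ne_zero).clm_apply continuous_const
  have hah : Continuous fun x => a (horiz x) := hac.comp continuous_horiz
  have hvh : ∀ i, Continuous fun x => cellularFlow (horiz x) i := fun i =>
    (hv i).comp continuous_horiz
  have i0 : IntegrableOn (fun x => a (horiz x) * cellularFlow (horiz x) 0 *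
      fderiv ℝ (fun x => Φ x 0) x (EuclideanSpace.single 2 1)) (cell 3) :=
    integrableOn_cell ((hah.mul (hvh 0)).mul (hcont 0))
  have i1 : IntegrableOn (fun x => a (horiz x) * cellularFlow (horiz x) 1 *
      fderiv ℝ (fun x => Φ x 1) x (EuclideanSpace.single 2 1)) (cell 3) :=
    integrableOn_cell ((hah.mul (hvh 1)).mul (hcont 1))
  have iQ : IntegrableOn (fun x => h (horiz x) * advect cellularFlow₃ P x) (cell 3) :=
    integrableOn_cell (hhh.continuous.mul hQs.1.continuous)
  have iP : IntegrableOn (fun x => a (horiz x) * P x) (cell 3) :=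
    integrableOn_cell (hah.mul hPs.1.continuous)
  rw [integral_add iQ iP] at h2
  rw [eq_neg_of_add_eq_zero_left h2, ← integral_neg]
  -- The two terms h a ∂₃Φ₃, one from each inner product, cancel here.
  have key : ∀ x, (inner ℝ (twoHalf cellularFlow h x) (fderiv ℝ Φ x (twoHalf 0 a x)) -
        inner ℝ (twoHalf 0 a x) (fderiv ℝ Φ x (twoHalf cellularFlow h x)) : ℝ) =
      a (horiz x) * cellularFlow (horiz x) 0 *
          fderiv ℝ (fun x => Φ x 0) x (EuclideanSpace.single 2 1) +
        a (horiz x) * cellularFlow (horiz x) 1 *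
          fderiv ℝ (fun x => Φ x 1) x (EuclideanSpace.single 2 1) + -(a (horiz x) * P x) := fun x => by
    rw [twoHalf_zero_eq, inner_three, real_inner_smul_left, EuclideanSpace.inner_single_left,
      map_smul]
    simp only [PiLp.smul_apply, hD, smul_eq_mul, map_one, one_mul]
    have : fderiv ℝ (fun x => Φ x 2) x (twoHalf cellularFlow h x) =
        P x + h (horiz x) * fderiv ℝ (fun x => Φ x 2) x (EuclideanSpace.single 2 1) := by
      rw [twoHalf_eq cellularFlow h x, map_add, map_smul, smul_eq_mul]; rfl
    rw [this]
    simp only [twoHalf, PiLp.toLp_apply, Matrix.cons_val_zero, Matrix.cons_val_one, Matrix.cons_val]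
    ring
  simp only [key]
  have iPn : IntegrableOn (fun x => -(a (horiz x) * P x)) (cell 3) := iP.neg
  have i01 : IntegrableOn (fun x => a (horiz x) * cellularFlow (horiz x) 0 *
        fderiv ℝ (fun x => Φ x 0) x (EuclideanSpace.single 2 1) +
      a (horiz x) * cellularFlow (horiz x) 1 *
        fderiv ℝ (fun x => Φ x 1) x (EuclideanSpace.single 2 1)) (cell 3) := i0.add i1
  rw [integral_add i01 iPn, integral_add i0 i1, h0, h1, add_zero, zero_add]

end Evolution

/-! ### Exact growth of the gradient at the stagnation point. -/

section Gradient

/-- The derivative at the origin in direction y, before taking real parts, is a continuous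
functional on H³; this is what the density argument below needs. -/
theorem tsum_phaseL_le {c : (Fin 2 → ℤ) → ℂ} (hc : HSummable 3 c) (y : Euc 2) :
    Summable (fun n => c n * phaseL n y) ∧
      ‖∑' n, c n * phaseL n y‖ ≤ embConst 2 * √(hsq 3 c) * ‖y‖ := by
  obtain ⟨hs, hle⟩ := hc.summable_and_tsum_le (j := 1) (by norm_num)
  have hb : ∀ n, ‖c n * phaseL n y‖ ≤ freqWeight n ^ 1 * ‖c n‖ * ‖y‖ := fun n => by
    rw [norm_mul, pow_one]
    calc ‖c n‖ * ‖phaseL n y‖ ≤ ‖c n‖ * (freqWeight n * ‖y‖) := by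
          gcongr
          exact ((phaseL n).le_opNorm y).trans (by gcongr; exact norm_phaseL_le n)
      _ = _ := by ring
  have hs' := Summable.of_nonneg_of_le (fun _ => norm_nonneg _) hb (hs.mul_right ‖y‖)
  refine ⟨hs'.of_norm, (norm_tsum_le_tsum_norm hs').trans ?_⟩
  refine (hs'.tsum_le_tsum hb (hs.mul_right _)).trans ?_
  rw [tsum_mul_right]
  gcongr

/-- Fourier form of Dv(0) = diag(-1, 1): up to the sign from skewness, the derivative of Af at 0 in
direction y is that of f in direction Dv(0)y. The reflection is an involution, so A² fixes the
functional. -/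
theorem opA_phaseL (y : Euc 2) :
    opA (fun n => phaseL n y) = fun n => phaseL n (!₂[y 0, -y 1] : Euc 2) := by
  ext n
  rw [opA_apply, Finset.sum_congr rfl fun e he => by rw [cellKer_add he]]
  rw [shifts, Finset.sum_insert (by decide), Finset.sum_insert (by decide),
    Finset.sum_insert (by decide), Finset.sum_singleton]
  simp only [phaseL_apply, Fin.sum_univ_two, Complex.real_smul, Pi.add_apply, Matrix.cons_val_zero,
    Matrix.cons_val_one]
  push_cast
  ring

/-- The functional is fixed by A², so its value along the flow solves y' = y. It has order i = 1
with j = 0, hence the regularity 9 = 1 + 8 required to differentiate it in time. -/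
theorem tsum_flow_phaseL_of_regular {c₀ : (Fin 2 → ℤ) → ℂ} (h : HSummable 9 c₀) (y : Euc 2)
    {t : ℝ} (ht : 0 ≤ t) :
    ∑' n, flow c₀ t n * phaseL n y = Real.exp t * ∑' n, c₀ n * phaseL n y := by
  have hl : ∀ n : Fin 2 → ℤ, ‖phaseL n y‖ ≤ ‖y‖ * (freqWeight n ^ 1 / freqWeight n ^ 0) := fun n => by
    rw [pow_one, pow_zero, div_one, mul_comm]
    exact ((phaseL n).le_opNorm y).trans (by gcongr; exact norm_phaseL_le n)
  have hyy : (!₂[(!₂[y 0, -y 1] : Euc 2) 0, -(!₂[y 0, -y 1] : Euc 2) 1] : Euc 2) = y := by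
    ext j; fin_cases j <;> simp
  have hd : ∀ s, 0 ≤ s → HasDerivWithinAt (fun s => ∑' n, flow c₀ s n * phaseL n y)
      (∑' n, flow c₀ s n * phaseL n y) (Ici 0) s := fun s hs => by
    have := hasDerivWithinAt_tsum_flow h (norm_nonneg y) hl (by norm_num) hs
    rwa [opA_phaseL, opA_phaseL, hyy] at this
  have he : ∀ s, 0 ≤ s → HasDerivWithinAt
      (fun s => (Real.exp (-s) : ℂ) * ∑' n, flow c₀ s n * phaseL n y) 0 (Ici 0) s := fun s hs => by
    have h1 : HasDerivAt (fun s : ℝ => (Real.exp (-s) : ℂ)) (-(Real.exp (-s) : ℂ)) s := by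
      have := ((hasDerivAt_neg s).exp).ofReal_comp
      simpa using this
    refine (h1.hasDerivWithinAt.fun_mul (hd s hs)).congr_deriv ?_
    ring
  have hc := constant_of_has_deriv_right_zero (a := 0) (b := t)
    (f := fun s => (Real.exp (-s) : ℂ) * ∑' n, flow c₀ s n * phaseL n y)
    (fun s hs => (he s hs.1).continuousWithinAt.mono Icc_subset_Ici_self)
    (fun s hs => (he s hs.1).mono (Ici_subset_Ici.2 hs.1)) t ⟨ht, le_rfl⟩
  simp only [neg_zero, Real.exp_zero, Complex.ofReal_one, one_mul, flow_zero h] at hc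
  rw [← hc, ← mul_assoc, ← Complex.ofReal_mul, ← Real.exp_add]
  simp

/-- Both sides are continuous in the datum for the H³ norm, and finitely supported data are dense.
-/
theorem tsum_flow_phaseL {c₀ : (Fin 2 → ℤ) → ℂ} (h : HSummable 3 c₀) (y : Euc 2)
    {t : ℝ} (ht : 0 ≤ t) :
    ∑' n, flow c₀ t n * phaseL n y = Real.exp t * ∑' n, c₀ n * phaseL n y := by
  set L : ((Fin 2 → ℤ) → ℂ) → ℂ := fun c => ∑' n, c n * phaseL n y with hL
  have hsub : ∀ {a b}, HSummable 3 a → HSummable 3 b → L (a - b) = L a - L b := fun ha hb => by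
    simp only [hL]
    rw [← (tsum_phaseL_le ha y).1.tsum_sub (tsum_phaseL_le hb y).1]
    exact tsum_congr fun n => by rw [Pi.sub_apply]; ring
  set R : ℝ := √(Real.exp (growthRate 3 * t)) with hR
  have hb : ∀ F, ‖L (flow c₀ t) - Real.exp t * L c₀‖ ≤
      (embConst 2 * R * ‖y‖ + Real.exp t * embConst 2 * ‖y‖) * √(hsq 3 (c₀ - cutoff F c₀)) := by
    intro F
    have hF := hSummable_cutoff F c₀ 3
    have hd := h.sub hF
    have e1 : L (flow c₀ t) - Real.exp t * L c₀ =
        L (flow (c₀ - cutoff F c₀) t) - Real.exp t * L (c₀ - cutoff F c₀) := by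
      have := tsum_flow_phaseL_of_regular (hSummable_cutoff F c₀ 9) y ht
      rw [flow_sub h hF ht, hsub (hSummable_flow h ht).1 (hSummable_flow hF ht).1, hsub h hF]
      simp only [hL, this]
      ring
    have b1 := (tsum_phaseL_le (hSummable_flow hd ht).1 y).2
    have b2 := (tsum_phaseL_le hd y).2
    have b3 : √(hsq 3 (flow (c₀ - cutoff F c₀) t)) ≤ √(hsq 3 (c₀ - cutoff F c₀)) * R := by
      rw [hR, ← Real.sqrt_mul (hsq_nonneg _ _)]
      exact Real.sqrt_le_sqrt (hSummable_flow hd ht).2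
    have := embConst_nonneg 2
    rw [e1]
    calc _ ≤ ‖L (flow (c₀ - cutoff F c₀) t)‖ + ‖(Real.exp t : ℂ) * L (c₀ - cutoff F c₀)‖ :=
          norm_sub_le _ _
      _ ≤ embConst 2 * (√(hsq 3 (c₀ - cutoff F c₀)) * R) * ‖y‖ +
          Real.exp t * (embConst 2 * √(hsq 3 (c₀ - cutoff F c₀)) * ‖y‖) := by
          rw [norm_mul, Complex.norm_real, Real.norm_of_nonneg (Real.exp_pos t).le]
          gcongr
          exact b1.trans (by gcongr)
      _ = _ := by ring
  have hlim : Tendsto (fun F => (embConst 2 * R * ‖y‖ + Real.exp t * embConst 2 * ‖y‖) *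
      √(hsq 3 (c₀ - cutoff F c₀))) atTop (𝓝 0) := by
    have := ((Real.continuous_sqrt.tendsto 0).comp (tendsto_hsq_sub_cutoff h)).const_mul
      (embConst 2 * R * ‖y‖ + Real.exp t * embConst 2 * ‖y‖)
    simpa using this
  exact sub_eq_zero.1 (norm_le_zero_iff.1 (ge_of_tendsto' hlim hb))

/-- At the hyperbolic stagnation point the gradient grows exactly like `e^t`. -/
theorem fderiv_synth_flow_zero {c₀ : (Fin 2 → ℤ) → ℂ} (h : HSummable 3 c₀) {t : ℝ} (ht : 0 ≤ t) :
    fderiv ℝ (synth (flow c₀ t)) 0 = Real.exp t • fderiv ℝ (synth c₀) 0 := by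
  have hchar : ∀ n : Fin 2 → ℤ, char n 0 = 1 := fun n => by simp [char]
  ext y
  rw [smul_apply,
    fderiv_synth_apply ((hSummable_flow h ht).1.summable_weight (by norm_num) le_rfl),
    fderiv_synth_apply (h.summable_weight (by norm_num) le_rfl)]
  simp only [hchar, mul_one]
  rw [tsum_flow_phaseL h y ht, Complex.re_ofReal_mul, smul_eq_mul]

end Gradient

/-! ### Pointwise values against the essential supremum. -/

section SupNorm

/-- By continuity, a value at 0 above the essential supremum would persist on a neighbourhood of 0,
which has positive measure inside the cell. -/
theorem enorm_zero_le_eLpNorm_top {d : ℕ} {E : Type*} [NormedAddCommGroup E] {f : Euc d → E}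
    (hf : Continuous f) : ‖f 0‖ₑ ≤ eLpNorm f ⊤ (volume.restrict (cell d)) := by
  rw [eLpNorm_exponent_top]
  by_contra! hlt
  have hopen : IsOpen {x | eLpNormEssSup f (volume.restrict (cell d)) < ‖f x‖ₑ} :=
    isOpen_lt continuous_const hf.enorm
  have hsub : Metric.ball (0 : Euc d) 1 ⊆ cell d := fun x hx i => by
    have h1 : |x i| ≤ 1 := (PiLp.norm_apply_le x i).trans (mem_ball_zero_iff.1 hx).le
    have := Real.pi_gt_three
    exact abs_le.1 (h1.trans (by linarith))
  have hpos : 0 < volume ({x | eLpNormEssSup f (volume.restrict (cell d)) < ‖f x‖ₑ} ∩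
      Metric.ball (0 : Euc d) 1) :=
    (hopen.inter Metric.isOpen_ball).measure_pos _ ⟨0, hlt, by simp⟩
  have hae := ae_le_eLpNormEssSup (f := f) (μ := volume.restrict (cell d))
  rw [ae_iff] at hae
  simp only [not_le] at hae
  rw [Measure.restrict_apply hopen.measurableSet] at hae
  exact hpos.ne' (measure_mono_null (inter_subset_inter_right _ hsub) hae)

theorem norm_fderiv_le_twoHalf {w : Euc 2 → Euc 2} {h : Euc 2 → ℝ} (hw : ContDiff ℝ 1 w)
    (hh : ContDiff ℝ 1 h) (x : Euc 3) :
    ‖fderiv ℝ h (horiz x)‖ ≤ ‖fderiv ℝ (twoHalf w h) x‖ := by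
  have hd := (contDiff_twoHalf hw hh).differentiable one_ne_zero x
  refine ContinuousLinearMap.opNorm_le_bound _ (norm_nonneg _) fun y => ?_
  set Y : Euc 3 := !₂[y 0, y 1, 0]
  have hY : ‖Y‖ = ‖y‖ := by
    simp [EuclideanSpace.norm_eq, Fin.sum_univ_three, Fin.sum_univ_two, Y]
  have hYy : horizL Y = y := by
    ext j; fin_cases j <;> simp [horizL_apply, horiz, Y]
  have e : fderiv ℝ (twoHalf w h) x Y 2 = fderiv ℝ h (horiz x) y := by
    rw [fderiv_apply_apply hd]
    have := (hasFDerivAt_comp_horiz hh x).fderiv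
    change fderiv ℝ (fun x => h (horiz x)) x Y = _
    rw [this, ContinuousLinearMap.comp_apply, hYy]
  rw [← e, ← hY]
  exact (PiLp.norm_apply_le _ 2).trans (ContinuousLinearMap.le_opNorm _ _)

end SupNorm

/-! ### Pressure and the constitutive law. -/

section Constitutive

theorem fderiv_twoHalf_apply {w : Euc 2 → Euc 2} {h : Euc 2 → ℝ} (hw : ContDiff ℝ 1 w)
    (hh : ContDiff ℝ 1 h) (x y : Euc 3) :
    fderiv ℝ (twoHalf w h) x y = !₂[fderiv ℝ w (horiz x) (horiz y) 0,
      fderiv ℝ w (horiz x) (horiz y) 1, fderiv ℝ h (horiz x) (horiz y)] := by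
  have hd := (contDiff_twoHalf hw hh).differentiable one_ne_zero x
  ext i
  rw [fderiv_apply_apply hd]
  have hwi : ∀ j, fderiv ℝ (fun x : Euc 3 => w (horiz x) j) x y =
      fderiv ℝ w (horiz x) (horiz y) j := fun j => by
    have := hasFDerivAt_apply (hasFDerivAt_comp_horiz hw x) j
    rw [this.fderiv]; rfl
  fin_cases i
  · exact hwi 0
  · exact hwi 1
  · change fderiv ℝ (fun x => h (horiz x)) x y = _
    rw [(hasFDerivAt_comp_horiz hh x).fderiv]; rfl

theorem hasFDerivAt_coord {d : ℕ} (i : Fin d) (x : Euc d) :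
    HasFDerivAt (fun x : Euc d => x i) (EuclideanSpace.proj i : Euc d →L[ℝ] ℝ) x :=
  (EuclideanSpace.proj i : Euc d →L[ℝ] ℝ).hasFDerivAt

/-- The convective acceleration of the cellular flow is a gradient. -/
theorem fderiv_cellularFlow_self (x : Euc 2) :
    fderiv ℝ cellularFlow x (cellularFlow x) 0 = Real.sin (x 0) * Real.cos (x 0) ∧
      fderiv ℝ cellularFlow x (cellularFlow x) 1 = Real.sin (x 1) * Real.cos (x 1) := by
  have hd : DifferentiableAt ℝ cellularFlow x :=
    (contDiff_cellularFlow (n := 1)).differentiable one_ne_zero x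
  have h0 := hasFDerivAt_coord (0 : Fin 2) x
  have h1 := hasFDerivAt_coord (1 : Fin 2) x
  have s0 := Real.sin_sq_add_cos_sq (x 0)
  have s1 := Real.sin_sq_add_cos_sq (x 1)
  constructor
  · rw [fderiv_apply_apply hd]
    change fderiv ℝ (fun x : Euc 2 => -(Real.sin (x 0) * Real.cos (x 1))) x _ = _
    rw [(h0.sin.fun_mul h1.cos).fun_neg.fderiv]
    simp [cellularFlow]
    linear_combination (Real.sin (x 0) * Real.cos (x 0)) * s1
  · rw [fderiv_apply_apply hd]
    change fderiv ℝ (fun x : Euc 2 => Real.cos (x 0) * Real.sin (x 1)) x _ = _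
    rw [(h0.cos.fun_mul h1.sin).fderiv]
    simp [cellularFlow]
    linear_combination (Real.sin (x 1) * Real.cos (x 1)) * s0

/-- The pressure of the cellular flow. -/
def cellPressure (x : Euc 3) : ℝ := (Real.cos (x 0) ^ 2 + Real.cos (x 1) ^ 2) / 2

theorem contDiff_cellPressure : ContDiff ℝ 1 cellPressure := by
  unfold cellPressure; fun_prop

theorem periodic_cellPressure : Periodic cellPressure := by
  intro i x
  fin_cases i <;> simp [cellPressure]

theorem gradient_cellPressure (x : Euc 3) : gradient cellPressure x =
    !₂[-(Real.sin (x 0) * Real.cos (x 0)), -(Real.sin (x 1) * Real.cos (x 1)), 0] := by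
  have h0 := hasFDerivAt_coord (0 : Fin 3) x
  have h1 := hasFDerivAt_coord (1 : Fin 3) x
  have h := ((h0.cos.pow 2).add (h1.cos.pow 2)).mul_const (2⁻¹ : ℝ)
  have e : fderiv ℝ cellPressure x = _ := h.fderiv
  ext i
  rw [gradient_apply, e]
  fin_cases i <;> simp <;> ring

theorem constitutive_twoHalf {h : Euc 2 → ℝ} (hh : ContDiff ℝ 1 h) (x : Euc 3) :
    twoHalf 0 (advect cellularFlow h) x =
      fderiv ℝ (twoHalf cellularFlow h) x (twoHalf cellularFlow h x) + gradient cellPressure x := by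
  have hx : horiz (twoHalf cellularFlow h x) = cellularFlow (horiz x) := by
    ext j; fin_cases j <;> simp [twoHalf, horiz]
  obtain ⟨e0, e1⟩ := fderiv_cellularFlow_self (horiz x)
  rw [fderiv_twoHalf_apply contDiff_cellularFlow hh, gradient_cellPressure, hx]
  ext i
  fin_cases i
  · simp [twoHalf, e0]
  · simp [twoHalf, e1]
  · simp [twoHalf, advect]

end Constitutive

/-! ### The explicit solution and its gradient bounds. -/

section Existence

variable {k : ℕ} {g₀ : Euc 2 → ℝ} {t : ℝ}

/-- The solution of the rank-one diffusion equation with initial datum `g₀`. -/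
def rankOne (g₀ : Euc 2 → ℝ) (t : ℝ) : Euc 2 → ℝ := synth (flow (fourierCoeff g₀) t)

theorem rankOne_zero (hk : 2 ≤ k) (h : MemSobolev k g₀) : rankOne g₀ 0 = g₀ := by
  rw [rankOne, flow_zero h.hSummable, ← h.eq_synth (by norm_num) hk]

theorem memSobolev_rankOne (hk : 2 ≤ k) (h : MemSobolev k g₀) (ht : 0 ≤ t) :
    MemSobolev k (rankOne g₀ t) := memSobolev_synth_flow hk h.hSummable ht

theorem advect_rankOne (hk : 3 ≤ k) (h : MemSobolev k g₀) (ht : 0 ≤ t) :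
    advect cellularFlow (rankOne g₀ t) = synth (opA (flow (fourierCoeff g₀) t)) :=
  advect_synth ((hSummable_flow h.hSummable ht).1.summable_weight (by norm_num) hk)

theorem memSobolev_advect_rankOne (hk : 3 ≤ k) (h : MemSobolev k g₀) (ht : 0 ≤ t) :
    MemSobolev (k - 1) (advect cellularFlow (rankOne g₀ t)) := by
  rw [advect_rankOne hk h ht]
  exact memSobolev_synth_opA_flow hk h.hSummable ht

theorem isMRESolution_rankOne (hk : 3 ≤ k) (h : MemSobolev k g₀) :
    IsMRESolution k (Ici 0) (fun t => twoHalf cellularFlow (rankOne g₀ t))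
      (fun t => twoHalf 0 (advect cellularFlow (rankOne g₀ t))) := by
  have hk2 : 2 ≤ k := by omega
  have hm : ∀ t ∈ Ici (0 : ℝ), MemSobolev k (rankOne g₀ t) := fun t ht =>
    memSobolev_rankOne hk2 h ht
  have hma : ∀ t ∈ Ici (0 : ℝ), MemSobolev (k - 1) (advect cellularFlow (rankOne g₀ t)) :=
    fun t ht => memSobolev_advect_rankOne hk h ht
  have hC : ∀ t ∈ Ici (0 : ℝ), ContDiff ℝ 1 (rankOne g₀ t) := fun t ht =>
    (hm t ht).contDiff (by norm_num) hk
  refine ⟨fun t ht => vecMemSobolev_twoHalf (memSobolev_cellularFlow k) (hm t ht), fun t ht => ?_,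
    fun t ht => vecMemSobolev_twoHalf (fun _ => memSobolev_zero _) (hma t ht), fun t ht => ?_,
    fun t ht => integral_twoHalf_advect (hC t ht) (hm t ht).2.1,
    fun t ht => divFree_twoHalf_cellularFlow (hm t ht).1,
    fun t ht => divFree_twoHalf_zero (hma t ht).1,
    fun t ht => ⟨cellPressure, contDiff_cellPressure, periodic_cellPressure,
      constitutive_twoHalf (hC t ht)⟩, fun t ht Φ hΦ hΦp => ?_⟩
  · refine (tendsto_sobolevNorm_flow hk2 h.hSummable ht).congr' ?_
    filter_upwards [self_mem_nhdsWithin] with s hs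
    rw [twoHalf_sub, vecSobolevNorm_twoHalf_zero ((hm s hs).1.sub (hm t ht).1)]
    rfl
  · refine (tendsto_sobolevNorm_opA_flow hk h.hSummable ht).congr' ?_
    filter_upwards [self_mem_nhdsWithin] with s hs
    rw [twoHalf_sub, vecSobolevNorm_twoHalf_zero ((hma s hs).1.sub (hma t ht).1),
      advect_rankOne hk h hs, advect_rankOne hk h ht]
  · have hΦ2 : SmoothPeriodic fun x => Φ x 2 :=
      ⟨contDiff_euclidean.1 hΦ 2, fun j x => by simp only [hΦp j x]⟩
    have hd := hasDerivWithinAt_integral_flow hk2 h.hSummable hΦ2 ht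
    rw [integral_twoHalf_evolution (hC t ht) (hm t ht).2.1 (hma t ht).1 hΦ hΦp]
    have e : ∀ s ∈ Ici (0 : ℝ), ∫ x in cell 3, inner ℝ (twoHalf cellularFlow (rankOne g₀ s) x) (Φ x) =
        (∫ x in cell 3, inner ℝ (cellularFlow₃ x) (Φ x)) +
          ∫ x in cell 3, rankOne g₀ s (horiz x) * Φ x 2 := fun s hs => by
      rw [← integral_add]
      · refine setIntegral_congr_fun (measurableSet_cell 3) fun x _ => ?_
        simp only [twoHalf_eq cellularFlow (rankOne g₀ s), inner_add_left, real_inner_smul_left,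
          EuclideanSpace.inner_single_left, map_one, one_mul]
        rfl
      · exact integrableOn_cell ((contDiff_cellularFlow₃ (n := 0)).continuous.inner hΦ.continuous)
      · exact integrableOn_cell (((hm s hs).1.comp continuous_horiz).mul hΦ2.1.continuous)
    exact (hd.const_add _).congr e (e t ht)

theorem isRankOneSolution_rankOne (hk : 3 ≤ k) (h : MemSobolev k g₀) :
    IsRankOneSolution k (Ici 0) (rankOne g₀) := by
  have hk2 : 2 ≤ k := by omega
  refine ⟨fun t ht => memSobolev_rankOne hk2 h ht,
    fun t ht => tendsto_sobolevNorm_flow hk2 h.hSummable ht, fun t ht φ hφ hper => ?_⟩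
  have hP : SmoothPeriodic fun x => φ (horiz x) := ⟨hφ.comp contDiff_horiz, hper.comp_horiz⟩
  have hs1 : SmoothPeriodic (advect cellularFlow φ) :=
    SmoothPeriodic.fderiv_apply ⟨hφ, hper⟩ contDiff_cellularFlow periodic_cellularFlow
  have hs2 : SmoothPeriodic (advect cellularFlow (advect cellularFlow φ)) :=
    hs1.fderiv_apply contDiff_cellularFlow periodic_cellularFlow
  have hd := hasDerivWithinAt_integral_flow hk2 h.hSummable hP ht
  have e : ∀ {ψ : Euc 2 → ℝ}, Continuous ψ → ∀ s ∈ Ici (0 : ℝ),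
      ∫ x in cell 2, rankOne g₀ s x * ψ x =
        (2 * Real.pi)⁻¹ * ∫ x in cell 3, rankOne g₀ s (horiz x) * ψ (horiz x) := fun hψ s hs => by
    rw [integral_cell_horiz (f := fun x => rankOne g₀ s x * _)
      ((memSobolev_rankOne hk2 h hs).1.mul hψ), smul_eq_mul, inv_mul_cancel_left₀]
    positivity
  rw [e hs2.1.continuous t ht]
  rw [advect_comp_horiz (hφ.of_le (by simp)), advect_comp_horiz (hs1.1.of_le (by simp))] at hd
  exact (hd.const_mul _).congr (e hφ.continuous) (e hφ.continuous t ht)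

theorem le_gradSupNorm_rankOne (hk : 3 ≤ k) (h : MemSobolev k g₀) (ht : 0 ≤ t) :
    ENNReal.ofReal (‖gradient g₀ 0‖ * Real.exp t) ≤
      gradSupNorm (twoHalf cellularFlow (rankOne g₀ t)) := by
  have hC : ContDiff ℝ 1 (rankOne g₀ t) :=
    (memSobolev_rankOne (by omega) h ht).contDiff (by norm_num) hk
  have hB := contDiff_twoHalf (contDiff_cellularFlow (n := 1)) hC
  refine le_trans ?_ (enorm_zero_le_eLpNorm_top (hB.continuous_fderiv one_ne_zero))
  rw [← ofReal_norm]
  refine ENNReal.ofReal_le_ofReal ?_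
  have h0 : horiz 0 = 0 := map_zero horizL
  have h1 := norm_fderiv_le_twoHalf (contDiff_cellularFlow (n := 1)) hC 0
  rw [h0, rankOne, fderiv_synth_flow_zero (h.hSummable.mono hk) ht, norm_smul,
    ← h.eq_synth (by norm_num) (by omega), ← norm_gradient, Real.norm_of_nonneg (Real.exp_pos t).le,
    mul_comm] at h1
  exact h1

theorem sobolevNorm_rankOne_le (hk : 2 ≤ k) (h : MemSobolev k g₀) (ht : 0 ≤ t) :
    sobolevNorm k (rankOne g₀ t) ≤
      sobolevNorm k g₀ * ENNReal.ofReal (Real.exp (growthRate k * t)) := by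
  have hf := hSummable_flow h.hSummable ht
  refine (sobolevNorm_synth_le hf.1 (hf.1.summable_norm (by norm_num) hk)).trans ?_
  rw [sobolevNorm_eq h.hSummable, ← ENNReal.ofReal_mul (Real.sqrt_nonneg _)]
  refine ENNReal.ofReal_le_ofReal ?_
  have h1 : 1 ≤ Real.exp (growthRate k * t) :=
    Real.one_le_exp (mul_nonneg (growthRate_nonneg k) ht)
  calc √(hsq k (flow (fourierCoeff g₀) t))
      -- The rate belongs to the squared norm; since the exponential is at least 1, squaring it only
      -- weakens the bound and simplifies the root.
      ≤ √(hsq k (fourierCoeff g₀) * Real.exp (growthRate k * t) ^ 2) := by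
        refine Real.sqrt_le_sqrt (hf.2.trans ?_)
        have := hsq_nonneg k (fourierCoeff g₀)
        gcongr
        nlinarith
    _ = _ := by
        rw [Real.sqrt_mul (hsq_nonneg _ _), Real.sqrt_sq (by positivity)]

theorem gradSupNorm_rankOne_le (hk : 3 ≤ k) (h : MemSobolev k g₀) (ht : 0 ≤ t) {C : ℝ}
    (hC1 : 3 * embConst 3 ≤ C) (hC2 : growthRate k ≤ C) :
    gradSupNorm (twoHalf cellularFlow (rankOne g₀ t)) ≤
      ENNReal.ofReal C * vecSobolevNorm k (twoHalf cellularFlow g₀) *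
        ENNReal.ofReal (Real.exp (C * t)) := by
  have hm := memSobolev_rankOne (by omega) h ht
  have hv := vecMemSobolev_twoHalf (memSobolev_cellularFlow k) hm
  have hv0 := (vecMemSobolev_twoHalf (memSobolev_cellularFlow k) h).2.2.ne
  have hexp : 1 ≤ Real.exp (C * t) := Real.one_le_exp
    (mul_nonneg ((growthRate_nonneg k).trans hC2) ht)
  have hd := contDiff_twoHalf (contDiff_cellularFlow (n := 1)) (hm.contDiff (by norm_num) hk)
  -- The horizontal components do not move and only the vertical one grows. Three components account
  -- for the factor 3 in front of the embedding constant.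
  have hcomp : ∀ i, sobolevNorm k (fun x => twoHalf cellularFlow (rankOne g₀ t) x i) ≤
      vecSobolevNorm k (twoHalf cellularFlow g₀) * ENNReal.ofReal (Real.exp (C * t)) := fun i => by
    have h1 : 1 ≤ ENNReal.ofReal (Real.exp (C * t)) := by simpa using hexp
    have hflow : ∀ i : Fin 2, sobolevNorm k (fun x : Euc 3 => cellularFlow (horiz x) i) ≤
        vecSobolevNorm k (twoHalf cellularFlow g₀) * ENNReal.ofReal (Real.exp (C * t)) := fun i => by
      rw [sobolevNorm, sobolevSq_comp_horiz k (memSobolev_cellularFlow k i).1]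
      exact (sobolevNorm_le_twoHalf (contDiff_cellularFlow (n := 0)).continuous g₀ i).trans
        (le_mul_of_one_le_right' h1)
    fin_cases i
    · exact hflow 0
    · exact hflow 1
    · change sobolevNorm k (fun x => rankOne g₀ t (horiz x)) ≤ _
      rw [sobolevNorm, sobolevSq_comp_horiz k hm.1]
      refine (sobolevNorm_rankOne_le (by omega) h ht).trans ?_
      gcongr
      exact sobolevNorm_le_twoHalf_two _ h.1
  set V := vecSobolevNorm k (twoHalf cellularFlow g₀) with hV
  have hfin : V * ENNReal.ofReal (Real.exp (C * t)) ≠ ⊤ := ENNReal.mul_ne_top hv0 ENNReal.ofReal_ne_top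
  have hbound : ∀ x, ‖fderiv ℝ (twoHalf cellularFlow (rankOne g₀ t)) x‖ ≤
      3 * embConst 3 * (V * ENNReal.ofReal (Real.exp (C * t))).toReal := fun x => by
    refine (norm_fderiv_le_sum (hd.differentiable one_ne_zero x)).trans ?_
    have hi : ∀ i, ‖fderiv ℝ (fun x => twoHalf cellularFlow (rankOne g₀ t) x i) x‖ ≤
        embConst 3 * (V * ENNReal.ofReal (Real.exp (C * t))).toReal := fun i =>
      ((hv.apply i).norm_fderiv_le le_rfl hk x).trans
        (mul_le_mul_of_nonneg_left (ENNReal.toReal_mono hfin (hcomp i)) (embConst_nonneg 3))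
    refine (Finset.sum_le_sum fun i _ => hi i).trans (le_of_eq ?_)
    simp only [Finset.sum_const, Finset.card_univ, Fintype.card_fin, nsmul_eq_mul]
    push_cast; ring
  have hb : gradSupNorm (twoHalf cellularFlow (rankOne g₀ t)) ≤
      ENNReal.ofReal (3 * embConst 3 * (V * ENNReal.ofReal (Real.exp (C * t))).toReal) := by
    rw [gradSupNorm, eLpNorm_exponent_top]
    exact eLpNormEssSup_le_of_ae_bound (Eventually.of_forall hbound)
  refine hb.trans ?_
  have := embConst_nonneg 3
  rw [ENNReal.ofReal_mul (by positivity), ENNReal.ofReal_toReal hfin, mul_assoc]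
  gcongr

end Existence

/-! ### Mollification of periodic functions. -/

section PeriodicFunctions

variable {d : ℕ}

theorem exists_translate_mem_cell (x : Euc d) :
    ∃ m : Fin d → ℤ, x + WithLp.toLp 2 (fun i => (m i : ℝ) * (2 * Real.pi)) ∈ cell d := by
  refine ⟨fun i => -⌊(x i + Real.pi) / (2 * Real.pi)⌋, fun i => ?_⟩
  have hp : 0 < 2 * Real.pi := by positivity
  have h1 := Int.floor_le ((x i + Real.pi) / (2 * Real.pi))
  have h2 := (Int.lt_floor_add_one ((x i + Real.pi) / (2 * Real.pi))).le
  rw [le_div_iff₀ hp] at h1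
  rw [div_le_iff₀ hp] at h2
  simp only [PiLp.add_apply, Int.cast_neg]
  constructor <;> linarith

theorem Periodic.uniformContinuous {F : Type*} [PseudoMetricSpace F] {f : Euc d → F}
    (hper : Periodic f) (hf : Continuous f) : UniformContinuous f := by
  obtain ⟨R, hR⟩ := (isCompact_cell d).isBounded.subset_closedBall 0
  have hu := (isCompact_closedBall (0 : Euc d) (R + 1)).uniformContinuousOn_of_continuous
    hf.continuousOn
  rw [Metric.uniformContinuousOn_iff] at hu
  rw [Metric.uniformContinuous_iff]
  intro ε hε
  obtain ⟨δ, hδ, h⟩ := hu ε hε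
  refine ⟨min δ 1, lt_min hδ one_pos, fun x y hxy => ?_⟩
  obtain ⟨m, hm⟩ := exists_translate_mem_cell x
  rw [← hper.add_int_mul m x, ← hper.add_int_mul m y]
  have hx := hR hm
  have hd := hxy
  rw [← dist_add_right x y (WithLp.toLp 2 fun i => (m i : ℝ) * (2 * Real.pi))] at hd
  rw [mem_closedBall_zero_iff] at hx
  refine h _ ?_ _ ?_ (hd.trans_le (min_le_left _ _))
  · rw [mem_closedBall_zero_iff]; linarith
  · rw [Metric.mem_closedBall]
    refine (dist_triangle_left _ _ (x + WithLp.toLp 2 fun i => (m i : ℝ) * (2 * Real.pi))).trans ?_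
    rw [dist_zero_right, add_comm]
    exact add_le_add hx (hd.trans_le (min_le_right _ _)).le

open scoped Convolution in
/-- Periodic `C¹` functions are `C¹`-limits of smooth periodic functions. -/
theorem exists_smooth_approx {F : Type*} [NormedAddCommGroup F] [NormedSpace ℝ F]
    [CompleteSpace F] {f : Euc d → F} (hf : ContDiff ℝ 1 f) (hper : Periodic f) {ε : ℝ}
    (hε : 0 < ε) : ∃ g : Euc d → F, ContDiff ℝ ∞ g ∧ Periodic g ∧ (∀ x, ‖g x - f x‖ ≤ ε) ∧
      ∀ x, ‖fderiv ℝ g x - fderiv ℝ f x‖ ≤ ε := by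
  have hfd := hf.differentiable one_ne_zero
  obtain ⟨δ₁, hδ₁, h1⟩ := Metric.uniformContinuous_iff.1 (hper.uniformContinuous hf.continuous) ε hε
  obtain ⟨δ₂, hδ₂, h2⟩ := Metric.uniformContinuous_iff.1
    (hper.fderiv.uniformContinuous (hf.continuous_fderiv one_ne_zero)) ε hε
  set δ := min δ₁ δ₂ with hδ
  have hδ0 : 0 < δ := lt_min hδ₁ hδ₂
  let φ : ContDiffBump (0 : Euc d) := ⟨δ / 2, δ, by positivity, by linarith⟩
  set g : Euc d → F := φ.normed volume ⋆[ContinuousLinearMap.lsmul ℝ ℝ, volume] f with hg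
  have hgdef : ∀ x, g x = ∫ z, φ.normed volume z • f (x - z) := fun x => rfl
  have hgC : ContDiff ℝ ∞ g := φ.hasCompactSupport_normed.contDiff_convolution_left _
    φ.contDiff_normed hf.continuous.locallyIntegrable
  have hint : ∀ x, Integrable fun z => φ.normed volume z • f (x - z) := fun x =>
    ((φ.contDiff_normed (n := 0)).continuous.smul
      (hf.continuous.comp (continuous_const.sub continuous_id))).integrable_of_hasCompactSupport
      φ.hasCompactSupport_normed.smul_right
  -- The gradient of g - f is bounded through its Lipschitz constant. Its increment between x and y
  -- is the mollification error of z ↦ f(x + z) - f(y + z), and s ↦ f(s + z) - f(s) is ε-Lipschitz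
  -- for |z| < δ by uniform continuity of the derivative.
  have hlip : ∀ x y, ‖(g x - f x) - (g y - f y)‖ ≤ ε * ‖x - y‖ := by
    intro x y
    have hG := φ.dist_normed_convolution_le (μ := volume) (x₀ := 0) (ε := ε * ‖x - y‖)
      (g := fun z => f (x + z) - f (y + z))
      (by have := hf.continuous; exact Continuous.aestronglyMeasurable (by fun_prop))
      (fun z hz => by
        have hz' : dist z 0 < δ := hz
        have hder : ∀ s ∈ (univ : Set (Euc d)), HasFDerivWithinAt (fun s => f (s + z) - f s)
            (fderiv ℝ f (s + z) - fderiv ℝ f s) univ s := fun s _ =>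
          (((hasFDerivAt_comp_add_right z).2 (hfd (s + z)).hasFDerivAt).sub (hfd s).hasFDerivAt).hasFDerivWithinAt
        have hb : ∀ s ∈ (univ : Set (Euc d)), ‖fderiv ℝ f (s + z) - fderiv ℝ f s‖ ≤ ε := fun s _ => by
          rw [← dist_eq_norm]
          refine (h2 ?_).le
          rw [dist_self_add_left, ← dist_zero_right]
          exact hz'.trans_le (min_le_right _ _)
        have := convex_univ.norm_image_sub_le_of_norm_hasFDerivWithin_le hder hb (mem_univ y)
          (mem_univ x)
        rw [dist_eq_norm]
        simp only [add_zero]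
        rwa [show f (x + z) - f (y + z) - (f x - f y) = f (x + z) - f x - (f (y + z) - f y) by abel])
    have e : (φ.normed volume ⋆[ContinuousLinearMap.lsmul ℝ ℝ, volume]
        fun z => f (x + z) - f (y + z)) 0 = g x - g y := by
      rw [hgdef, hgdef, ← integral_sub (hint x) (hint y), convolution_def]
      refine integral_congr_ae (Eventually.of_forall fun z => ?_)
      simp [sub_eq_add_neg]
    rw [e, dist_eq_norm] at hG
    simp only [add_zero] at hG
    rwa [show g x - f x - (g y - f y) = g x - g y - (f x - f y) by abel]
  refine ⟨g, hgC, fun i x => ?_, fun x => ?_, fun x => ?_⟩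
  · rw [hgdef, hgdef]
    refine integral_congr_ae (Eventually.of_forall fun z => ?_)
    simp only [add_sub_right_comm, hper i]
  · rw [← dist_eq_norm]
    refine φ.dist_normed_convolution_le hf.continuous.aestronglyMeasurable fun z hz => (h1 ?_).le
    exact (Metric.mem_ball.1 hz).trans_le (min_le_left _ _)
  · have h3 : LipschitzWith ⟨ε, hε.le⟩ fun x => g x - f x := LipschitzWith.of_dist_le_mul fun x y => by
      rw [dist_eq_norm, dist_eq_norm]; exact hlip x y
    have h4 := norm_fderiv_le_of_lipschitz ℝ (x₀ := x) h3
    rwa [fderiv_fun_sub (hgC.differentiable (by simp) x) (hfd x)] at h4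

/-- A continuous periodic field of zero `L²` norm vanishes. -/
theorem eq_zero_of_integral_norm_sq {m : ℕ} {f : Euc d → Euc m} (hf : Continuous f)
    (hper : Periodic f) (h : ∫ x in cell d, ‖f x‖ ^ 2 = 0) : f = 0 := by
  have hae : ∀ᵐ x ∂(volume.restrict (cell d)), ‖f x‖ ^ 2 = 0 :=
    (integral_eq_zero_iff_of_nonneg (fun _ => sq_nonneg _)
      (integrableOn_cell (hf.norm.pow 2))).1 h
  ext x i
  have hi : Continuous fun x => f x i := by fun_prop
  -- Going through the Fourier coefficients turns almost everywhere vanishing on the cell into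
  -- vanishing everywhere.
  have hc : fourierCoeff (fun x => f x i) = 0 := by
    ext n
    rw [fourierCoeff, integral_eq_zero_of_ae, mul_zero, Pi.zero_apply]
    filter_upwards [hae] with y hy
    have : f y = 0 := by simpa using hy
    simp [this]
  have he := eq_synth_fourierCoeff hi (fun j x => by simp only [hper j x])
    (by simp [hc, summable_zero])
  rw [hc] at he
  have := congrFun he x
  simpa [synth, csynth] using this

end PeriodicFunctions

/-! ### Divergence-free fields tested against C¹ functions. -/

section DivergenceFree

variable {d : ℕ}

/-- C¹ approximation by smooth periodic functions extends the weak condition to test functions built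
from B and the pressure. -/
theorem DivFree.integral_eq_zero {w : Euc d → Euc d} (hw : DivFree w) (hwc : Continuous w)
    {f : Euc d → ℝ} (hf : ContDiff ℝ 1 f) (hper : Periodic f) :
    ∫ x in cell d, fderiv ℝ f x (w x) = 0 := by
  have hfi : IntegrableOn (fun x => fderiv ℝ f x (w x)) (cell d) :=
    integrableOn_cell ((hf.continuous_fderiv one_ne_zero).clm_apply hwc)
  have hwi : IntegrableOn (fun x => ‖w x‖) (cell d) := integrableOn_cell hwc.norm
  have hb : ∀ ε > 0, |∫ x in cell d, fderiv ℝ f x (w x)| ≤ ε * ∫ x in cell d, ‖w x‖ := by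
    intro ε hε
    obtain ⟨g, hg, hgp, -, hgd⟩ := exists_smooth_approx hf hper hε
    have hgi : IntegrableOn (fun x => fderiv ℝ g x (w x)) (cell d) :=
      integrableOn_cell ((hg.continuous_fderiv (by simp)).clm_apply hwc)
    have e : ∫ x in cell d, fderiv ℝ f x (w x) =
        -∫ x in cell d, (fderiv ℝ g x - fderiv ℝ f x) (w x) := by
      simp only [sub_apply]
      rw [integral_sub hgi hfi, hw g hg hgp]; ring
    rw [e, abs_neg, ← integral_const_mul, ← Real.norm_eq_abs]
    refine norm_integral_le_of_norm_le (hwi.const_mul ε) (Eventually.of_forall fun x => ?_)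
    exact ((fderiv ℝ g x - fderiv ℝ f x).le_opNorm (w x)).trans (by gcongr; exact hgd x)
  have h0 : |∫ x in cell d, fderiv ℝ f x (w x)| ≤ 0 := by
    refine ge_of_tendsto (x := 𝓝[>] (0 : ℝ)) (f := fun ε => ε * ∫ x in cell d, ‖w x‖) ?_ ?_
    · have : Tendsto (fun ε : ℝ => ε * ∫ x in cell d, ‖w x‖) (𝓝 0) (𝓝 0) := by
        simpa using (continuous_mul_const (∫ x in cell d, ‖w x‖)).tendsto 0
      exact this.mono_left nhdsWithin_le_nhds
    · filter_upwards [self_mem_nhdsWithin] with ε hε using hb ε hε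
  exact abs_nonpos_iff.1 h0

/-- The curl-type field built from two divergence-free fields and a function is divergence free:
`div ((Y · ∇f) X - (X · ∇f) Y - f [X, Y]) = 0`. -/
theorem DivFree.commutator {X Y : Euc d → Euc d} (hX : DivFree X) (hY : DivFree Y)
    (hXc : ContDiff ℝ 1 X) (hYc : ContDiff ℝ 1 Y) (hXp : Periodic X) (hYp : Periodic Y)
    {f : Euc d → ℝ} (hf : ContDiff ℝ 1 f) (hfp : Periodic f) :
    DivFree fun x => fderiv ℝ f x (Y x) • X x - fderiv ℝ f x (X x) • Y x -
      f x • (fderiv ℝ Y x (X x) - fderiv ℝ X x (Y x)) := by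
  intro h hh hhp
  have hh1 : ContDiff ℝ 1 (fderiv ℝ h) := hh.fderiv_right (m := 1) (by norm_cast)
  have hhd := hh1.differentiable one_ne_zero
  have key : ∀ {X : Euc d → Euc d}, ContDiff ℝ 1 X → ∀ x y,
      fderiv ℝ (fun x => f x * fderiv ℝ h x (X x)) x y = fderiv ℝ f x y * fderiv ℝ h x (X x) +
        f x * (fderiv ℝ (fderiv ℝ h) x y (X x) + fderiv ℝ h x (fderiv ℝ X x y)) := by
    intro X hXc x y
    have e1 := (hhd x).hasFDerivAt.clm_apply (hXc.differentiable one_ne_zero x).hasFDerivAt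
    rw [((hf.differentiable one_ne_zero x).hasFDerivAt.fun_mul e1).fderiv]
    simp
    ring
  -- Against a smooth h the field pairs to Y·∇(f X·∇h) - X·∇(f Y·∇h). Each term has zero mean, and
  -- the second derivatives of h cancel by symmetry, so no second derivative of X, Y or f is needed.
  have h1 := hY.integral_eq_zero hYc.continuous (hf.mul (hh1.clm_apply hXc))
    (fun i x => by simp only [hfp i x, hhp.fderiv i x, hXp i x])
  have h2 := hX.integral_eq_zero hXc.continuous (hf.mul (hh1.clm_apply hYc))
    (fun i x => by simp only [hfp i x, hhp.fderiv i x, hYp i x])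
  have hci : ∀ {X Y : Euc d → Euc d}, ContDiff ℝ 1 X → ContDiff ℝ 1 Y →
      IntegrableOn (fun x => fderiv ℝ (fun x => f x * fderiv ℝ h x (X x)) x (Y x)) (cell d) :=
    fun hX hY => integrableOn_cell
      (((hf.mul (hh1.clm_apply hX)).continuous_fderiv one_ne_zero).clm_apply hY.continuous)
  have h3 := (integral_sub (hci hXc hYc) (hci hYc hXc)).trans (congrArg₂ (· - ·) h1 h2)
  rw [sub_zero] at h3
  rw [← h3]
  refine setIntegral_congr_fun (measurableSet_cell d) fun x _ => ?_
  have hsymm : fderiv ℝ (fderiv ℝ h) x (Y x) (X x) = fderiv ℝ (fderiv ℝ h) x (X x) (Y x) :=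
    (hh.contDiffAt.isSymmSndFDerivAt (by simp; norm_cast)).eq _ _
  simp only [key hXc, key hYc, hsymm, map_sub, map_smul, smul_eq_mul]
  ring

end DivergenceFree

/-! ### Sobolev embedding for vector fields. -/

section VectorEmbedding

variable {d m k : ℕ} {f g : Euc d → Euc m}

theorem VecMemSobolev.contDiff (hd : d ≤ 3) (hk : 3 ≤ k) (h : VecMemSobolev k f) :
    ContDiff ℝ 1 f :=
  contDiff_euclidean.2 fun i => (h.apply i).contDiff hd hk

theorem VecMemSobolev.norm_le (hd : d ≤ 3) (hk : 2 ≤ k) (h : VecMemSobolev k f) (x : Euc d) :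
    ‖f x‖ ≤ m * embConst d * (vecSobolevNorm k f).toReal := by
  refine (norm_le_sum_abs _).trans ((Finset.sum_le_sum fun i _ =>
    ((h.apply i).abs_le hd hk x).trans (mul_le_mul_of_nonneg_left
      (ENNReal.toReal_mono h.2.2.ne (sobolevNorm_le_vecSobolevNorm f i)) (embConst_nonneg d))).trans ?_)
  simp [mul_assoc]

theorem VecMemSobolev.norm_fderiv_le (hd : d ≤ 3) (hk : 3 ≤ k) (h : VecMemSobolev k f) (x : Euc d) :
    ‖fderiv ℝ f x‖ ≤ m * embConst d * (vecSobolevNorm k f).toReal := by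
  refine (norm_fderiv_le_sum ((h.contDiff hd hk).differentiable one_ne_zero x)).trans
    ((Finset.sum_le_sum fun i _ =>
    ((h.apply i).norm_fderiv_le hd hk x).trans (mul_le_mul_of_nonneg_left
      (ENNReal.toReal_mono h.2.2.ne (sobolevNorm_le_vecSobolevNorm f i)) (embConst_nonneg d))).trans ?_)
  simp [mul_assoc]

theorem VecMemSobolev.sub (hf : VecMemSobolev k f) (hg : VecMemSobolev k g) :
    VecMemSobolev k (f - g) := by
  refine ⟨hf.1.sub hg.1, fun i x => ?_, ?_⟩
  · simp only [Pi.sub_apply, hf.2.1 i x, hg.2.1 i x]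
  · rw [vecSobolevNorm_lt_top_iff]
    intro i
    exact ((hf.apply i).sub (hg.apply i)).hSummable

end VectorEmbedding

/-! ### Continuity of solutions in time, uniformly in space. -/

section TimeRegularity

variable {k : ℕ} {I J : Set ℝ} {B u : ℝ → Euc 3 → Euc 3} {t : ℝ}

theorem IsMRESolution.mono (h : IsMRESolution k I B u) (hJ : J ⊆ I) : IsMRESolution k J B u where
  mem_B t ht := h.mem_B t (hJ ht)
  cont_B t ht := (h.cont_B t (hJ ht)).mono_left (nhdsWithin_mono t hJ)
  mem_u t ht := h.mem_u t (hJ ht)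
  cont_u t ht := (h.cont_u t (hJ ht)).mono_left (nhdsWithin_mono t hJ)
  mean_u t ht := h.mean_u t (hJ ht)
  div_B t ht := h.div_B t (hJ ht)
  div_u t ht := h.div_u t (hJ ht)
  constitutive t ht := h.constitutive t (hJ ht)
  evolution t ht Φ hΦ hp := (h.evolution t (hJ ht) Φ hΦ hp).mono hJ

theorem eventually_mul_toReal_le {α : Type*} {l : Filter α} {f : α → ENNReal}
    (hf : Tendsto f l (𝓝 0)) (C : ℝ) {δ : ℝ} (hδ : 0 < δ) : ∀ᶠ s in l, C * (f s).toReal ≤ δ := by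
  have h1 : Tendsto (fun s => C * (f s).toReal) l (𝓝 0) := by
    simpa using ((ENNReal.tendsto_toReal ENNReal.zero_ne_top).comp hf).const_mul C
  exact h1.eventually_le_const hδ

theorem IsMRESolution.contDiff (hk : 3 ≤ k) (h : IsMRESolution k I B u) (ht : t ∈ I) :
    ContDiff ℝ 1 (B t) := (h.mem_B t ht).contDiff le_rfl hk

/-- Solutions are continuous in time with values in `C¹` (for `B`) and `C⁰` (for `u`). -/
theorem IsMRESolution.eventually_close (hk : 3 ≤ k) (h : IsMRESolution k I B u) (ht : t ∈ I)
    {δ : ℝ} (hδ : 0 < δ) : ∀ᶠ s in 𝓝[I] t, s ∈ I ∧ (∀ x, ‖B s x - B t x‖ ≤ δ) ∧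
      (∀ x, ‖fderiv ℝ (B s) x - fderiv ℝ (B t) x‖ ≤ δ) ∧ ∀ x, ‖u s x - u t x‖ ≤ δ := by
  filter_upwards [self_mem_nhdsWithin,
    eventually_mul_toReal_le (h.cont_B t ht) ((3 : ℕ) * embConst 3) hδ,
    eventually_mul_toReal_le (h.cont_u t ht) ((3 : ℕ) * embConst 3) hδ] with s hs h1 h2
  have hB := (h.mem_B s hs).sub (h.mem_B t ht)
  have hu := (h.mem_u s hs).sub (h.mem_u t ht)
  refine ⟨hs, fun x => (hB.norm_le le_rfl (by omega) x).trans h1, fun x => ?_,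
    fun x => (hu.norm_le le_rfl (by omega) x).trans h2⟩
  have := (hB.norm_fderiv_le le_rfl hk x).trans h1
  rwa [fderiv_sub ((h.contDiff hk hs).differentiable one_ne_zero x)
    ((h.contDiff hk ht).differentiable one_ne_zero x)] at this

theorem IsMRESolution.exists_bound (hk : 3 ≤ k) (h : IsMRESolution k I B u) (ht : t ∈ I) :
    ∃ M, 0 ≤ M ∧ (∀ x, ‖B t x‖ ≤ M) ∧ (∀ x, ‖fderiv ℝ (B t) x‖ ≤ M) ∧ ∀ x, ‖u t x‖ ≤ M := by
  have hE := embConst_nonneg 3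
  refine ⟨(3 : ℕ) * embConst 3 * ((vecSobolevNorm k (B t)).toReal +
      (vecSobolevNorm (k - 1) (u t)).toReal), by positivity, fun x => ?_, fun x => ?_, fun x => ?_⟩
  · refine ((h.mem_B t ht).norm_le le_rfl (by omega) x).trans ?_
    gcongr
    exact le_add_of_nonneg_right ENNReal.toReal_nonneg
  · refine ((h.mem_B t ht).norm_fderiv_le le_rfl hk x).trans ?_
    gcongr
    exact le_add_of_nonneg_right ENNReal.toReal_nonneg
  · refine ((h.mem_u t ht).norm_le le_rfl (by omega) x).trans ?_
    gcongr
    exact le_add_of_nonneg_left ENNReal.toReal_nonneg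

end TimeRegularity

/-! ### Bounds for the weak induction term. -/

section Induction

/-- The weak form `∫ B · (u · ∇Φ) - u · (B · ∇Φ)` of `B · ∇u - u · ∇B`. -/
def weakInduction (B u Φ : Euc 3 → Euc 3) : ℝ :=
  ∫ x in cell 3, (inner ℝ (B x) (fderiv ℝ Φ x (u x)) - inner ℝ (u x) (fderiv ℝ Φ x (B x)))

variable {B u B' u' Φ Ψ : Euc 3 → Euc 3}

theorem integrableOn_weakInduction (hB : Continuous B) (hu : Continuous u) (hΦ : ContDiff ℝ 1 Φ) :
    IntegrableOn (fun x => (inner ℝ (B x) (fderiv ℝ Φ x (u x)) -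
      inner ℝ (u x) (fderiv ℝ Φ x (B x)) : ℝ)) (cell 3) := by
  have hD := hΦ.continuous_fderiv one_ne_zero
  exact integrableOn_cell ((hB.inner (hD.clm_apply hu)).sub (hu.inner (hD.clm_apply hB)))

theorem weakInduction_sub (hB : Continuous B) (hu : Continuous u) (hΦ : ContDiff ℝ 1 Φ)
    (hΨ : ContDiff ℝ 1 Ψ) :
    weakInduction B u (Φ - Ψ) = weakInduction B u Φ - weakInduction B u Ψ := by
  rw [weakInduction, weakInduction, weakInduction, ← integral_sub
    (integrableOn_weakInduction hB hu hΦ) (integrableOn_weakInduction hB hu hΨ)]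
  refine setIntegral_congr_fun (measurableSet_cell 3) fun x _ => ?_
  simp only [fderiv_sub (hΦ.differentiable one_ne_zero x) (hΨ.differentiable one_ne_zero x),
    sub_apply, inner_sub_right]
  ring

theorem abs_inner_clm_le {a c : Euc 3} {T : Euc 3 →L[ℝ] Euc 3} {α β L : ℝ} (hα : 0 ≤ α)
    (ha : ‖a‖ ≤ α) (hc : ‖c‖ ≤ β) (hT : ‖T‖ ≤ L) : |inner ℝ a (T c)| ≤ α * (L * β) := by
  have hL := (norm_nonneg T).trans hT
  refine (abs_real_inner_le_norm _ _).trans ?_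
  gcongr
  exact (T.le_opNorm c).trans (by gcongr)

theorem abs_integral_cell_le {f : Euc 3 → ℝ} {C : ℝ} (hf : ∀ x, |f x| ≤ C) :
    |∫ x in cell 3, f x| ≤ C * (2 * Real.pi) ^ 3 := by
  rw [← volume_real_cell 3]
  exact norm_setIntegral_le_of_norm_le_const (f := f) (isCompact_cell 3).measure_lt_top
    fun x _ => hf x

theorem abs_weakInduction_le {M L : ℝ} (hM : 0 ≤ M) (hB : ∀ x, ‖B x‖ ≤ M) (hu : ∀ x, ‖u x‖ ≤ M)
    (hΦ : ∀ x, ‖fderiv ℝ Φ x‖ ≤ L) :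
    |weakInduction B u Φ| ≤ 2 * M ^ 2 * (2 * Real.pi) ^ 3 * L := by
  refine (abs_integral_cell_le (C := 2 * M ^ 2 * L) fun x => ?_).trans (le_of_eq (by ring))
  refine (abs_sub _ _).trans ?_
  have h1 := abs_inner_clm_le hM (hB x) (hu x) (hΦ x)
  have h2 := abs_inner_clm_le hM (hu x) (hB x) (hΦ x)
  linarith

theorem abs_weakInduction_sub_le (hB : Continuous B) (hu : Continuous u) (hB' : Continuous B')
    (hu' : Continuous u') (hΦ1 : ContDiff ℝ 1 Φ) {M η L : ℝ} (hM : 0 ≤ M) (hη : 0 ≤ η) (hη1 : η ≤ 1)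
    (hBM : ∀ x, ‖B x‖ ≤ M) (huM : ∀ x, ‖u x‖ ≤ M) (hBη : ∀ x, ‖B' x - B x‖ ≤ η)
    (huη : ∀ x, ‖u' x - u x‖ ≤ η) (hΦ : ∀ x, ‖fderiv ℝ Φ x‖ ≤ L) :
    |weakInduction B' u' Φ - weakInduction B u Φ| ≤ (4 * M + 2) * (2 * Real.pi) ^ 3 * η * L := by
  rw [weakInduction, weakInduction, ← integral_sub (integrableOn_weakInduction hB' hu' hΦ1)
    (integrableOn_weakInduction hB hu hΦ1)]
  refine (abs_integral_cell_le (C := (4 * M + 2) * η * L) fun x => ?_).trans (le_of_eq (by ring))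
  have hB'M : ‖B' x‖ ≤ M + 1 := by
    have := norm_add_le (B x) (B' x - B x)
    rw [add_sub_cancel] at this
    linarith [hBM x, hBη x]
  have hu'M : ‖u' x‖ ≤ M + 1 := by
    have := norm_add_le (u x) (u' x - u x)
    rw [add_sub_cancel] at this
    linarith [huM x, huη x]
  have e : (inner ℝ (B' x) (fderiv ℝ Φ x (u' x)) - inner ℝ (u' x) (fderiv ℝ Φ x (B' x)) -
      (inner ℝ (B x) (fderiv ℝ Φ x (u x)) - inner ℝ (u x) (fderiv ℝ Φ x (B x))) : ℝ) =
      (inner ℝ (B' x - B x) (fderiv ℝ Φ x (u' x)) + inner ℝ (B x) (fderiv ℝ Φ x (u' x - u x))) -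
      (inner ℝ (u' x - u x) (fderiv ℝ Φ x (B' x)) + inner ℝ (u x) (fderiv ℝ Φ x (B' x - B x))) := by
    simp only [map_sub, inner_sub_left, inner_sub_right]
    ring
  rw [e]
  have h1 := abs_inner_clm_le hη (hBη x) hu'M (hΦ x)
  have h2 := abs_inner_clm_le hM (hBM x) (huη x) (hΦ x)
  have h3 := abs_inner_clm_le hη (huη x) hB'M (hΦ x)
  have h4 := abs_inner_clm_le hM (huM x) (hBη x) (hΦ x)
  refine (abs_sub _ _).trans ((add_le_add (abs_add_le _ _) (abs_add_le _ _)).trans ?_)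
  linarith

theorem le_of_forall_pos_le_add_mul {a b C : ℝ} (h : ∀ ε > 0, a ≤ b + C * ε) : a ≤ b := by
  have h1 : Tendsto (fun ε : ℝ => b + C * ε) (𝓝[>] 0) (𝓝 b) := by
    have : Tendsto (fun ε : ℝ => b + C * ε) (𝓝 0) (𝓝 (b + C * 0)) :=
      Continuous.tendsto (by fun_prop) 0
    rw [mul_zero, add_zero] at this
    exact this.mono_left nhdsWithin_le_nhds
  exact ge_of_tendsto h1 (by filter_upwards [self_mem_nhdsWithin] with ε hε using h ε hε)

end Induction

/-! ### Differentiating the energy of the difference of two solutions. -/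

section Energy

variable {k : ℕ} {I : Set ℝ} {B u B₁ u₁ B₂ u₂ : ℝ → Euc 3 → Euc 3} {t : ℝ}

/-- First-order Taylor expansion in time, uniformly over `C¹` test fields. -/
theorem IsMRESolution.eventually_taylor (hk : 3 ≤ k) (hI : Convex ℝ I) (h : IsMRESolution k I B u)
    (ht : t ∈ I) {δ : ℝ} (hδ : 0 < δ) : ∀ᶠ s in 𝓝[I] t, ∀ Φ : Euc 3 → Euc 3, ContDiff ℝ 1 Φ →
      Periodic Φ → ∀ L, (∀ x, ‖fderiv ℝ Φ x‖ ≤ L) →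
      |(∫ x in cell 3, inner ℝ (B s x) (Φ x)) - (∫ x in cell 3, inner ℝ (B t x) (Φ x)) -
        (s - t) * weakInduction (B t) (u t) Φ| ≤ δ * L * |s - t| := by
  obtain ⟨M, hM, hBM, -, huM⟩ := h.exists_bound hk ht
  set V : ℝ := (2 * Real.pi) ^ 3 with hV
  have hV0 : 0 < V := by positivity
  set η := min 1 (δ / ((4 * M + 2) * V)) with hη
  have hη0 : 0 < η := lt_min one_pos (by positivity)
  have hηδ : (4 * M + 2) * V * η ≤ δ := by
    have := min_le_right 1 (δ / ((4 * M + 2) * V))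
    rw [← hη, le_div_iff₀ (by positivity)] at this
    linarith
  obtain ⟨r, hr, hball⟩ := Metric.mem_nhdsWithin_iff.1 (h.eventually_close hk ht hη0)
  have hcB : ∀ s ∈ I, Continuous (B s) := fun s hs => (h.mem_B s hs).1
  have hcu : ∀ s ∈ I, Continuous (u s) := fun s hs => (h.mem_u s hs).1
  have htB : t ∈ Metric.ball t r ∩ I := ⟨Metric.mem_ball_self hr, ht⟩
  -- Mean value inequality on the convex set ball ∩ I. The test field enters only through its
  -- gradient bound L, so the neighbourhood does not depend on it.
  have smooth : ∀ s ∈ Metric.ball t r ∩ I, ∀ Φ : Euc 3 → Euc 3, ContDiff ℝ ∞ Φ →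
      Periodic Φ → ∀ L, (∀ x, ‖fderiv ℝ Φ x‖ ≤ L) →
      |(∫ x in cell 3, inner ℝ (B s x) (Φ x)) - (∫ x in cell 3, inner ℝ (B t x) (Φ x)) -
        (s - t) * weakInduction (B t) (u t) Φ| ≤ δ * L * |s - t| := by
    intro s hs Φ hΦ hΦp L hL
    have hL0 : 0 ≤ L := (norm_nonneg _).trans (hL 0)
    have hder : ∀ ξ ∈ Metric.ball t r ∩ I, HasDerivWithinAt
        (fun ξ => (∫ x in cell 3, inner ℝ (B ξ x) (Φ x)) - ξ * weakInduction (B t) (u t) Φ)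
        (weakInduction (B ξ) (u ξ) Φ - weakInduction (B t) (u t) Φ) (Metric.ball t r ∩ I) ξ :=
      fun ξ hξ => by
        have h1 := (h.evolution ξ hξ.2 Φ hΦ hΦp).mono (inter_subset_right (s := Metric.ball t r))
        have h2 := ((hasDerivAt_id ξ).mul_const (weakInduction (B t) (u t) Φ)).hasDerivWithinAt
          (s := Metric.ball t r ∩ I)
        rw [one_mul] at h2
        exact h1.fun_sub h2
    have hbd : ∀ ξ ∈ Metric.ball t r ∩ I,
        ‖weakInduction (B ξ) (u ξ) Φ - weakInduction (B t) (u t) Φ‖ ≤ δ * L := fun ξ hξ => by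
      obtain ⟨-, hB, -, hu⟩ := hball hξ
      refine (abs_weakInduction_sub_le (hcB t ht) (hcu t ht) (hcB ξ hξ.2) (hcu ξ hξ.2)
        (hΦ.of_le (by simp)) hM hη0.le (min_le_left _ _) hBM huM hB hu hL).trans ?_
      gcongr
    have := ((convex_ball t r).inter hI).norm_image_sub_le_of_norm_hasDerivWithin_le hder hbd htB hs
    rw [Real.norm_eq_abs, Real.norm_eq_abs] at this
    refine le_trans (le_of_eq ?_) this
    congr 1
    ring
  have hmem : Metric.ball t r ∩ I ∈ 𝓝[I] t :=
    inter_mem (mem_nhdsWithin_of_mem_nhds (Metric.ball_mem_nhds t hr)) self_mem_nhdsWithin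
  filter_upwards [hmem] with s hs Φ hΦ hΦp L hL
  have hBs : ∀ x, ‖B s x‖ ≤ M + 1 := fun x => by
    have h1 := (hball hs).2.1 x
    have h2 := norm_add_le (B t x) (B s x - B t x)
    rw [add_sub_cancel] at h2
    linarith [hBM x, min_le_left 1 (δ / ((4 * M + 2) * V))]
  -- With s fixed, Φ is replaced by a smooth C¹-approximation; all errors are linear in ε, which
  -- then tends to 0.
  refine le_of_forall_pos_le_add_mul
    (C := δ * |s - t| + (M + 1) * V + M * V + |s - t| * (2 * M ^ 2 * V)) fun ε hε => ?_
  obtain ⟨Ψ, hΨ, hΨp, hΨ0, hΨ1⟩ := exists_smooth_approx hΦ hΦp hε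
  have hΨ1' : ContDiff ℝ 1 Ψ := hΨ.of_le (by simp)
  have hΨL : ∀ x, ‖fderiv ℝ Ψ x‖ ≤ L + ε := fun x => by
    have h2 := norm_add_le (fderiv ℝ Φ x) (fderiv ℝ Ψ x - fderiv ℝ Φ x)
    rw [add_sub_cancel] at h2
    linarith [hL x, hΨ1 x]
  have main := smooth s hs Ψ hΨ hΨp (L + ε) hΨL
  have hpair : ∀ {f : Euc 3 → Euc 3} {R : ℝ}, Continuous f → 0 ≤ R → (∀ x, ‖f x‖ ≤ R) →
      |(∫ x in cell 3, inner ℝ (f x) (Ψ x)) - ∫ x in cell 3, inner ℝ (f x) (Φ x)| ≤ R * V * ε := by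
    intro f R hf hR hfR
    rw [← integral_sub (integrableOn_cell (hf.inner hΨ.continuous))
      (integrableOn_cell (hf.inner hΦ.continuous))]
    refine (abs_integral_cell_le (C := R * ε) fun x => ?_).trans (le_of_eq (by ring))
    rw [← inner_sub_right]
    refine (abs_real_inner_le_norm _ _).trans ?_
    gcongr
    · exact hfR x
    · exact hΨ0 x
  have p1 := hpair (hcB s hs.2) (by positivity) hBs
  have p2 := hpair (hcB t ht) hM hBM
  have p3 : |weakInduction (B t) (u t) Ψ - weakInduction (B t) (u t) Φ| ≤ 2 * M ^ 2 * V * ε := by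
    rw [← weakInduction_sub (hcB t ht) (hcu t ht) hΨ1' hΦ]
    refine abs_weakInduction_le hM hBM huM fun x => ?_
    rw [fderiv_sub (hΨ1'.differentiable one_ne_zero x) (hΦ.differentiable one_ne_zero x)]
    exact hΨ1 x
  have p4 : |(s - t) * (weakInduction (B t) (u t) Ψ - weakInduction (B t) (u t) Φ)| ≤
      |s - t| * (2 * M ^ 2 * V * ε) := by
    rw [abs_mul]; gcongr
  rw [abs_le] at main p1 p2 p4 ⊢
  constructor <;> linarith [main.1, main.2, p1.1, p1.2, p2.1, p2.2, p4.1, p4.2]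

/-- The natural test field b moves in time and is only C¹ in space. Polarization ‖b_s‖² - ‖b_t‖² =
⟨b_s - b_t, b_s + b_t⟩ freezes it for each s, and the Taylor expansion, uniform over test fields of
bounded gradient, applies. -/
theorem IsMRESolution.hasDerivWithinAt_energy (hk : 3 ≤ k) (hI : Convex ℝ I)
    (h₁ : IsMRESolution k I B₁ u₁) (h₂ : IsMRESolution k I B₂ u₂) (ht : t ∈ I) :
    HasDerivWithinAt (fun s => ∫ x in cell 3, ‖B₂ s x - B₁ s x‖ ^ 2)
      (2 * (weakInduction (B₂ t) (u₂ t) (B₂ t - B₁ t) -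
        weakInduction (B₁ t) (u₁ t) (B₂ t - B₁ t))) I t := by
  obtain ⟨M₁, hM₁, hB₁, hD₁, hu₁⟩ := h₁.exists_bound hk ht
  obtain ⟨M₂, hM₂, hB₂, hD₂, hu₂⟩ := h₂.exists_bound hk ht
  set V : ℝ := (2 * Real.pi) ^ 3 with hV
  have hV0 : 0 < V := by positivity
  set b : ℝ → Euc 3 → Euc 3 := fun s => B₂ s - B₁ s with hb
  have hC₁ : ∀ s ∈ I, ContDiff ℝ 1 (B₁ s) := fun s hs => h₁.contDiff hk hs
  have hC₂ : ∀ s ∈ I, ContDiff ℝ 1 (B₂ s) := fun s hs => h₂.contDiff hk hs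
  have hbC : ∀ s ∈ I, ContDiff ℝ 1 (b s) := fun s hs => (hC₂ s hs).sub (hC₁ s hs)
  have hbp : ∀ s ∈ I, Periodic (b s) := fun s hs i x => by
    simp only [hb, Pi.sub_apply, (h₁.mem_B s hs).2.1 i x, (h₂.mem_B s hs).2.1 i x]
  have hbd : ∀ s ∈ I, ∀ x, fderiv ℝ (b s) x = fderiv ℝ (B₂ s) x - fderiv ℝ (B₁ s) x :=
    fun s hs x => fderiv_sub ((hC₂ s hs).differentiable one_ne_zero x)
      ((hC₁ s hs).differentiable one_ne_zero x)
  rw [hasDerivWithinAt_iff_isLittleO, Asymptotics.isLittleO_iff]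
  intro c hc
  set L : ℝ := 2 * (M₁ + M₂) + 2 with hL
  -- Collects two Taylor errors δL and the induction terms tested on b s - b t, whose gradient is at
  -- most 2δ.
  set S : ℝ := 2 * L + 4 * M₁ ^ 2 * V + 4 * M₂ ^ 2 * V + 1 with hS
  have hS0 : 0 < S := by positivity
  set δ := min 1 (c / S) with hδ
  have hδ0 : 0 < δ := lt_min one_pos (by positivity)
  have hδ1 : δ ≤ 1 := min_le_left _ _
  have hδS : S * δ ≤ c := by
    have := min_le_right 1 (c / S)
    rw [← hδ, le_div_iff₀ hS0] at this
    linarith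
  filter_upwards [h₁.eventually_close hk ht hδ0, h₂.eventually_close hk ht hδ0,
    h₁.eventually_taylor hk hI ht hδ0, h₂.eventually_taylor hk hI ht hδ0] with s c₁ c₂ t₁ t₂
  have hs := c₁.1
  have hdiff : ∀ x, ‖fderiv ℝ (b s - b t) x‖ ≤ 2 * δ := fun x => by
    rw [fderiv_sub ((hbC s hs).differentiable one_ne_zero x)
      ((hbC t ht).differentiable one_ne_zero x), hbd s hs, hbd t ht]
    have : fderiv ℝ (B₂ s) x - fderiv ℝ (B₁ s) x - (fderiv ℝ (B₂ t) x - fderiv ℝ (B₁ t) x) =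
        (fderiv ℝ (B₂ s) x - fderiv ℝ (B₂ t) x) - (fderiv ℝ (B₁ s) x - fderiv ℝ (B₁ t) x) := by abel
    rw [this]
    refine (norm_sub_le _ _).trans ?_
    linarith [c₁.2.2.1 x, c₂.2.2.1 x]
  have hbt : ∀ x, ‖fderiv ℝ (b t) x‖ ≤ M₁ + M₂ := fun x => by
    rw [hbd t ht]
    refine (norm_sub_le _ _).trans ?_
    linarith [hD₁ x, hD₂ x]
  have hdiff1 : ContDiff ℝ 1 (b s - b t) := (hbC s hs).sub (hbC t ht)
  -- This is b s + b t, written with differences and a negation so that linearity in the test field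
  -- follows from `weakInduction_sub`.
  set Φ : Euc 3 → Euc 3 := b s - b t - (-(b t) - b t) with hΦ
  have hneg : ContDiff ℝ 1 (-(b t) - b t) := (hbC t ht).neg.sub (hbC t ht)
  have hΦC : ContDiff ℝ 1 Φ := hdiff1.sub hneg
  have hΦp : Periodic Φ := fun i x => by
    simp only [hΦ, Pi.sub_apply, Pi.neg_apply, hbp s hs i x, hbp t ht i x]
  have hΦL : ∀ x, ‖fderiv ℝ Φ x‖ ≤ L := fun x => by
    have hdt := (hbC t ht).differentiable one_ne_zero x
    have e : fderiv ℝ Φ x = fderiv ℝ (b s - b t) x - (-fderiv ℝ (b t) x - fderiv ℝ (b t) x) := by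
      rw [hΦ, fderiv_sub (hdiff1.differentiable one_ne_zero x) (hneg.differentiable one_ne_zero x),
        fderiv_sub hdt.neg hdt, fderiv_neg]
    rw [e]
    refine (norm_sub_le _ _).trans ((add_le_add_right (norm_sub_le _ _) _).trans ?_)
    rw [norm_neg]
    linarith [hdiff x, hbt x]
  have T₁ := t₁ Φ hΦC hΦp L hΦL
  have T₂ := t₂ Φ hΦC hΦp L hΦL
  have hlin : ∀ {B u : Euc 3 → Euc 3}, Continuous B → Continuous u → weakInduction B u Φ =
      weakInduction B u (b s - b t) + 2 * weakInduction B u (b t) := by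
    intro B u hB hu
    have hz : ContDiff ℝ 1 (0 : Euc 3 → Euc 3) := contDiff_const
    have hn : ContDiff ℝ 1 (-(b t)) := (hbC t ht).neg
    have h0 : weakInduction B u (-(b t) - b t) = -2 * weakInduction B u (b t) := by
      have h00 : weakInduction B u 0 = 0 := by
        rw [← sub_self (b t), weakInduction_sub hB hu (hbC t ht) (hbC t ht), sub_self]
      have h01 : weakInduction B u (-(b t)) = -weakInduction B u (b t) := by
        rw [← zero_sub (b t), weakInduction_sub hB hu hz (hbC t ht), h00, zero_sub]
      rw [weakInduction_sub hB hu hn (hbC t ht), h01]; ring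
    rw [hΦ, weakInduction_sub hB hu hdiff1 hneg, h0]; ring
  rw [hlin (h₁.mem_B t ht).1 (h₁.mem_u t ht).1] at T₁
  rw [hlin (h₂.mem_B t ht).1 (h₂.mem_u t ht).1] at T₂
  have N₁ := abs_weakInduction_le hM₁ hB₁ hu₁ hdiff
  have N₂ := abs_weakInduction_le hM₂ hB₂ hu₂ hdiff
  have hen : (∫ x in cell 3, ‖B₂ s x - B₁ s x‖ ^ 2) - ∫ x in cell 3, ‖B₂ t x - B₁ t x‖ ^ 2 =
      ((∫ x in cell 3, inner ℝ (B₂ s x) (Φ x)) - ∫ x in cell 3, inner ℝ (B₂ t x) (Φ x)) -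
      ((∫ x in cell 3, inner ℝ (B₁ s x) (Φ x)) - ∫ x in cell 3, inner ℝ (B₁ t x) (Φ x)) := by
    have i1 : ∀ {f : Euc 3 → Euc 3}, Continuous f →
        IntegrableOn (fun x => (inner ℝ (f x) (Φ x) : ℝ)) (cell 3) := fun hf =>
      integrableOn_cell (hf.inner hΦC.continuous)
    have i3 : ∀ {f g : Euc 3 → Euc 3}, Continuous f → Continuous g →
        IntegrableOn (fun x => (inner ℝ (f x) (Φ x) - inner ℝ (g x) (Φ x) : ℝ)) (cell 3) :=
      fun hf hg => (i1 hf).sub (i1 hg)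
    have i2 : ∀ r ∈ I, IntegrableOn (fun x => ‖B₂ r x - B₁ r x‖ ^ 2) (cell 3) := fun r hr =>
      integrableOn_cell ((hbC r hr).continuous.norm.pow 2)
    rw [← integral_sub (i2 s hs) (i2 t ht), ← integral_sub (i1 (h₂.mem_B s hs).1)
      (i1 (h₂.mem_B t ht).1), ← integral_sub (i1 (h₁.mem_B s hs).1) (i1 (h₁.mem_B t ht).1),
      ← integral_sub (i3 (h₂.mem_B s hs).1 (h₂.mem_B t ht).1)
        (i3 (h₁.mem_B s hs).1 (h₁.mem_B t ht).1)]
    refine setIntegral_congr_fun (measurableSet_cell 3) fun x _ => ?_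
    have hΦx : Φ x = (B₂ s x - B₁ s x) + (B₂ t x - B₁ t x) := by
      simp only [hΦ, hb, Pi.sub_apply, Pi.neg_apply]; abel
    have e : inner ℝ (B₂ s x) (Φ x) - inner ℝ (B₂ t x) (Φ x) -
        (inner ℝ (B₁ s x) (Φ x) - inner ℝ (B₁ t x) (Φ x)) =
        (inner ℝ ((B₂ s x - B₁ s x) - (B₂ t x - B₁ t x)) (Φ x) : ℝ) := by
      simp only [inner_sub_left]; ring
    refine Eq.trans ?_ e.symm
    rw [hΦx, inner_sub_left, inner_add_right, inner_add_right, real_inner_self_eq_norm_sq,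
      real_inner_self_eq_norm_sq, real_inner_comm (B₂ t x - B₁ t x) (B₂ s x - B₁ s x)]
    ring
  rw [hen, smul_eq_mul, Real.norm_eq_abs, Real.norm_eq_abs]
  have N₃ : |(s - t) * (weakInduction (B₂ t) (u₂ t) (b s - b t) -
      weakInduction (B₁ t) (u₁ t) (b s - b t))| ≤
      (4 * M₁ ^ 2 * V + 4 * M₂ ^ 2 * V) * δ * |s - t| := by
    rw [abs_mul, mul_comm]
    gcongr
    refine (abs_sub _ _).trans ?_
    linarith
  have hfin : (2 * L + 4 * M₁ ^ 2 * V + 4 * M₂ ^ 2 * V) * δ * |s - t| ≤ c * |s - t| := by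
    gcongr
    nlinarith
  rw [abs_le] at T₁ T₂ N₃ ⊢
  constructor <;> linarith [T₁.1, T₁.2, T₂.1, T₂.2, N₃.1, N₃.2]

end Energy

/-! ### Bookkeeping of integrations by parts. -/

section NullMean

/-- Continuous functions of zero mean on the torus. -/
def NullMean (f : Euc 3 → ℝ) : Prop := Continuous f ∧ ∫ x in cell 3, f x = 0

variable {f g J A R : Euc 3 → ℝ}

theorem NullMean.add (hf : NullMean f) (hg : NullMean g) : NullMean fun x => f x + g x :=
  ⟨hf.1.add hg.1, by
    rw [integral_add (integrableOn_cell hf.1) (integrableOn_cell hg.1), hf.2, hg.2, add_zero]⟩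

theorem NullMean.const_mul (hf : NullMean f) (c : ℝ) : NullMean fun x => c * f x :=
  ⟨continuous_const.mul hf.1, by rw [integral_const_mul, hf.2, mul_zero]⟩

/-- Integrations by parts thereby become null-mean summands in a purely pointwise inequality. -/
theorem NullMean.integral_le (hA : NullMean A) (hJ : Continuous J) (hR : Continuous R)
    (h : ∀ x, J x ≤ A x + R x) : ∫ x in cell 3, J x ≤ ∫ x in cell 3, R x := by
  have h1 : ∫ x in cell 3, J x ≤ ∫ x in cell 3, (A x + R x) :=
    setIntegral_mono (integrableOn_cell hJ) (integrableOn_cell (hA.1.add hR)) h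
  rwa [integral_add (integrableOn_cell hA.1) (integrableOn_cell hR), hA.2, zero_add] at h1

theorem DivFree.nullMean {w : Euc 3 → Euc 3} (hw : DivFree w) (hwc : Continuous w)
    (hf : ContDiff ℝ 1 f) (hper : Periodic f) : NullMean fun x => fderiv ℝ f x (w x) :=
  ⟨(hf.continuous_fderiv one_ne_zero).clm_apply hwc, hw.integral_eq_zero hwc hf hper⟩

theorem DivFree.sub {d : ℕ} {v w : Euc d → Euc d} (hv : DivFree v) (hw : DivFree w)
    (hvc : Continuous v) (hwc : Continuous w) : DivFree (v - w) := by
  intro φ hφ hp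
  have hD := hφ.continuous_fderiv (by simp)
  simp only [Pi.sub_apply, map_sub]
  rw [integral_sub (integrableOn_cell (hD.clm_apply hvc)) (integrableOn_cell (hD.clm_apply hwc)),
    hv φ hφ hp, hw φ hφ hp, sub_zero]

end NullMean

/-! ### The energy inequality for uniqueness. -/

section Estimate

theorem neg_mul_le_of_abs_le {a b α β : ℝ} (ha : |a| ≤ α) (hb : |b| ≤ β) : -(a * b) ≤ α * β := by
  have h1 : |a * b| ≤ α * β := by
    rw [abs_mul]
    exact mul_le_mul ha hb (abs_nonneg _) ((abs_nonneg _).trans ha)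
  exact (neg_le_abs _).trans h1

/-- The pointwise inequality behind the energy estimate for the difference of two solutions. -/
theorem energy_pointwise {T₁ T₂ S : Euc 3 →L[ℝ] Euc 3} {a b w G u : Euc 3} {K : ℝ}
    (hS : S = T₂ - T₁) (h₁ : ‖T₁‖ ≤ K) (h₂ : ‖T₂‖ ≤ K) (hw : w = S (a + b) + T₁ b + G)
    (hu : u = (T₁ a 2) • EuclideanSpace.single 2 1) :
    inner ℝ (a + b) (S (u + w)) - inner ℝ (u + w) (S (a + b)) -
        (inner ℝ a (S u) - inner ℝ u (S a)) ≤
      inner ℝ b (S (u + w)) + (inner ℝ a (S w) + inner ℝ (T₁ w) b) + 3 * inner ℝ G w +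
        -1 * (S b 2 * T₁ a 2 - S a 2 * T₁ b 2 - b 2 * (T₁ (S a) 2 - T₁ (T₁ b) 2)) +
        2 * -(inner ℝ G (S (a + b)) - inner ℝ G (T₂ b)) + 12 * K ^ 2 * ‖b‖ ^ 2 := by
  have hK : 0 ≤ K := (norm_nonneg _).trans h₁
  have hb₁ : ‖T₁ b‖ ≤ K * ‖b‖ := (T₁.le_opNorm b).trans (by gcongr)
  have hb₂ : ‖T₂ b‖ ≤ K * ‖b‖ := (T₂.le_opNorm b).trans (by gcongr)
  have hw₁ : ‖T₁ w‖ ≤ K * ‖w‖ := (T₁.le_opNorm w).trans (by gcongr)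
  have hSa₁ : ‖T₁ (S a)‖ ≤ K * ‖S a‖ := (T₁.le_opNorm _).trans (by gcongr)
  have hbb₁ : ‖T₁ (T₁ b)‖ ≤ K * (K * ‖b‖) := (T₁.le_opNorm _).trans (by gcongr)
  -- The derivative of b along B₁ is expressed without derivatives of b: only w, b and the pressure
  -- gradient remain.
  have hSa : S a = w - T₂ b - G := by
    rw [hw, map_add]
    have : S b = T₂ b - T₁ b := by rw [hS]; rfl
    rw [this]; abel
  have hs : ‖S a‖ ≤ ‖w‖ + K * ‖b‖ + ‖G‖ := by
    rw [hSa]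
    exact (norm_sub_le _ _).trans (add_le_add_left ((norm_sub_le _ _).trans (by gcongr)) _)
  have hSab : S (a + b) = w - T₁ b - G := by rw [hw]; abel
  -- The uncontrolled term. Verticality of u leaves a product of third components, exactly what the
  -- commutator summand on the right removes.
  have hub : inner ℝ u (S b) = T₁ a 2 * S b 2 := by
    rw [hu, real_inner_smul_left, EuclideanSpace.inner_single_left]; simp
  -- Source of the dissipation -‖w‖².
  have e1 : inner ℝ w (S (a + b)) = ‖w‖ ^ 2 - inner ℝ w (T₁ b) - inner ℝ G w := by
    rw [hSab, inner_sub_right, inner_sub_right, real_inner_self_eq_norm_sq, real_inner_comm w G]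
  -- Orthogonality of G to w and to S(a + b) - T₂ b forces ∫‖G‖² = -∫⟨G, T₁ b + T₂ b⟩. Its multiple
  -- 2 supplies -2‖G‖² and uses up two of the three copies of ⟨G, w⟩.
  have e2 : inner ℝ G (S (a + b)) = inner ℝ G w - inner ℝ G (T₁ b) - ‖G‖ ^ 2 := by
    rw [hSab, inner_sub_right, inner_sub_right, real_inner_self_eq_norm_sq]
  have e3 : (inner ℝ (a + b) (S (u + w)) - inner ℝ (u + w) (S (a + b)) -
        (inner ℝ a (S u) - inner ℝ u (S a)) : ℝ) =
      inner ℝ a (S w) + inner ℝ b (S (u + w)) - inner ℝ u (S b) - inner ℝ w (S (a + b)) := by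
    simp only [map_add, inner_add_left, inner_add_right]; ring
  rw [e3, e1, e2, hub]
  have ab : ∀ {x y : Euc 3} {ξ η : ℝ}, ‖x‖ ≤ ξ → ‖y‖ ≤ η → |inner ℝ x y| ≤ ξ * η := fun hx hy =>
    (abs_real_inner_le_norm _ _).trans
      (mul_le_mul hx hy (norm_nonneg _) ((norm_nonneg _).trans hx))
  have c2 : ∀ {x : Euc 3} {ξ : ℝ}, ‖x‖ ≤ ξ → |x 2| ≤ ξ := fun hx =>
    (PiLp.norm_apply_le _ 2).trans hx
  have q1 := (abs_le.1 (ab (le_refl ‖w‖) hb₁)).2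
  have q2 := (abs_le.1 (ab hw₁ (le_refl ‖b‖))).1
  have q3 := (abs_le.1 (ab (le_refl ‖G‖) hb₁)).1
  have q4 := (abs_le.1 (ab (le_refl ‖G‖) hb₂)).1
  have q5 := neg_mul_le_of_abs_le (c2 (le_refl ‖S a‖)) (c2 hb₁)
  have q6 := neg_mul_le_of_abs_le (c2 (le_refl ‖b‖)) (c2 hSa₁)
  have q7 := (le_abs_self _).trans (abs_mul (b 2) (T₁ (T₁ b) 2)).le
  have q8 : |b 2| * |T₁ (T₁ b) 2| ≤ ‖b‖ * (K * (K * ‖b‖)) :=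
    mul_le_mul (c2 le_rfl) (c2 hbb₁) (abs_nonneg _) (norm_nonneg _)
  have q9 : 2 * (K * ‖b‖) * ‖S a‖ ≤ 2 * (K * ‖b‖) * (‖w‖ + K * ‖b‖ + ‖G‖) := by gcongr
  -- With β = K‖b‖ what remains is -‖w‖² + 4β‖w‖ - 2‖G‖² + 6β‖G‖ + 3β², which is at most 23β²/2 by
  -- completing the squares.
  nlinarith [sq_nonneg (‖w‖ - 2 * (K * ‖b‖)), sq_nonneg (‖G‖ - 3 / 2 * (K * ‖b‖)),
    sq_nonneg (K * ‖b‖)]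

theorem inner_gradient {d : ℕ} (p : Euc d → ℝ) (x y : Euc d) :
    inner ℝ (gradient p x) y = fderiv ℝ p x y := by
  rw [inner_gradient_left]

/-- The energy estimate for the difference of two stationary configurations, the first of which has
its velocity in the vertical direction. -/
theorem weakInduction_energy_le {B₁ u₁ B₂ u₂ : Euc 3 → Euc 3} {p₁ p₂ : Euc 3 → ℝ} {K : ℝ}
    (hB₁ : ContDiff ℝ 1 B₁) (hB₂ : ContDiff ℝ 1 B₂) (hB₁p : Periodic B₁) (hB₂p : Periodic B₂)
    (hu₁ : Continuous u₁) (hu₂ : Continuous u₂) (dB₁ : DivFree B₁) (dB₂ : DivFree B₂)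
    (du₁ : DivFree u₁) (du₂ : DivFree u₂) (hp₁ : ContDiff ℝ 1 p₁) (hp₂ : ContDiff ℝ 1 p₂)
    (hp₁p : Periodic p₁) (hp₂p : Periodic p₂)
    (e₁ : ∀ x, u₁ x = fderiv ℝ B₁ x (B₁ x) + gradient p₁ x)
    (e₂ : ∀ x, u₂ x = fderiv ℝ B₂ x (B₂ x) + gradient p₂ x)
    (hv : ∀ x, u₁ x = (fderiv ℝ B₁ x (B₁ x) 2) • EuclideanSpace.single 2 1)
    (hK₁ : ∀ x, ‖fderiv ℝ B₁ x‖ ≤ K) (hK₂ : ∀ x, ‖fderiv ℝ B₂ x‖ ≤ K) :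
    weakInduction B₂ u₂ (B₂ - B₁) - weakInduction B₁ u₁ (B₂ - B₁) ≤
      12 * K ^ 2 * ∫ x in cell 3, ‖B₂ x - B₁ x‖ ^ 2 := by
  set b := B₂ - B₁ with hb
  set w := u₂ - u₁ with hw
  set q := p₂ - p₁ with hq
  have hbC : ContDiff ℝ 1 b := hB₂.sub hB₁
  have hbp : Periodic b := fun i x => by simp only [hb, Pi.sub_apply, hB₁p i x, hB₂p i x]
  have hqC : ContDiff ℝ 1 q := hp₂.sub hp₁
  have hqp : Periodic q := fun i x => by simp only [hq, Pi.sub_apply, hp₁p i x, hp₂p i x]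
  have hwc : Continuous w := hu₂.sub hu₁
  have dw : DivFree w := du₂.sub du₁ hu₂ hu₁
  have db : DivFree b := dB₂.sub dB₁ hB₂.continuous hB₁.continuous
  have hd₁ := hB₁.differentiable one_ne_zero
  have hd₂ := hB₂.differentiable one_ne_zero
  have hdb := hbC.differentiable one_ne_zero
  have hDb : ∀ x, fderiv ℝ b x = fderiv ℝ B₂ x - fderiv ℝ B₁ x := fun x =>
    fderiv_sub (hd₂ x) (hd₁ x)
  have hi : ∀ {f : Euc 3 → Euc 3}, ContDiff ℝ 1 f → ContDiff ℝ 1 fun x => f x 2 := fun hf =>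
    contDiff_euclidean.1 hf 2
  have hip : ∀ {f : Euc 3 → Euc 3}, Periodic f → Periodic fun x => f x 2 := fun hf i x => by
    simp only [hf i x]
  have hG : ∀ x, gradient q x = gradient p₂ x - gradient p₁ x := fun x => by
    simp only [gradient, hq]
    rw [fderiv_sub (hp₂.differentiable one_ne_zero x) (hp₁.differentiable one_ne_zero x), map_sub]
  have c₁ := hB₁.continuous_fderiv one_ne_zero
  have c₂ := hB₂.continuous_fderiv one_ne_zero
  have cb := hbC.continuous_fderiv one_ne_zero
  -- Five integrations by parts: transport of ‖b‖² by u₂ (halved below), of B₁·b and of q by w, and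
  -- the two commutator identities.
  have n1 := du₂.nullMean hu₂ (hbC.inner ℝ hbC) (fun i x => by simp only [hbp i x])
  have n2 := dw.nullMean hwc (hB₁.inner ℝ hbC) (fun i x => by simp only [hB₁p i x, hbp i x])
  have n3 := dw.nullMean hwc hqC hqp
  -- Commutator field of B₁ and b with f = b₃, tested on B₁,₃: it exchanges (b·∇b₃)(B₁·∇B₁,₃) for
  -- (B₁·∇b₃)(b·∇B₁,₃) and a term with [B₁, b].
  have n4 := (dB₁.commutator db hB₁ hbC hB₁p hbp (hi hbC) (hip hbp)).nullMean
    (by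
      have := (hi hbC).continuous_fderiv one_ne_zero
      have := hbC.continuous
      have := hB₁.continuous
      fun_prop)
    (hi hB₁) (hip hB₁p)
  -- With f = 1 the field is -[B₂, b]; its orthogonality to ∇q controls the pressure gradient.
  have n5 := (dB₂.commutator db hB₂ hbC hB₂p hbp (f := fun _ => 1) contDiff_const
    (fun _ _ => rfl)).nullMean
    (by
      have := hbC.continuous
      have := hB₂.continuous
      simp only [fderiv_fun_const]
      fun_prop) hqC hqp
  have hA := ((((n1.const_mul 2⁻¹).add n2).add (n3.const_mul 3)).add (n4.const_mul (-1))).add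
    (n5.const_mul 2)
  have hJ : weakInduction B₂ u₂ b - weakInduction B₁ u₁ b =
      ∫ x in cell 3, ((inner ℝ (B₂ x) (fderiv ℝ b x (u₂ x)) - inner ℝ (u₂ x) (fderiv ℝ b x (B₂ x))) -
        (inner ℝ (B₁ x) (fderiv ℝ b x (u₁ x)) - inner ℝ (u₁ x) (fderiv ℝ b x (B₁ x)))) := by
    rw [weakInduction, weakInduction, integral_sub
      (integrableOn_weakInduction hB₂.continuous hu₂ hbC)
      (integrableOn_weakInduction hB₁.continuous hu₁ hbC)]
  have hJc : Continuous fun x => ((inner ℝ (B₂ x) (fderiv ℝ b x (u₂ x)) -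
      inner ℝ (u₂ x) (fderiv ℝ b x (B₂ x))) -
        (inner ℝ (B₁ x) (fderiv ℝ b x (u₁ x)) - inner ℝ (u₁ x) (fderiv ℝ b x (B₁ x))) : ℝ) := by
    have := hB₁.continuous
    have := hB₂.continuous
    fun_prop
  rw [hJ, ← integral_const_mul]
  refine hA.integral_le hJc (continuous_const.mul (hbC.continuous.norm.pow 2)) fun x => ?_
  have hBx : B₂ x = B₁ x + b x := by simp [hb]
  have hux : u₂ x = u₁ x + w x := by simp [hw]
  have hwx : w x = fderiv ℝ b x (B₁ x + b x) + fderiv ℝ B₁ x (b x) + gradient q x := by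
    rw [← hBx, hG, hDb]
    simp only [hw, hb, Pi.sub_apply, e₁ x, e₂ x, sub_apply, map_sub]
    abel
  have main := energy_pointwise (hDb x) (hK₁ x) (hK₂ x) hwx (hv x)
  have f1 : fderiv ℝ (fun x => inner ℝ (b x) (b x)) x (u₂ x) =
      (2 * inner ℝ (b x) (fderiv ℝ b x (u₂ x)) : ℝ) := by
    rw [fderiv_inner_apply ℝ (hdb x) (hdb x), real_inner_comm (b x)]; ring
  have f2 : fderiv ℝ (fun x => inner ℝ (B₁ x) (b x)) x (w x) =
      (inner ℝ (B₁ x) (fderiv ℝ b x (w x)) + inner ℝ (fderiv ℝ B₁ x (w x)) (b x) : ℝ) := by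
    rw [fderiv_inner_apply ℝ (hd₁ x) (hdb x)]
  have g1 : ∀ y, fderiv ℝ (fun x => b x 2) x y = fderiv ℝ b x y 2 := fun y =>
    (fderiv_apply_apply (hdb x) y 2).symm
  have g2 : ∀ y, fderiv ℝ (fun x => B₁ x 2) x y = fderiv ℝ B₁ x y 2 := fun y =>
    (fderiv_apply_apply (hd₁ x) y 2).symm
  rw [← hBx, ← hux] at main
  simp only [inner_gradient] at main
  simp only [f1, f2, g1, g2, map_sub, map_smul, PiLp.sub_apply, PiLp.smul_apply, smul_eq_mul,
    fderiv_fun_const, Pi.zero_apply, zero_apply, zero_mul, one_mul]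
  refine main.trans (le_of_eq ?_)
  simp only [hb, Pi.sub_apply]
  ring

end Estimate

/-! ### Gronwall argument and recovery of the velocity. -/

section Uniqueness

variable {k : ℕ} {T : ℝ} {B₁ u₁ B₂ u₂ : ℝ → Euc 3 → Euc 3}

theorem IsMRESolution.exists_uniform_bound {I J : Set ℝ} {B u : ℝ → Euc 3 → Euc 3} (hk : 3 ≤ k)
    (h : IsMRESolution k I B u) (hJ : IsCompact J) (hJI : J ⊆ I) :
    ∃ K, ∀ s ∈ J, ∀ x, ‖fderiv ℝ (B s) x‖ ≤ K := by
  refine hJ.induction_on (p := fun J => ∃ K, ∀ s ∈ J, ∀ x, ‖fderiv ℝ (B s) x‖ ≤ K) ⟨0, by simp⟩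
    (fun s t hst ⟨K, hK⟩ => ⟨K, fun r hr => hK r (hst hr)⟩) ?_ fun t ht => ?_
  · rintro s t ⟨K, hK⟩ ⟨K', hK'⟩
    refine ⟨max K K', fun r hr x => ?_⟩
    rcases hr with hr | hr
    · exact (hK r hr x).trans (le_max_left _ _)
    · exact (hK' r hr x).trans (le_max_right _ _)
  · obtain ⟨M, -, -, hM, -⟩ := h.exists_bound hk (hJI ht)
    refine ⟨_, nhdsWithin_mono t hJI (h.eventually_close hk (hJI ht) one_pos), M + 1, ?_⟩
    rintro s ⟨-, -, hs, -⟩ x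
    have h1 := norm_add_le (fderiv ℝ (B t) x) (fderiv ℝ (B s) x - fderiv ℝ (B t) x)
    rw [add_sub_cancel] at h1
    linarith [hM x, hs x]

/-- Uniqueness, relative to a solution whose velocity is vertical. -/
theorem IsMRESolution.unique (hk : 3 ≤ k) (h₁ : IsMRESolution k (Ico 0 T) B₁ u₁)
    (h₂ : IsMRESolution k (Ico 0 T) B₂ u₂) (h0 : B₂ 0 = B₁ 0)
    (hv : ∀ t ∈ Ico 0 T, ∀ x,
      u₁ t x = (fderiv ℝ (B₁ t) x (B₁ t x) 2) • EuclideanSpace.single 2 1)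
    {t : ℝ} (ht : t ∈ Ico 0 T) : B₂ t = B₁ t ∧ u₂ t = u₁ t := by
  have hsub : Icc 0 t ⊆ Ico 0 T := fun s hs => ⟨hs.1, hs.2.trans_lt ht.2⟩
  obtain ⟨K₁, hK₁⟩ := h₁.exists_uniform_bound hk isCompact_Icc hsub
  obtain ⟨K₂, hK₂⟩ := h₂.exists_uniform_bound hk isCompact_Icc hsub
  set K := max K₁ K₂ with hK
  set E : ℝ → ℝ := fun s => ∫ x in cell 3, ‖B₂ s x - B₁ s x‖ ^ 2 with hE
  have hder : ∀ s ∈ Ico 0 T, HasDerivWithinAt E _ (Ico 0 T) s := fun s hs =>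
    h₁.hasDerivWithinAt_energy hk (convex_Ico 0 T) h₂ hs
  have hgr := le_mul_exp_of_deriv_right_le (f := E) (T := t) (G := 2 * (12 * K ^ 2))
    (fun s hs => ((hder s (hsub hs)).continuousWithinAt).mono hsub)
    (fun s hs => (hder s (hsub (Ico_subset_Icc_self hs))).mono_of_mem_nhdsWithin
      (mem_of_superset (Ico_mem_nhdsGE (hs.2.trans ht.2)) (Ico_subset_Ico_left hs.1)))
    (fun s hs => by
      have hs' := hsub (Ico_subset_Icc_self hs)
      obtain ⟨p₁, hp₁, hp₁p, e₁⟩ := h₁.constitutive s hs'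
      obtain ⟨p₂, hp₂, hp₂p, e₂⟩ := h₂.constitutive s hs'
      have := weakInduction_energy_le (h₁.contDiff hk hs') (h₂.contDiff hk hs') (h₁.mem_B s hs').2.1
        (h₂.mem_B s hs').2.1 (h₁.mem_u s hs').1 (h₂.mem_u s hs').1 (h₁.div_B s hs')
        (h₂.div_B s hs') (h₁.div_u s hs') (h₂.div_u s hs') hp₁ hp₂ hp₁p hp₂p e₁ e₂ (hv s hs')
        (K := K) (fun x => (hK₁ s (Ico_subset_Icc_self hs) x).trans (le_max_left _ _))
        (fun x => (hK₂ s (Ico_subset_Icc_self hs) x).trans (le_max_right _ _))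
      rw [mul_assoc 2]
      exact mul_le_mul_of_nonneg_left this zero_le_two) (t := t) ⟨ht.1, le_rfl⟩
  have hE0 : E 0 = 0 := by simp [hE, h0]
  rw [hE0, zero_mul] at hgr
  have hEt : ∫ x in cell 3, ‖(B₂ t - B₁ t) x‖ ^ 2 = 0 :=
    le_antisymm hgr (integral_nonneg fun _ => sq_nonneg _)
  have hB : B₂ t = B₁ t := sub_eq_zero.1 (eq_zero_of_integral_norm_sq
    ((h₂.mem_B t ht).1.sub (h₁.mem_B t ht).1)
    ((h₂.mem_B t ht).sub (h₁.mem_B t ht)).2.1 hEt)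
  refine ⟨hB, ?_⟩
  obtain ⟨p₁, hp₁, hp₁p, e₁⟩ := h₁.constitutive t ht
  obtain ⟨p₂, hp₂, hp₂p, e₂⟩ := h₂.constitutive t ht
  have hu := (h₂.mem_u t ht).sub (h₁.mem_u t ht)
  -- Once the magnetic fields agree, u₂ - u₁ is a gradient; being divergence free, it is orthogonal
  -- to itself.
  have hdiv := (h₂.div_u t ht).sub (h₁.div_u t ht) (h₂.mem_u t ht).1 (h₁.mem_u t ht).1
  have hz := hdiv.integral_eq_zero hu.1 (hp₂.sub hp₁) (fun i x => by
    simp only [hp₁p i x, hp₂p i x])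
  refine sub_eq_zero.1 (eq_zero_of_integral_norm_sq hu.1 hu.2.1 ?_)
  rw [← hz]
  refine setIntegral_congr_fun (measurableSet_cell 3) fun x _ => ?_
  have hg : fderiv ℝ (fun x => p₂ x - p₁ x) x ((u₂ t - u₁ t) x) =
      inner ℝ (gradient p₂ x - gradient p₁ x) ((u₂ t - u₁ t) x) := by
    rw [fderiv_fun_sub (hp₂.differentiable one_ne_zero x) (hp₁.differentiable one_ne_zero x),
      sub_apply, inner_sub_left, inner_gradient, inner_gradient]
  have hux : (u₂ t - u₁ t) x = gradient p₂ x - gradient p₁ x := by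
    rw [Pi.sub_apply, e₁ x, e₂ x, hB]; abel
  simp only [hg]
  rw [← hux, real_inner_self_eq_norm_sq]

end Uniqueness

end

end MRE

/-! ### Assembly of the theorem. -/

theorem theorem6p2 (k : ℕ) (hk : 3 ≤ k) :
    ∃ C : ℝ, 0 < C ∧
      ∀ g₀ : MRE.Euc 2 → ℝ, MRE.MemSobolev k g₀ → gradient g₀ 0 ≠ 0 →
        ∃ B u : ℝ → MRE.Euc 3 → MRE.Euc 3,
          -- existence of a global solution with the given initial data
          MRE.IsMRESolution k (Set.Ici 0) B u ∧
          B 0 = MRE.twoHalf MRE.cellularFlow g₀ ∧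
          u 0 = MRE.twoHalf 0 (MRE.advect MRE.cellularFlow g₀) ∧
          -- uniqueness, also among solutions on shorter time intervals
          (∀ T : ℝ, 0 < T → ∀ B' u' : ℝ → MRE.Euc 3 → MRE.Euc 3,
            MRE.IsMRESolution k (Set.Ico 0 T) B' u' →
            B' 0 = MRE.twoHalf MRE.cellularFlow g₀ →
            ∀ t ∈ Set.Ico 0 T, B' t = B t ∧ u' t = u t) ∧
          -- the form of the solution
          (∃ g : ℝ → MRE.Euc 2 → ℝ, MRE.IsRankOneSolution k (Set.Ici 0) g ∧ g 0 = g₀ ∧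
            ∀ t : ℝ, 0 ≤ t → B t = MRE.twoHalf MRE.cellularFlow (g t) ∧
              u t = MRE.twoHalf 0 (MRE.advect MRE.cellularFlow (g t))) ∧
          -- exponential growth of the gradient
          ∀ t : ℝ, 0 ≤ t → ContDiff ℝ 1 (B t) ∧
            ENNReal.ofReal (‖gradient g₀ 0‖ * Real.exp t) ≤ MRE.gradSupNorm (B t) ∧
            MRE.gradSupNorm (B t) ≤
              ENNReal.ofReal C *
                MRE.vecSobolevNorm k (MRE.twoHalf MRE.cellularFlow g₀) *
                ENNReal.ofReal (Real.exp (C * t)) := by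
  have hE := MRE.embConst_nonneg 3
  have hG := MRE.growthRate_nonneg k
  refine ⟨3 * MRE.embConst 3 + MRE.growthRate k + 1, by positivity, fun g₀ hg₀ _ => ?_⟩
  have h0 : MRE.rankOne g₀ 0 = g₀ := MRE.rankOne_zero (by omega) hg₀
  have hsol := MRE.isMRESolution_rankOne hk hg₀
  refine ⟨_, _, hsol, by simp only [h0], by simp only [h0], fun T _ B' u' h' hB' t ht => ?_,
    ⟨MRE.rankOne g₀, MRE.isRankOneSolution_rankOne hk hg₀, h0, fun _ _ => ⟨rfl, rfl⟩⟩,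
    fun t ht => ⟨hsol.contDiff hk ht, MRE.le_gradSupNorm_rankOne hk hg₀ ht,
      MRE.gradSupNorm_rankOne_le hk hg₀ ht (by linarith) (by linarith)⟩⟩
  -- The remaining obligation is verticality: the third component of B·∇B is v·∇g, which is the
  -- whole velocity.
  refine (hsol.mono Set.Ico_subset_Ici_self).unique hk h' (by simp only [hB', h0])
    (fun s hs x => ?_) ht
  have hC := (MRE.memSobolev_rankOne (by omega) hg₀ hs.1).contDiff (by norm_num) hk
  rw [MRE.fderiv_twoHalf_apply MRE.contDiff_cellularFlow hC, MRE.twoHalf_zero_eq]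
  have hx : MRE.horiz (MRE.twoHalf MRE.cellularFlow (MRE.rankOne g₀ s) x) =
      MRE.cellularFlow (MRE.horiz x) := by
    ext j; fin_cases j <;> rfl
  rw [hx]
  rfl
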